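/- All graphs are finite and simple. Write $\deg(u)$ for the degree of $u$ and $\log$ for the natural logarithm. Let $k\ge 3$ be an integer and $t\ge \tfrac12$ a real number. Say that a graph $G$ is *$(k,t)$-locally sparse* if for every vertex $u$ the subgraph of $G$ induced by the neighbourhood $N(u)$ contains at most $t$ copies of $P_{k-1}$, the path on $k-1$ vertices (a copy is a not necessarily induced subgraph isomorphic to $P_{k-1}$). **Definitions.** $Z_G(\lambda)=\sum_I\lambda^{|I|}$, the sum being over all independent sets $I$ of $G$, is the partition function of the hard-core model, whose occupancy fraction is $\frac1{|V(G)|}\frac{\lambda Z_G'(\lambda)}{Z_G(\lambda)}$. $W:[-1/e,\infty)\to[-1,\infty)$ is the principal branch of the Lambert function (the inverse of $x\mapsto xe^x$ on $[-1,\infty)$), and $W(y)/y$ is read as $1$ at $y=0$. A fractional $q$-colouring of $G$ is an assignment of pairwise disjoint intervals $w(I)\subseteq[0,q)$ to the independent sets $I$ of $G$ such that $\sum_{I\ni v}|w(I)|=1$ for every vertex $v$; then $v$ is coloured with $\bigcup_{I\ni v}w(I)$. $\chi_f(G)$ is the least $q$ for which $G$ has a fractional $q$-colouring. A cover $\mathscr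 H=(L,H)$ of $G$ consists of a finite graph $H$ and sets $L(u)\subseteq V(H)$ $(u\in V(G))$ that partition $V(H)$, such that each $H[L(u)]$ is complete, edges of $H$ between $L(u)$ and $L(v)$ with $u\ne v$ exist only if $uv\in E(G)$, and in that case they form a (possibly empty) matching. $G$ is $\mathscr H$-colourable if $H$ has an independent set of size $|V(G)|$. $\chi_c(G)$ is the least $q$ such that $G$ is $\mathscr H$-colourable for every cover $\mathscr H$ with $|L(u)|=q$ for all $u$. **Theorem.** 1. Let $G$ be a $(k,t)$-locally sparse graph with at least one vertex and of maximum degree $\Delta$. For any $\lambda>0$, $$\frac{1}{|V(G)|}\frac{\lambda Z_G'(\lambda)}{Z_G(\lambda)}\ \ge\ \max_{0\le x\le\lambda}\left\{\frac{x}{1+x}\,\frac{W\big(\Delta(1+x)^{k-3+\sqrt{2t}}\log(1+x)\big)}{\Delta(1+x)^{k-3+\sqrt{2t}}\log(1+x)}\right\}.$$ 2. For any $\varepsilon>0$ there exists $\delta_0>1$ (depending only on $\varepsilon$) such that, for all $k\ge3$ and $t\ge\frac12$, every $(k,t)$-locally sparse graph $G$ has a fractional colouring in which each vertex $u$ is coloured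 with a subset of $$\left[0,\ (1+\varepsilon)\max\left\{\frac{\deg(u)}{\log(\deg(u)/(k+\sqrt t))},\ \frac{\delta_0}{\log\delta_0}(k+\sqrt t)\right\}\right).$$ In particular, if $k=k(\Delta)\ge3$ and $t=t(\Delta)\ge\frac12$ satisfy $\Delta/(k+\sqrt t)\to\infty$ as $\Delta\to\infty$, then $$\chi_f(G)\le(1+o(1))\,\frac{\Delta}{\log(\Delta/(k+\sqrt t))}$$ for every $(k,t)$-locally sparse graph $G$ of maximum degree $\Delta$, where the $o(1)$ term depends only on $\Delta$ and on the functions $k$ and $t$. 3. For any $\varepsilon>0$ there exist $\delta_0>1$ and $\Delta_0$ (depending only on $\varepsilon$) such that the following holds for all $\Delta\ge\Delta_0$, $k\ge3$, $t\ge\frac12$ and every $(k,t)$-locally sparse graph $G$ of maximum degree $\Delta$. If $\mathscr H=(L,H)$ is a cover of $G$ such that for each vertex $u$ $$|L(u)|\ \ge\ (1+\varepsilon)\max\left\{\frac{\deg(u)}{\log\big(\deg(u)/((k+\sqrt t)\log\Delta)\big)},\ \frac{\delta_0}{\log\delta_0}(k+\sqrt t)\log\Delta\right\},$$ then $G$ is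 $\mathscr H$-colourable. In particular, if $k=k(\Delta)\ge3$ and $t=t(\Delta)\ge\frac12$ satisfy $k+\sqrt t=\Delta^{o(1)}$ as $\Delta\to\infty$, then $$\chi_c(G)\le(1+o(1))\,\frac{\Delta}{\log\Delta}$$ for every $(k,t)$-locally sparse graph $G$ of maximum degree $\Delta$, where the $o(1)$ term depends only on $\Delta$ and on the functions $k$ and $t$. In the maxima of parts 2 and 3 the first argument is disregarded when it is undefined ($\deg(u)=0$, or the logarithm in its denominator is $0$). -/

import Mathlib

open Filter Topology

universe u v

noncomputable section

/-- The principal branch `W : [-1/e, ∞) → [-1, ∞)` of the Lambert function, that is, the inverse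
of the restriction of `x ↦ x * exp x` to `[-1, ∞)`. -/
def lambertW (y : ℝ) : ℝ :=
  Function.invFunOn (fun x : ℝ => x * Real.exp x) (Set.Ici (-1)) y

/-- The function `y ↦ W(y) / y`, with its limit `1` as value at `y = 0`. -/
def lambertRatio (y : ℝ) : ℝ :=
  if y = 0 then 1 else lambertW y / y

namespace SimpleGraph

section Occupancy

variable {V : Type u} [Fintype V]

open Classical in
/-- The partition function `Z_G(lam) = ∑ lam ^ |I|` of the hard-core model on `G`, where the sum
is over all independent sets `I` of `G` (including the empty set). -/
def hardCoreZ (G : SimpleGraph V) (lam : ℝ) : ℝ :=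
  ∑ I ∈ Finset.univ.filter (fun I : Finset V => G.IsIndepSet (I : Set V)), lam ^ Finset.card I

/-- The occupancy fraction `(1 / |V(G)|) * (lam * Z_G'(lam) / Z_G(lam))` of the hard-core model
on `G` at fugacity `lam`. -/
def occupancyFraction (G : SimpleGraph V) (lam : ℝ) : ℝ :=
  1 / (Fintype.card V : ℝ) * (lam * deriv G.hardCoreZ lam / G.hardCoreZ lam)

open Classical in
/-- For each vertex `u`, the subgraph of `G` induced by the (open) neighbourhood of `u` contains at
most `t` copies of the path `P_{k-1}` on `k - 1` vertices. A copy is a subgraph isomorphic to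
`P_{k-1}` (copies are unlabelled). -/
def NbhdPathCountLE (G : SimpleGraph V) (k : ℕ) (t : ℝ) : Prop :=
  ∀ u : V, ((G.induce (G.neighborSet u)).copyCount (pathGraph (k - 1)) : ℝ) ≤ t

open Classical in
/-- `w` is a fractional `q`-colouring of `G`: it assigns to the independent sets of `G` pairwise
disjoint intervals contained in `[0, q)` such that, for each vertex, the total length of the
intervals of the independent sets containing it is `1`. (Sets which are not independent get the
empty interval.) -/
structure IsFractionalColouring (G : SimpleGraph V) (q : ℝ) (w : Finset V → Set ℝ) : Prop where
  eq_empty : ∀ I : Finset V, ¬ G.IsIndepSet (I : Set V) → w I = ∅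
  ordConnected : ∀ I : Finset V, (w I).OrdConnected
  subset_Ico : ∀ I : Finset V, w I ⊆ Set.Ico 0 q
  disjoint : Pairwise fun I J : Finset V => Disjoint (w I) (w J)
  sum_length : ∀ x : V,
    ∑ I ∈ Finset.univ.filter (fun I : Finset V => x ∈ I),
      MeasureTheory.volume (w I) = 1

/-- The set of colours that the vertex `x` receives under `w`. -/
def fractionalColours (w : Finset V → Set ℝ) (x : V) : Set ℝ :=
  ⋃ I : Finset V, ⋃ _ : x ∈ I, w I

/-- The fractional chromatic number. -/
def fracChromaticNumber (G : SimpleGraph V) : ℝ :=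
  sInf {q : ℝ | ∃ w : Finset V → Set ℝ, G.IsFractionalColouring q w}

end Occupancy

/-- A cover `(L, H)` of `G`, where `H` is a graph with vertex set `W`. -/
structure Cover {V : Type u} (G : SimpleGraph V) (W : Type v) where
  /-- the cover graph -/
  H : SimpleGraph W
  /-- the lists -/
  L : V → Finset W
  /-- the lists partition the vertex set of `H` -/
  partition : ∀ x : W, ∃! a : V, x ∈ L a
  /-- each list induces a complete graph -/
  isClique : ∀ a : V, H.IsClique (L a : Set W)
  /-- edges between different lists only occur along edges of `G` -/
  adj_of_adj : ∀ (a b : V) (x y : W), x ∈ L a → y ∈ L b → H.Adj x y → a = b ∨ G.Adj a b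
  /-- along an edge `ab` of `G` the edges between the two lists form a matching: each `x ∈ L a` has
  at most one neighbour in `L b` (and vice versa, by exchanging `a` and `b`) -/
  matching : ∀ a b : V, G.Adj a b → ∀ x ∈ L a, ∀ y ∈ L b, ∀ z ∈ L b,
    H.Adj x y → H.Adj x z → y = z

/-- `G` is colourable with respect to the cover `C = (L, H)`: the graph `H` has an independent set
of size `|V(G)|`. -/
def Cover.Colourable {V : Type u} [Fintype V] {G : SimpleGraph V} {W : Type v}
    (C : G.Cover W) : Prop :=
  ∃ I : Finset W, C.H.IsIndepSet (I : Set W) ∧ I.card = Fintype.card V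

/-- The correspondence chromatic number (DP-chromatic number): the least `q` such that `G` is
colourable with respect to each of its `q`-fold covers. -/
def corrChromaticNumber {V : Type u} [Fintype V] (G : SimpleGraph V) : ℕ :=
  sInf {q : ℕ | ∀ (W : Type u) (C : G.Cover W), (∀ a : V, (C.L a).card = q) → C.Colourable}

end SimpleGraph

end

/-! The path hypothesis enters only through local density: every vertex set inside a neighbourhood
spans average degree at most `a = k - 3 + √(2t)`. Deleting an edge from each copy of the path leaves
a graph whose average degrees Erdős–Gallai bounds by `k - 3`. The at most `t` deleted edges add at
most `2t` to a degree sum, which is at most `√(2t)|S|` unless `S` is so small that the trivial bound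
`|S| - 1` on degrees suffices (`NbhdPathCountLE.localDensityLE`).

On a graph with vertex set `F` of average degree at most `a`, the hard-core model at fugacity `λ`
has mean size at least `λ(1+λ)^(-(a+1))|F|` by convexity (`le_hcSum_card`), while `log Z ≤ |F|
log(1+λ)`. So if `Z` is large, many vertices are occupied on average; if `Z` is small, the empty set
is likely. `local_occupancy` quantifies this with a free parameter `w ≥ 0`. Given the configuration
outside `N(u)`, the model inside is hard-core on the uncovered neighbours, so averaging yields `β
P(u ∈ I) + γ E|I ∩ N(u)| ≥ 1` (`LocalDensityLE.vertex_occupancy`).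

Summing over `u` bounds the occupancy fraction, the optimal `w` being a Lambert value. For
fractional colouring, the inequality holds on every induced subgraph, so one may repeatedly use the
hard-core distribution on the vertices not yet fully coloured: a vertex `u` is finished by time `β +
γ deg(u)`. With `K = k + √t`, `λ = η/K` for a small `η`, and `w` close to `log(deg(u)/K)`, this
deadline is the claimed bound.

For correspondence colouring, take a random hard-core set `I` in the cover graph. The elements `x ∈
L(u)` have disjoint blocks of neighbours in the lists of `N(u)`, each inheriting the local density
of `G`. Each block is often empty or has many occupied elements on average; the total occupation is
at most `deg(u)`, so many `x` stay available. An exponential form of this (`hcSum_tilt_le`) makes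
failure polynomially unlikely in `Δ`, even conditionally on everything outside the neighbouring
lists. It is equally unlikely that an available `x` keeps many uncovered neighbours. The lopsided
local lemma then gives an `I` without bad vertices, and an independent transversal in the available
lists completes the colouring. -/

namespace SimpleGraph

/-! ### Erdős–Gallai bound for graphs without long paths -/

section ErdosGallai

open Classical in
/-- The number of neighbours of `v` inside the finite set `S`. -/
noncomputable def degIn {V : Type*} (G : SimpleGraph V) (S : Finset V) (v : V) : ℕ :=
  (S.filter (fun w => G.Adj v w)).card

variable {V : Type*} {G : SimpleGraph V}

lemma isChain_append_singleton_of_getLast {l : List V} (hl : l.IsChain G.Adj) {y : V}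
    (h : ∀ x ∈ l.getLast?, G.Adj x y) : (l ++ [y]).IsChain G.Adj := by
  rw [List.isChain_append]
  refine ⟨hl, by simp, ?_⟩
  intro x hx z hz
  simp at hz
  subst hz
  exact h x hx

lemma getLast?_take_succ {l : List V} {i : ℕ} (hi : i < l.length) :
    (l.take (i + 1)).getLast? = some l[i] := by
  rw [List.getLast?_eq_getElem?, List.length_take, min_eq_left (by omega), Nat.add_sub_cancel,
    List.getElem?_take_of_lt (by omega), List.getElem?_eq_getElem hi]

/-- A closed chain of length at least two stays a chain under rotation. -/
lemma isChain_rotate {l : List V} (hl : l.IsChain G.Adj)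
    (h : ∀ x ∈ l.getLast?, ∀ y ∈ l.head?, G.Adj x y) (j : ℕ) (hj : j ≤ l.length) :
    (l.rotate j).IsChain G.Adj := by
  rw [List.rotate_eq_drop_append_take hj, List.isChain_append]
  refine ⟨hl.drop j, hl.take j, ?_⟩
  intro x hx y hy
  refine h x ?_ y ?_
  · rw [List.getLast?_drop] at hx
    split_ifs at hx with h1
    · simp at hx
    · exact hx
  · rw [List.head?_take] at hy
    split_ifs at hy with h1
    · simp at hy
    · exact hy

/-- From a closed chain through all vertices of `l` and an edge leaving it, one gets a longer
path. -/
lemma exists_longer_of_cycle {l : List V} (hl : l.IsChain G.Adj) (hn : l.Nodup)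
    (h : ∀ x ∈ l.getLast?, ∀ y ∈ l.head?, G.Adj x y) {x y : V} (hx : x ∈ l) (hy : y ∉ l)
    (hxy : G.Adj x y) :
    ∃ l' : List V, l'.IsChain G.Adj ∧ l'.Nodup ∧ (∀ z ∈ l', z ∈ l ∨ z = y) ∧
      l'.length = l.length + 1 := by
  obtain ⟨j, hj, rfl⟩ := List.getElem_of_mem hx
  refine ⟨l.rotate (j + 1) ++ [y], ?_, ?_, ?_, by simp⟩
  · refine isChain_append_singleton_of_getLast (isChain_rotate hl h _ hj) ?_
    intro z hz
    have : z = l[j] := by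
      rw [List.rotate_eq_drop_append_take (by omega), List.getLast?_append,
        getLast?_take_succ hj] at hz
      simpa using hz.symm
    rw [this]; exact hxy
  · rw [List.nodup_append]
    refine ⟨by simpa using hn, by simp, ?_⟩
    intro a ha b hb
    simp at ha hb
    subst hb
    rintro rfl
    exact hy ha
  · intro z hz
    simpa using hz

/-- Rotating a path whose first vertex is adjacent to the successor of a neighbour of the last
vertex closes it up to a cycle on the same vertices. -/
lemma exists_cycle_of_crossing {l : List V} (hl : l.IsChain G.Adj) {i : ℕ}
    (hi : i + 1 < l.length) (h0 : G.Adj (l[0]'(by omega)) l[i + 1])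
    (h1 : G.Adj (l[l.length - 1]'(by omega)) l[i]) :
    ∃ c : List V, c.IsChain G.Adj ∧ c.Perm l ∧
      ∀ x ∈ c.getLast?, ∀ y ∈ c.head?, G.Adj x y := by
  refine ⟨(l.take (i + 1)).reverse ++ l.drop (i + 1), ?_, ?_, ?_⟩
  · rw [List.isChain_append]
    refine ⟨?_, hl.drop _, ?_⟩
    · rw [List.isChain_reverse]
      refine (hl.take _).imp ?_
      intro a b hab
      exact hab.symm
    · intro x hx y hy
      rw [List.getLast?_reverse, List.head?_take, if_neg (by omega)] at hx
      rw [List.head?_drop] at hy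
      rw [List.head?_eq_getElem?, List.getElem?_eq_getElem (by omega)] at hx
      rw [List.getElem?_eq_getElem hi] at hy
      simp at hx hy
      rw [← hx, ← hy]; exact h0
  · calc ((l.take (i + 1)).reverse ++ l.drop (i + 1)).Perm (l.take (i + 1) ++ l.drop (i + 1)) :=
          List.Perm.append_right _ (List.reverse_perm _)
      _ = l := List.take_append_drop _ _
  · intro x hx y hy
    rw [List.getLast?_append, List.getLast?_drop, if_neg (by omega)] at hx
    rw [List.head?_append, List.head?_reverse, getLast?_take_succ (by omega)] at hy
    rw [List.getLast?_eq_getElem?, List.getElem?_eq_getElem (by omega)] at hx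
    simp at hx hy
    rw [← hx, ← hy]; exact h1

/-- The Erdős–Gallai bound: if every path has at most `d + 1` vertices, then every finite set of
vertices spans average degree at most `d`. -/
theorem sum_degIn_le_of_path_length_le {d : ℕ}
    (hfree : ∀ l : List V, l.IsChain G.Adj → l.Nodup → l.length ≤ d + 1) (S : Finset V) :
    ∑ v ∈ S, G.degIn S v ≤ d * S.card := by
  classical
  induction S using Finset.strongInduction with
  | H S ih =>
  by_cases hS : S = ∅
  · simp [hS]
  by_cases hsmall : S.card ≤ d + 1
  · calc ∑ v ∈ S, G.degIn S v ≤ ∑ v ∈ S, d := by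
          refine Finset.sum_le_sum fun v hv => ?_
          have : S.filter (fun w => G.Adj v w) ⊆ S.erase v := by
            intro w hw
            simp only [Finset.mem_filter] at hw
            exact Finset.mem_erase.2 ⟨hw.2.ne', hw.1⟩
          have := Finset.card_le_card this
          rw [Finset.card_erase_of_mem hv] at this
          unfold degIn
          convert this.trans (by omega : S.card - 1 ≤ d)
      _ = d * S.card := by simp [mul_comm]
  push Not at hsmall
  -- a closed proper part splits the sum
  by_cases hdisc : ∃ T ⊆ S, T.Nonempty ∧ T ≠ S ∧ ∀ x ∈ T, ∀ y ∈ S, G.Adj x y → y ∈ T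
  · obtain ⟨T, hTS, hT, hne, hcl⟩ := hdisc
    have h1 := ih T (Finset.ssubset_iff_subset_ne.2 ⟨hTS, hne⟩)
    have h2 := ih (S \ T) (Finset.sdiff_ssubset hTS hT)
    have e1 : ∀ v ∈ T, G.degIn S v = G.degIn T v := by
      intro v hv
      unfold degIn
      congr 1
      ext w
      simp only [Finset.mem_filter]
      exact ⟨fun h => ⟨hcl v hv w h.1 h.2, h.2⟩, fun h => ⟨hTS h.1, h.2⟩⟩
    have e2 : ∀ v ∈ S \ T, G.degIn S v = G.degIn (S \ T) v := by
      intro v hv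
      unfold degIn
      congr 1
      ext w
      simp only [Finset.mem_filter, Finset.mem_sdiff] at hv ⊢
      exact ⟨fun h => ⟨⟨h.1, fun hw => hv.2 (hcl w hw v hv.1 h.2.symm)⟩, h.2⟩,
        fun h => ⟨h.1.1, h.2⟩⟩
    rw [← Finset.sum_sdiff hTS, Finset.sum_congr rfl e1, Finset.sum_congr rfl e2,
      ← Finset.card_sdiff_add_card_eq_card hTS, mul_add]
    exact add_le_add h2 h1
  push Not at hdisc
  -- Deleting `v` lowers the degree sum by `2 * G.degIn S v`, hence by at most the `d` lost on the
  -- right-hand side.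
  by_cases hmin : ∃ v ∈ S, 2 * G.degIn S v ≤ d
  · obtain ⟨v, hv, hvd⟩ := hmin
    have h1 := ih (S.erase v) (Finset.erase_ssubset hv)
    have key : ∑ w ∈ S.erase v, G.degIn S w =
        ∑ w ∈ S.erase v, G.degIn (S.erase v) w + G.degIn S v := by
      have e : ∀ w ∈ S.erase v, G.degIn S w =
          G.degIn (S.erase v) w + if G.Adj v w then 1 else 0 := by
        intro w hw
        unfold degIn
        conv_lhs => rw [← Finset.insert_erase hv, Finset.filter_insert]
        simp only [G.adj_comm v w]
        split_ifs with h
        · rw [Finset.card_insert_of_notMem (by simp)]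
        · rfl
      rw [Finset.sum_congr rfl e, Finset.sum_add_distrib]
      congr 1
      rw [← Finset.card_filter]
      unfold degIn
      congr 1
      ext w
      simp only [Finset.mem_filter, Finset.mem_erase]
      exact ⟨fun h => ⟨h.1.2, h.2⟩, fun h => ⟨⟨h.2.ne', h.1⟩, h.2⟩⟩
    rw [← Finset.add_sum_erase _ _ hv, key]
    have : S.card = (S.erase v).card + 1 := by
      rw [Finset.card_erase_of_mem hv]; have := Finset.card_pos.2 ⟨v, hv⟩; omega
    rw [this, mul_add]
    omega
  push Not at hmin
  exfalso
  -- a longest path inside `S`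
  obtain ⟨s, hs⟩ := Finset.nonempty_iff_ne_empty.2 hS
  let P : ℕ → Prop := fun n => ∃ l : List V, l.IsChain G.Adj ∧ l.Nodup ∧ (∀ z ∈ l, z ∈ S) ∧
    l.length = n
  have hP1 : P 1 := ⟨[s], by simp, by simp, by simpa using hs, rfl⟩
  have hPb : ∀ n, P n → n ≤ d + 1 := by
    rintro n ⟨l, h1, h2, -, rfl⟩; exact hfree l h1 h2
  have hPm : P (Nat.findGreatest P (d + 1)) := Nat.findGreatest_spec (P := P) (by omega) hP1
  have hmax : ∀ n, P n → n ≤ Nat.findGreatest P (d + 1) :=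
    fun n hn => Nat.le_findGreatest (hPb n hn) hn
  obtain ⟨l, hl, hn, hlS, hlen⟩ := hPm
  rw [← hlen] at hmax
  have hpos : 1 ≤ l.length := hmax 1 hP1
  have hle : l.length ≤ d + 1 := hfree l hl hn
  have hmem : ∀ (i : ℕ) (hi : i < l.length), l[i] ∈ S := fun i hi => hlS _ (List.getElem_mem hi)
  have hlast : ∀ y ∈ S, G.Adj (l[l.length - 1]'(by omega)) y → y ∈ l := by
    intro y hy hadj
    by_contra hyl
    have := hmax (l.length + 1) ⟨l ++ [y], ?_, ?_, ?_, by simp⟩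
    · omega
    · refine isChain_append_singleton_of_getLast hl ?_
      intro x hx
      rw [List.getLast?_eq_getElem?, List.getElem?_eq_getElem (by omega)] at hx
      simp at hx
      rw [← hx]; exact hadj
    · rw [List.nodup_append]
      refine ⟨hn, by simp, ?_⟩
      intro a ha b hb
      simp at hb
      subst hb
      rintro rfl
      exact hyl ha
    · intro z hz
      simp at hz
      rcases hz with hz | rfl
      · exact hlS z hz
      · exact hy
  have hfirst : ∀ y ∈ S, G.Adj (l[0]'(by omega)) y → y ∈ l := by
    intro y hy hadj
    by_contra hyl
    have := hmax (l.length + 1) ⟨y :: l, ?_, by simp [hyl, hn], ?_, by simp⟩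
    · omega
    · rw [List.isChain_cons]
      refine ⟨?_, hl⟩
      intro x hx
      rw [List.head?_eq_getElem?, List.getElem?_eq_getElem (by omega)] at hx
      simp at hx
      rw [← hx]; exact hadj.symm
    · intro z hz
      simp at hz
      rcases hz with rfl | hz
      · exact hy
      · exact hlS z hz
  -- The path has `r ≤ d` edges. By maximality all neighbours in `S` of its two ends lie on it, so
  -- `A` and `B` have more than `d / 2` elements each. They therefore share a position, where the
  -- path can be closed up to a cycle.
  let r := l.length - 1
  let A := (Finset.range r).filter (fun i => ∃ h : i + 1 < l.length,
    G.Adj (l[0]'(by omega)) l[i + 1])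
  let B := (Finset.range r).filter (fun i => ∃ h : i < l.length,
    G.Adj (l[l.length - 1]'(by omega)) l[i])
  have hA : G.degIn S (l[0]'(by omega)) ≤ A.card := by
    unfold degIn
    refine Finset.card_le_card_of_injOn (fun y => l.idxOf y - 1) ?_ ?_
    · intro y hy
      simp only [Finset.coe_filter, Set.mem_ofPred_eq] at hy
      have hyl := hfirst y hy.1 hy.2
      have h1 := List.idxOf_lt_length_of_mem hyl
      have h2 : l.idxOf y ≠ 0 := by
        intro h
        have h3 : l[l.idxOf y] = y := List.getElem_idxOf h1
        simp only [h] at h3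
        exact hy.2.ne h3
      simp only [A, Finset.coe_filter, Set.mem_ofPred_eq, Finset.mem_range]
      refine ⟨by omega, by omega, ?_⟩
      have e : l.idxOf y - 1 + 1 = l.idxOf y := by omega
      simp only [e, List.getElem_idxOf]
      exact hy.2
    · intro y hy z hz hyz
      simp only [Finset.coe_filter, Set.mem_ofPred_eq] at hy hz
      have hyl := hfirst y hy.1 hy.2
      have hzl := hfirst z hz.1 hz.2
      have h1 := List.idxOf_lt_length_of_mem hyl
      have h2 : l.idxOf y ≠ 0 := by
        intro h
        have h3 : l[l.idxOf y] = y := List.getElem_idxOf h1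
        simp only [h] at h3
        exact hy.2.ne h3
      have h1' := List.idxOf_lt_length_of_mem hzl
      have h2' : l.idxOf z ≠ 0 := by
        intro h
        have h3 : l[l.idxOf z] = z := List.getElem_idxOf h1'
        simp only [h] at h3
        exact hz.2.ne h3
      simp only at hyz
      exact (List.idxOf_inj hyl).1 (by omega)
  have hB : G.degIn S (l[l.length - 1]'(by omega)) ≤ B.card := by
    unfold degIn
    refine Finset.card_le_card_of_injOn (fun y => l.idxOf y) ?_ ?_
    · intro y hy
      simp only [Finset.coe_filter, Set.mem_ofPred_eq] at hy
      have hyl := hlast y hy.1 hy.2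
      have h1 := List.idxOf_lt_length_of_mem hyl
      have h2 : l.idxOf y ≠ l.length - 1 := by
        intro h
        have h3 : l[l.idxOf y] = y := List.getElem_idxOf h1
        simp only [h] at h3
        exact hy.2.ne h3
      simp only [B, Finset.coe_filter, Set.mem_ofPred_eq, Finset.mem_range]
      refine ⟨by omega, by omega, ?_⟩
      simp only [List.getElem_idxOf]
      exact hy.2
    · intro y hy z hz hyz
      simp only [Finset.coe_filter, Set.mem_ofPred_eq] at hy hz
      exact (List.idxOf_inj (hlast y hy.1 hy.2)).1 hyz
  have hAB : ¬ Disjoint A B := by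
    intro hd
    have h1 := Finset.card_le_card (Finset.union_subset (Finset.filter_subset _ _)
      (Finset.filter_subset _ _) : A ∪ B ⊆ Finset.range r)
    rw [Finset.card_union_of_disjoint hd, Finset.card_range] at h1
    have h2 := hmin _ (hmem 0 (by omega))
    have h3 := hmin _ (hmem (l.length - 1) (by omega))
    omega
  rw [Finset.not_disjoint_iff] at hAB
  obtain ⟨i, hiA, hiB⟩ := hAB
  simp only [A, B, Finset.mem_filter] at hiA hiB
  obtain ⟨-, hi1, hiA⟩ := hiA
  obtain ⟨-, hi2, hiB⟩ := hiB
  obtain ⟨c, hc, hperm, hclose⟩ := exists_cycle_of_crossing hl hi1 hiA hiB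
  -- an edge leaving the cycle
  have hlne : l.toFinset ≠ S := by
    intro h
    have := List.toFinset_card_le l
    rw [h] at this
    omega
  obtain ⟨x, hx, y, hy, hxy, hyl⟩ := hdisc l.toFinset
    (fun z hz => hlS z (List.mem_toFinset.1 hz))
    ⟨l[0]'(by omega), by simp⟩ hlne
  obtain ⟨l', h1, h2, h3, h4⟩ := exists_longer_of_cycle hc (hperm.nodup_iff.2 hn) hclose
    (hperm.mem_iff.2 (List.mem_toFinset.1 hx))
    (fun h => hyl (List.mem_toFinset.2 (hperm.mem_iff.1 h))) hxy
  have := hmax _ ⟨l', h1, h2, ?_, rfl⟩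
  · rw [h4, hperm.length_eq] at this
    omega
  · intro z hz
    rcases h3 z hz with h | rfl
    · exact hlS z (hperm.mem_iff.1 h)
    · exact hy

end ErdosGallai

/-! ### From few paths in neighbourhoods to bounded local density -/

section LocalDensity

variable {V : Type*}

lemma degIn_le_card_sub_one (G : SimpleGraph V) {S : Finset V} {v : V} (hv : v ∈ S) :
    G.degIn S v ≤ S.card - 1 := by
  classical
  have : S.filter (fun w => G.Adj v w) ⊆ S.erase v := by
    intro w hw
    simp only [Finset.mem_filter] at hw
    exact Finset.mem_erase.2 ⟨hw.2.ne', hw.1⟩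
  have := Finset.card_le_card this
  rw [Finset.card_erase_of_mem hv] at this
  unfold degIn
  convert this

/-- `G` has local density at most `a` if every finite set of vertices inside a neighbourhood spans
average degree at most `a`. -/
def LocalDensityLE (G : SimpleGraph V) (a : ℝ) : Prop :=
  ∀ (u : V) (S : Finset V), (∀ v ∈ S, G.Adj u v) →
    ((∑ v ∈ S, G.degIn S v : ℕ) : ℝ) ≤ a * S.card

lemma length_lt_of_pathGraph_free {G : SimpleGraph V} {m : ℕ} (h : (pathGraph m).Free G)
    {l : List V} (hl : l.IsChain G.Adj) (hn : l.Nodup) : l.length < m := by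
  by_contra hlen
  push Not at hlen
  apply h
  refine ⟨⟨⟨fun i => l[i.1]'(by omega), ?_⟩, ?_⟩⟩
  · intro i j hij
    rw [pathGraph_adj] at hij
    rw [List.isChain_iff_getElem] at hl
    rcases hij with hij | hij
    · have := hl i.1 (by omega)
      simpa only [hij] using this
    · have := (hl j.1 (by omega)).symm
      simpa only [hij] using this
  · intro i j hij
    have : l[i.1]'(by omega) = l[j.1]'(by omega) := hij
    rw [hn.getElem_inj_iff] at this
    exact Fin.ext this

lemma pathGraph_ne_bot {m : ℕ} (hm : 2 ≤ m) : pathGraph m ≠ ⊥ := by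
  intro h
  have : (pathGraph m).Adj ⟨0, by omega⟩ ⟨1, by omega⟩ := by simp [pathGraph_adj]
  rw [h] at this
  exact this

lemma sum_degIn_univ [Fintype V] (G : SimpleGraph V) [Fintype G.edgeSet] :
    ∑ v, G.degIn Finset.univ v = 2 * G.edgeFinset.card := by
  classical
  have := G.sum_degrees_eq_twice_card_edges
  convert this using 2 with v
  · unfold degIn
    rw [← card_neighborFinset_eq_degree]
    congr 1
    ext w
    simp
  · congr!

/-- A graph with few copies of a path on `d + 2` vertices spans few edges on each set of
vertices. -/
lemma sum_degIn_le_of_copyCount [Fintype V] (G : SimpleGraph V) {d : ℕ} (S : Finset V) :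
    ∑ v ∈ S, G.degIn S v ≤ d * S.card + 2 * G.copyCount (pathGraph (d + 2)) := by
  classical
  -- This removes at most one edge per copy and leaves a graph in which every path has at most `d +
  -- 1` vertices.
  set G' := G.killCopies (pathGraph (d + 2)) with hG'
  have hfree : (pathGraph (d + 2)).Free G' := free_killCopies (pathGraph_ne_bot (by omega))
  have hle : G' ≤ G := killCopies_le_left
  have h1 : ∑ v ∈ S, G'.degIn S v ≤ d * S.card :=
    sum_degIn_le_of_path_length_le
      (fun l hl hn => Nat.lt_succ_iff.1 (length_lt_of_pathGraph_free hfree hl hn)) S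
  have h2 : G.edgeFinset.card ≤ G'.edgeFinset.card + G.copyCount (pathGraph (d + 2)) := by
    have := G.le_card_edgeFinset_killCopies_add_copyCount (H := pathGraph (d + 2))
    convert this
  -- The edges removed at `v` inside `S` are among all edges removed at `v`, so the loss on `S` is
  -- at most the total loss.
  have h3 : ∀ v, G.degIn S v + G'.degIn Finset.univ v
      ≤ G'.degIn S v + G.degIn Finset.univ v := by
    intro v
    unfold degIn
    rw [← Finset.card_union_add_card_inter, add_comm]
    refine add_le_add (Finset.card_le_card ?_) (Finset.card_le_card ?_)
    · intro w hw
      simp only [Finset.mem_inter, Finset.mem_filter] at hw ⊢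
      exact ⟨hw.1.1, hw.2.2⟩
    · intro w hw
      simp only [Finset.mem_union, Finset.mem_filter, Finset.mem_univ, true_and] at hw ⊢
      rcases hw with hw | hw
      exacts [hw.2, hle hw]
  have h3' : ∀ v, G'.degIn S v ≤ G.degIn S v ∧ G'.degIn Finset.univ v ≤ G.degIn Finset.univ v := by
    intro v
    unfold degIn
    constructor <;>
    · refine Finset.card_le_card (Finset.monotone_filter_right _ ?_)
      intro w _ hw
      exact hle hw
  have e1 := sum_degIn_univ G
  have e2 := sum_degIn_univ G'
  have h4 : ∑ v ∈ S, (G.degIn S v - G'.degIn S v)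
      ≤ ∑ v, (G.degIn Finset.univ v - G'.degIn Finset.univ v) := by
    refine (Finset.sum_le_sum fun v _ => ?_).trans
      (Finset.sum_le_sum_of_subset (Finset.subset_univ S))
    have := h3 v
    omega
  have h5 : ∑ v, (G.degIn Finset.univ v - G'.degIn Finset.univ v) + ∑ v, G'.degIn Finset.univ v
      = ∑ v, G.degIn Finset.univ v := by
    rw [← Finset.sum_add_distrib]
    exact Finset.sum_congr rfl fun v _ => Nat.sub_add_cancel (h3' v).2
  have h6 : ∑ v ∈ S, (G.degIn S v - G'.degIn S v) + ∑ v ∈ S, G'.degIn S v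
      = ∑ v ∈ S, G.degIn S v := by
    rw [← Finset.sum_add_distrib]
    exact Finset.sum_congr rfl fun v _ => Nat.sub_add_cancel (h3' v).1
  omega

/-- Locally sparse graphs have bounded local density. -/
theorem NbhdPathCountLE.localDensityLE [Fintype V] {G : SimpleGraph V} {k : ℕ} {t : ℝ}
    (hk : 3 ≤ k) (ht : 0 ≤ t) (h : G.NbhdPathCountLE k t) :
    G.LocalDensityLE ((k : ℝ) - 3 + √(2 * t)) := by
  classical
  intro u S hS
  have hk' : (3 : ℝ) ≤ k := by exact_mod_cast hk
  have hs := Real.sqrt_nonneg (2 * t)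
  have hn : (0 : ℝ) ≤ S.card := by positivity
  -- Below this threshold all degrees are at most `√(2t)`; above it, `2t = √(2t) * √(2t)` is at most
  -- `√(2t) * |S|`.
  by_cases hcard : (S.card : ℝ) - 1 ≤ √(2 * t)
  · have h1 : ∑ v ∈ S, G.degIn S v ≤ (S.card - 1) * S.card :=
      (Finset.sum_le_sum fun v hv => G.degIn_le_card_sub_one hv).trans (by simp [mul_comm])
    rcases Nat.eq_zero_or_pos S.card with h0 | h0
    · rw [Finset.card_eq_zero.1 h0]; simp
    · calc ((∑ v ∈ S, G.degIn S v : ℕ) : ℝ) ≤ (((S.card - 1) * S.card : ℕ) : ℝ) := by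
            exact_mod_cast h1
        _ = ((S.card : ℝ) - 1) * S.card := by push_cast [Nat.cast_sub h0]; ring
        _ ≤ _ := by
          refine mul_le_mul_of_nonneg_right ?_ hn
          linarith
  · push Not at hcard
    let T : Finset (G.neighborSet u) := S.subtype (fun v => v ∈ G.neighborSet u)
    have hTS : T.map (Function.Embedding.subtype _) = S :=
      Finset.subtype_map_of_mem (fun v hv => hS v hv)
    have hcardT : T.card = S.card := by rw [← hTS, Finset.card_map]
    have hdeg : ∀ v : G.neighborSet u, (G.induce (G.neighborSet u)).degIn T v = G.degIn S v := by
      intro v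
      unfold degIn
      conv_rhs => rw [← hTS, Finset.filter_map, Finset.card_map]
      congr 1
    have hsum : ∑ v ∈ S, G.degIn S v = ∑ v ∈ T, (G.induce (G.neighborSet u)).degIn T v := by
      rw [Finset.sum_congr rfl (fun v _ => hdeg v)]
      conv_lhs => rw [← hTS, Finset.sum_map]
      simp only [Function.Embedding.subtype_apply, hTS]
    have h1 := (G.induce (G.neighborSet u)).sum_degIn_le_of_copyCount (d := k - 3) T
    rw [← hsum, hcardT, show k - 3 + 2 = k - 1 by omega] at h1
    have h2 := h u
    have h3 : ((∑ v ∈ S, G.degIn S v : ℕ) : ℝ) ≤ ((k : ℝ) - 3) * S.card + 2 * t := by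
      have h4 : ((∑ v ∈ S, G.degIn S v : ℕ) : ℝ) ≤ ((k - 3 : ℕ) : ℝ) * S.card
          + 2 * ((G.induce (G.neighborSet u)).copyCount (pathGraph (k - 1)) : ℝ) := by
        exact_mod_cast h1
      rw [Nat.cast_sub hk] at h4
      push_cast at h4 ⊢
      have h5 : ((G.induce (G.neighborSet u)).copyCount (pathGraph (k - 1)) : ℝ) ≤ t := by
        convert h2
      linarith
    have h6 : 2 * t ≤ √(2 * t) * S.card := by
      rcases Nat.eq_zero_or_pos S.card with h0 | h0
      · rw [h0] at hcard; push_cast at hcard; linarith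
      · have : √(2 * t) * √(2 * t) = 2 * t := Real.mul_self_sqrt (by linarith)
        by_cases hx : √(2 * t) ≤ S.card
        · nlinarith
        · push Not at hx
          linarith
    linarith

end LocalDensity

/-! ### The hard-core model and local occupancy -/

section HardCore

open scoped Classical

variable {W : Type*} (H : SimpleGraph W)

/-- The independent sets of `H` contained in `S`. -/
noncomputable def indepIn (S : Finset W) : Finset (Finset W) :=
  S.powerset.filter (fun I => H.IsIndepSet (I : Set W))

/-- The unnormalised expectation of `f` in the hard-core model at fugacity `lam` on the subgraph
of `H` induced by `S`. -/
noncomputable def hcSum (S : Finset W) (lam : ℝ) (f : Finset W → ℝ) : ℝ :=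
  ∑ I ∈ H.indepIn S, lam ^ I.card * f I

/-- The vertices of `N` without neighbours in `J`. -/
noncomputable def uncovered (N J : Finset W) : Finset W :=
  N.filter (fun y => ∀ x ∈ J, ¬ H.Adj y x)

variable {H}

lemma mem_indepIn {S I : Finset W} :
    I ∈ H.indepIn S ↔ I ⊆ S ∧ H.IsIndepSet (I : Set W) := by
  simp [indepIn]

lemma empty_mem_indepIn {S : Finset W} : ∅ ∈ H.indepIn S := by
  simp [mem_indepIn, IsIndepSet]

lemma mem_uncovered {N J : Finset W} {y : W} :
    y ∈ H.uncovered N J ↔ y ∈ N ∧ ∀ x ∈ J, ¬ H.Adj y x := by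
  simp [uncovered]

lemma uncovered_subset {N J : Finset W} : H.uncovered N J ⊆ N := Finset.filter_subset _ _

lemma isIndepSet_coe_iff {I : Finset W} :
    H.IsIndepSet (I : Set W) ↔ ∀ x ∈ I, ∀ y ∈ I, ¬ H.Adj x y := by
  constructor
  · intro h x hx y hy hxy
    exact h hx hy hxy.ne hxy
  · intro h x hx y hy _
    exact h x hx y hy

lemma hcSum_congr {S : Finset W} {lam : ℝ} {f g : Finset W → ℝ}
    (h : ∀ I ∈ H.indepIn S, f I = g I) : H.hcSum S lam f = H.hcSum S lam g :=
  Finset.sum_congr rfl fun I hI => by rw [h I hI]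

lemma hcSum_mono {S : Finset W} {lam : ℝ} (hl : 0 ≤ lam) {f g : Finset W → ℝ}
    (h : ∀ I ∈ H.indepIn S, f I ≤ g I) : H.hcSum S lam f ≤ H.hcSum S lam g :=
  Finset.sum_le_sum fun I hI => mul_le_mul_of_nonneg_left (h I hI) (pow_nonneg hl _)

lemma hcSum_nonneg {S : Finset W} {lam : ℝ} (hl : 0 ≤ lam) {f : Finset W → ℝ}
    (h : ∀ I ∈ H.indepIn S, 0 ≤ f I) : 0 ≤ H.hcSum S lam f :=
  Finset.sum_nonneg fun I hI => mul_nonneg (pow_nonneg hl _) (h I hI)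

lemma hcSum_add {S : Finset W} {lam : ℝ} (f g : Finset W → ℝ) :
    H.hcSum S lam (fun I => f I + g I) = H.hcSum S lam f + H.hcSum S lam g := by
  simp [hcSum, mul_add, Finset.sum_add_distrib]

lemma hcSum_const_mul {S : Finset W} {lam : ℝ} (c : ℝ) (f : Finset W → ℝ) :
    H.hcSum S lam (fun I => c * f I) = c * H.hcSum S lam f := by
  rw [hcSum, hcSum, Finset.mul_sum]
  exact Finset.sum_congr rfl fun I _ => by ring

lemma hcSum_sum {ι : Type*} {S : Finset W} {lam : ℝ} (T : Finset ι) (f : ι → Finset W → ℝ) :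
    H.hcSum S lam (fun I => ∑ i ∈ T, f i I) = ∑ i ∈ T, H.hcSum S lam (f i) := by
  simp only [hcSum, Finset.mul_sum]
  exact Finset.sum_comm

lemma one_le_hcSum_one {S : Finset W} {lam : ℝ} (hl : 0 ≤ lam) :
    1 ≤ H.hcSum S lam (fun _ => 1) := by
  have : (fun I : Finset W => lam ^ I.card * (1 : ℝ)) ∅ ≤ H.hcSum S lam (fun _ => 1) :=
    Finset.single_le_sum (f := fun I : Finset W => lam ^ I.card * (1 : ℝ))
      (fun I _ => by positivity) empty_mem_indepIn
  simpa using this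

/-- Only the empty set contributes to the probability of `∅`. -/
lemma hcSum_ite_empty {S : Finset W} {lam : ℝ} :
    H.hcSum S lam (fun I => if I = ∅ then 1 else 0) = 1 := by
  unfold hcSum
  rw [Finset.sum_eq_single ∅]
  · simp
  · intro I _ hI; simp [hI]
  · intro h; exact absurd empty_mem_indepIn h

/-- The spatial Markov property. -/
lemma hcSum_split {S N : Finset W} (hN : N ⊆ S) (lam : ℝ) (f : Finset W → ℝ) :
    H.hcSum S lam f = H.hcSum (S \ N) lam
      (fun J => H.hcSum (H.uncovered N J) lam (fun K => f (J ∪ K))) := by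
  unfold hcSum
  simp only [Finset.mul_sum]
  rw [Finset.sum_sigma']
  refine Finset.sum_bij' (fun I _ => ⟨I \ N, I ∩ N⟩) (fun p _ => p.1 ∪ p.2) ?_ ?_ ?_ ?_ ?_
  · intro I hI
    rw [mem_indepIn, isIndepSet_coe_iff] at hI
    simp only [Finset.mem_sigma, mem_indepIn, isIndepSet_coe_iff]
    refine ⟨⟨Finset.sdiff_subset_sdiff hI.1 le_rfl, fun x hx y hy =>
      hI.2 x (Finset.mem_sdiff.1 hx).1 y (Finset.mem_sdiff.1 hy).1⟩, ?_, fun x hx y hy =>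
      hI.2 x (Finset.mem_inter.1 hx).1 y (Finset.mem_inter.1 hy).1⟩
    intro x hx
    rw [mem_uncovered]
    exact ⟨(Finset.mem_inter.1 hx).2, fun y hy =>
      hI.2 x (Finset.mem_inter.1 hx).1 y (Finset.mem_sdiff.1 hy).1⟩
  · rintro ⟨J, K⟩ hp
    simp only [Finset.mem_sigma, mem_indepIn, isIndepSet_coe_iff] at hp
    obtain ⟨⟨hJ, hJi⟩, hK, hKi⟩ := hp
    simp only [mem_indepIn, isIndepSet_coe_iff, Finset.mem_union]
    refine ⟨Finset.union_subset (hJ.trans Finset.sdiff_subset)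
      ((hK.trans uncovered_subset).trans hN), ?_⟩
    rintro x (hx | hx) y (hy | hy)
    · exact hJi x hx y hy
    · exact fun h => (mem_uncovered.1 (hK hy)).2 x hx h.symm
    · exact (mem_uncovered.1 (hK hx)).2 y hy
    · exact hKi x hx y hy
  · intro I _
    exact Finset.sdiff_union_inter I N
  · rintro ⟨J, K⟩ hp
    simp only [Finset.mem_sigma, mem_indepIn] at hp
    obtain ⟨⟨hJ, -⟩, hK, -⟩ := hp
    have hK' : K ⊆ N := hK.trans uncovered_subset
    have hJ' : Disjoint J N := (Finset.disjoint_of_subset_left hJ Finset.sdiff_disjoint)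
    have e1 : (J ∪ K) \ N = J := by
      rw [Finset.union_sdiff_distrib, Finset.sdiff_eq_empty_iff_subset.2 hK', Finset.union_empty,
        Finset.sdiff_eq_self_of_disjoint hJ']
    have e2 : (J ∪ K) ∩ N = K := by
      rw [Finset.union_inter_distrib_right, Finset.disjoint_iff_inter_eq_empty.1 hJ',
        Finset.empty_union, Finset.inter_eq_left.2 hK']
    simp only [e1, e2]
  · intro I hI
    have e : I \ N ∪ I ∩ N = I := Finset.sdiff_union_inter I N
    simp only [e]
    have : I.card = (I \ N).card + (I ∩ N).card := by
      rw [Finset.card_sdiff_add_card_inter]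
    rw [this, pow_add, mul_assoc]

/-- Averaging an inequality over the configuration outside of `N`. -/
lemma hcSum_le_hcSum_of_split {S N : Finset W} (hN : N ⊆ S) {lam : ℝ} (hl : 0 ≤ lam)
    {f g : Finset W → ℝ}
    (h : ∀ J ∈ H.indepIn (S \ N), H.hcSum (H.uncovered N J) lam (fun K => f (J ∪ K)) ≤
      H.hcSum (H.uncovered N J) lam (fun K => g (J ∪ K))) :
    H.hcSum S lam f ≤ H.hcSum S lam g := by
  rw [hcSum_split hN, hcSum_split hN]
  exact hcSum_mono hl h

lemma hcSum_one_le_pow {S : Finset W} {lam : ℝ} (hl : 0 ≤ lam) :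
    H.hcSum S lam (fun _ => 1) ≤ (1 + lam) ^ S.card := by
  have : ∑ I ∈ S.powerset, lam ^ I.card = (1 + lam) ^ S.card := by
    have := Finset.sum_pow_mul_eq_add_pow lam 1 S
    simp only [one_pow, mul_one] at this
    rw [this, add_comm]
  rw [← this, hcSum]
  simp only [mul_one]
  exact Finset.sum_le_sum_of_subset_of_nonneg (Finset.filter_subset _ _)
    fun I _ _ => pow_nonneg hl _

lemma hcSum_sdiff {S T : Finset W} (lam : ℝ) :
    H.hcSum S lam (fun I => if Disjoint I T then 1 else 0) = H.hcSum (S \ T) lam (fun _ => 1) := by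
  unfold hcSum
  rw [← Finset.sum_filter_add_sum_filter_not (H.indepIn S) (fun I => Disjoint I T)]
  rw [Finset.sum_eq_zero (s := (H.indepIn S).filter (fun I => ¬ Disjoint I T)), add_zero]
  · refine Finset.sum_congr ?_ ?_
    · ext I
      simp only [Finset.mem_filter, mem_indepIn, Finset.subset_sdiff]
      tauto
    · intro I hI
      simp only [mem_indepIn, Finset.subset_sdiff] at hI
      simp [hI.1.2]
  · intro I hI
    simp [(Finset.mem_filter.1 hI).2]

/-- Given the configuration off `T`, the partition function of what remains of `T` is at most that
of an edgeless graph on `T`. -/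
lemma hcSum_one_le_pow_mul {S T : Finset W} (hT : T ⊆ S) {lam : ℝ} (hl : 0 ≤ lam) :
    H.hcSum S lam (fun _ => 1) ≤ (1 + lam) ^ T.card * H.hcSum (S \ T) lam (fun _ => 1) := by
  rw [hcSum_split hT, ← hcSum_const_mul]
  refine hcSum_mono hl fun J _ => ?_
  rw [mul_one]
  exact hcSum_one_le_pow hl |>.trans
    (pow_le_pow_right₀ (by linarith) (Finset.card_le_card uncovered_subset))

/-- Removing `v` from an independent set containing it leaves an arbitrary independent set off the
closed neighbourhood of `v`. -/
lemma hcSum_mem {S : Finset W} {v : W} (hv : v ∈ S) (lam : ℝ) :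
    H.hcSum S lam (fun I => if v ∈ I then 1 else 0) =
      lam * H.hcSum (S \ insert v (S.filter (fun w => H.Adj v w))) lam (fun _ => 1) := by
  rw [hcSum_split (Finset.singleton_subset_iff.2 hv)]
  have e : S \ insert v (S.filter (fun w => H.Adj v w)) =
      (S \ {v}) \ S.filter (fun w => H.Adj v w) := by
    ext x; simp; tauto
  rw [e, ← hcSum_sdiff, ← hcSum_const_mul]
  refine hcSum_congr fun J hJ => ?_
  rw [mem_indepIn, Finset.subset_sdiff, Finset.disjoint_singleton_right] at hJ
  have e2 : Disjoint J (S.filter (fun w => H.Adj v w)) ↔ ∀ x ∈ J, ¬ H.Adj v x := by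
    rw [Finset.disjoint_left]
    refine forall₂_congr fun x hx => ?_
    simp [hJ.1.1 hx]
  by_cases h : ∀ x ∈ J, ¬ H.Adj v x
  · have e3 : H.uncovered {v} J = {v} := by
      ext y; rw [mem_uncovered]; simp only [Finset.mem_singleton]
      constructor
      · exact fun h => h.1
      · rintro rfl; exact ⟨rfl, h⟩
    have e4 : H.indepIn {v} = {∅, {v}} := by
      ext I
      rw [mem_indepIn, isIndepSet_coe_iff, Finset.subset_singleton_iff]
      simp only [Finset.mem_insert, Finset.mem_singleton]
      constructor
      · exact fun h => h.1
      · rintro (rfl | rfl) <;> simp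
    rw [if_pos (e2.2 h), e3, hcSum, e4, Finset.sum_pair (Finset.singleton_ne_empty v).symm]
    simp [hJ.1.2]
  · rw [if_neg (mt e2.1 h), mul_zero]
    refine Finset.sum_eq_zero fun K hK => ?_
    have : v ∉ J ∪ K := by
      simp only [Finset.mem_union, not_or]
      refine ⟨hJ.1.2, fun hK' => h ?_⟩
      exact (mem_uncovered.1 ((mem_indepIn.1 hK).1 hK')).2
    simp [this]

lemma hcSum_card_inter {S N : Finset W} (lam : ℝ) :
    H.hcSum S lam (fun I => ((I ∩ N).card : ℝ)) =
      ∑ v ∈ N, H.hcSum S lam (fun I => if v ∈ I then 1 else 0) := by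
  rw [← hcSum_sum]
  refine hcSum_congr fun I _ => ?_
  rw [Finset.sum_ite_mem, Finset.inter_comm]
  simp

lemma hcSum_card {S : Finset W} (lam : ℝ) :
    H.hcSum S lam (fun I => (I.card : ℝ)) =
      ∑ v ∈ S, H.hcSum S lam (fun I => if v ∈ I then 1 else 0) := by
  rw [← hcSum_card_inter]
  refine hcSum_congr fun I hI => ?_
  rw [Finset.inter_eq_left.2 (mem_indepIn.1 hI).1]

/-- The expected size of a random independent set in a graph of average degree at most `a`. -/
lemma le_hcSum_card {S : Finset W} {a lam : ℝ} (hl : 0 < lam)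
    (hd : ((∑ v ∈ S, H.degIn S v : ℕ) : ℝ) ≤ a * S.card) :
    S.card * lam * (1 + lam) ^ (-(a + 1)) * H.hcSum S lam (fun _ => 1) ≤
      H.hcSum S lam (fun I => (I.card : ℝ)) := by
  set L := Real.log (1 + lam) with hL
  have hL0 : 0 ≤ L := Real.log_nonneg (by linarith)
  set Z := H.hcSum S lam (fun _ => 1)
  have hZ : 1 ≤ Z := one_le_hcSum_one hl.le
  rw [hcSum_card]
  -- The convex function `d ↦ (1 + lam) ^ (-(d + 1))` is replaced by its tangent at `d = a`. After
  -- summation the linear terms contribute a nonnegative amount, because the average degree is at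
  -- most `a`.
  have key : ∀ v ∈ S, lam * (1 + lam) ^ (-(a + 1)) * Z * (1 - (H.degIn S v - a) * L) ≤
      H.hcSum S lam (fun I => if v ∈ I then 1 else 0) := by
    intro v hv
    rw [hcSum_mem hv, mul_assoc, mul_assoc]
    refine mul_le_mul_of_nonneg_left ?_ hl.le
    have h1 := hcSum_one_le_pow_mul (H := H) (S := S)
      (T := insert v (S.filter (fun w => H.Adj v w)))
      (Finset.insert_subset hv (Finset.filter_subset _ _)) hl.le
    rw [Finset.card_insert_of_notMem (by simp)] at h1
    change Z ≤ (1 + lam) ^ (H.degIn S v + 1) * _ at h1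
    set Z' := H.hcSum (S \ insert v (S.filter (fun w => H.Adj v w))) lam (fun _ => 1)
    have hpos : (0 : ℝ) < 1 + lam := by linarith
    have h2 : (1 + lam) ^ (-(a + 1)) * (1 - (H.degIn S v - a) * L) ≤
        ((1 + lam) ^ (H.degIn S v + 1))⁻¹ := by
      have e1 : ((1 + lam) ^ (H.degIn S v + 1))⁻¹ = Real.exp (-((H.degIn S v + 1) * L)) := by
        rw [Real.exp_neg, hL, mul_comm, Real.exp_mul, Real.exp_log hpos]
        congr 1
        rw [← Real.rpow_natCast]; push_cast; rfl
      rw [e1, Real.rpow_def_of_pos hpos, ← hL]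
      have e2 : -((H.degIn S v + 1) * L) = L * (-(a + 1)) + (-((H.degIn S v - a) * L)) := by ring
      rw [e2, Real.exp_add]
      refine mul_le_mul_of_nonneg_left ?_ (Real.exp_pos _).le
      have := Real.add_one_le_exp (-((H.degIn S v - a) * L))
      linarith
    calc (1 + lam) ^ (-(a + 1)) * (Z * (1 - (H.degIn S v - a) * L))
        = ((1 + lam) ^ (-(a + 1)) * (1 - (H.degIn S v - a) * L)) * Z := by ring
      _ ≤ ((1 + lam) ^ (H.degIn S v + 1))⁻¹ * Z :=
          mul_le_mul_of_nonneg_right h2 (by linarith)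
      _ ≤ ((1 + lam) ^ (H.degIn S v + 1))⁻¹ * ((1 + lam) ^ (H.degIn S v + 1) * Z') :=
          mul_le_mul_of_nonneg_left h1 (by positivity)
      _ = Z' := by
          rw [← mul_assoc, inv_mul_cancel₀ (by positivity), one_mul]
  refine le_trans ?_ (Finset.sum_le_sum key)
  rw [← Finset.mul_sum, Finset.sum_sub_distrib, ← Finset.sum_mul, Finset.sum_sub_distrib]
  push_cast at hd
  simp only [Finset.sum_const, nsmul_eq_mul, mul_one]
  have h3 : 0 ≤ lam * (1 + lam) ^ (-(a + 1)) * Z := by positivity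
  have h4 : (S.card : ℝ) ≤ S.card - (∑ v ∈ S, (H.degIn S v : ℝ) - S.card * a) * L := by
    nlinarith
  calc S.card * lam * (1 + lam) ^ (-(a + 1)) * Z
      = lam * (1 + lam) ^ (-(a + 1)) * Z * S.card := by ring
    _ ≤ _ := mul_le_mul_of_nonneg_left h4 h3

/-- The local occupancy inequality for graphs of average degree at most `a`. -/
lemma local_occupancy {S : Finset W} {a lam w : ℝ} (hl : 0 < lam) (hw : 0 ≤ w)
    (hd : ((∑ v ∈ S, H.degIn S v : ℕ) : ℝ) ≤ a * S.card) :
    H.hcSum S lam (fun _ => 1) ≤ Real.exp w / (1 + w) +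
      (1 + lam) ^ (a + 1) * Real.log (1 + lam) / lam / (1 + w) *
        H.hcSum S lam (fun I => (I.card : ℝ)) := by
  set Z := H.hcSum S lam (fun _ => 1) with hZdef
  have hZ : 1 ≤ Z := one_le_hcSum_one hl.le
  have hpos : (0 : ℝ) < 1 + lam := by linarith
  have hL0 : 0 < Real.log (1 + lam) := Real.log_pos (by linarith)
  have h1 := le_hcSum_card hl hd
  rw [← hZdef] at h1
  have h2 : Real.log Z ≤ S.card * Real.log (1 + lam) := by
    rw [← Real.log_pow]
    exact Real.log_le_log (by linarith) (hcSum_one_le_pow hl.le)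
  have h3 : Real.log Z * Z ≤ (1 + lam) ^ (a + 1) * Real.log (1 + lam) / lam *
      H.hcSum S lam (fun I => (I.card : ℝ)) := by
    have h4 := mul_le_mul_of_nonneg_left h1
      (show 0 ≤ (1 + lam) ^ (a + 1) * Real.log (1 + lam) / lam by positivity)
    refine le_trans ?_ h4
    rw [Real.rpow_neg hpos.le]
    have e : (1 + lam) ^ (a + 1) * Real.log (1 + lam) / lam *
        (S.card * lam * ((1 + lam) ^ (a + 1))⁻¹ * Z) = S.card * Real.log (1 + lam) * Z := by
      have : (1 + lam) ^ (a + 1) ≠ 0 := by positivity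
      field_simp
    rw [e]
    exact mul_le_mul_of_nonneg_right h2 (by linarith)
  -- This is `1 + y ≤ exp y` at `y = w - log Z`; equality at `log Z = w` explains the role of the
  -- parameter `w`.
  have h5 : (1 + w - Real.log Z) * Z ≤ Real.exp w := by
    have := Real.add_one_le_exp (w - Real.log Z)
    calc (1 + w - Real.log Z) * Z ≤ Real.exp (w - Real.log Z) * Z :=
          mul_le_mul_of_nonneg_right (by linarith) (by linarith)
      _ = Real.exp w := by
          rw [Real.exp_sub, Real.exp_log (by linarith), div_mul_cancel₀ _ (by linarith)]
  have h6 : (1 + w) * Z ≤ Real.exp w + (1 + lam) ^ (a + 1) * Real.log (1 + lam) / lam *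
      H.hcSum S lam (fun I => (I.card : ℝ)) := by linarith
  have hw1 : 0 < 1 + w := by linarith
  calc Z = ((1 + w) * Z) / (1 + w) := by field_simp
    _ ≤ _ := div_le_div_of_nonneg_right h6 hw1.le
    _ = _ := by ring

/-- The local occupancy inequality at a vertex of the hard-core model on an induced subgraph. -/
lemma LocalDensityLE.vertex_occupancy {S : Finset W} {a lam w : ℝ} (hl : 0 < lam) (hw : 0 ≤ w)
    (ha : H.LocalDensityLE a) {u : W} (hu : u ∈ S) :
    H.hcSum S lam (fun _ => 1) ≤
      (1 + lam) / lam * (Real.exp w / (1 + w)) *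
        H.hcSum S lam (fun I => if u ∈ I then 1 else 0) +
      (1 + lam) ^ (a + 1) * Real.log (1 + lam) / lam / (1 + w) *
        ∑ v ∈ S.filter (fun v => H.Adj u v), H.hcSum S lam (fun I => if v ∈ I then 1 else 0) := by
  set N := S.filter (fun v => H.Adj u v) with hN
  set Γ := (1 + lam) ^ (a + 1) * Real.log (1 + lam) / lam / (1 + w)
  have hNS : N ⊆ S := Finset.filter_subset _ _
  -- Given the rest, `u` is occupied with probability `lam / (1 + lam)` if none of its neighbours is
  -- occupied, and never otherwise.
  have h1 : (1 + lam) / lam * H.hcSum S lam (fun I => if u ∈ I then 1 else 0) =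
      H.hcSum S lam (fun I => if Disjoint I N then 1 else 0) := by
    rw [hcSum_sdiff, hcSum_mem hu, ← mul_assoc, div_mul_cancel₀ _ hl.ne',
      hcSum_split (S := S \ N) (N := {u}) (by simp [hN, hu]), ← hcSum_const_mul]
    have e : (S \ N) \ {u} = S \ insert u N := by ext x; simp; tauto
    rw [e]
    refine hcSum_congr fun J hJ => ?_
    have e3 : H.uncovered {u} J = {u} := by
      ext y; rw [mem_uncovered]; simp only [Finset.mem_singleton]
      constructor
      · exact fun h => h.1
      · rintro rfl
        refine ⟨rfl, fun x hx hadj => ?_⟩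
        have := (mem_indepIn.1 hJ).1 hx
        simp [hadj] at this
        exact this.2.2 this.1
    have e4 : H.indepIn {u} = {∅, {u}} := by
      ext I
      rw [mem_indepIn, isIndepSet_coe_iff, Finset.subset_singleton_iff]
      simp only [Finset.mem_insert, Finset.mem_singleton]
      constructor
      · exact fun h => h.1
      · rintro (rfl | rfl) <;> simp
    rw [e3, hcSum, e4, Finset.sum_pair (Finset.singleton_ne_empty u).symm]
    simp
  have h2 : H.hcSum S lam (fun _ => 1) ≤ H.hcSum S lam (fun I =>
      Real.exp w / (1 + w) * (if Disjoint I N then 1 else 0) + Γ * ((I ∩ N).card : ℝ)) := by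
    -- Given `J` off `N`, the configuration in `N` is a hard-core set on the uncovered neighbours of
    -- `u`, and these span average degree at most `a`.
    refine hcSum_le_hcSum_of_split hNS hl.le fun J hJ => ?_
    have hJ' : Disjoint J N := by
      have := (mem_indepIn.1 hJ).1
      rw [Finset.subset_sdiff] at this
      exact this.2
    have h3 := local_occupancy (H := H) (S := H.uncovered N J) (a := a) hl hw
      (ha u _ fun v hv => by
        have := uncovered_subset hv
        rw [hN, Finset.mem_filter] at this
        exact this.2)
    refine h3.trans (le_of_eq ?_)
    rw [hcSum_add, hcSum_const_mul, hcSum_const_mul]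
    congr 1
    · have : H.hcSum (H.uncovered N J) lam (fun K => if Disjoint (J ∪ K) N then (1 : ℝ) else 0)
          = H.hcSum (H.uncovered N J) lam (fun K => if K = ∅ then 1 else 0) := by
        refine hcSum_congr fun K hK => ?_
        have hK' : K ⊆ N := (mem_indepIn.1 hK).1.trans uncovered_subset
        congr 1
        rw [Finset.disjoint_union_left, eq_iff_iff]
        constructor
        · rintro ⟨-, h⟩
          exact Finset.disjoint_self_iff_empty _ |>.1 (Finset.disjoint_of_subset_right hK' h)
        · rintro rfl
          exact ⟨hJ', Finset.disjoint_empty_left _⟩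
      rw [this, hcSum_ite_empty, mul_one]
    · congr 1
      refine hcSum_congr fun K hK => ?_
      have hK' : K ⊆ N := (mem_indepIn.1 hK).1.trans uncovered_subset
      rw [Finset.union_inter_distrib_right, Finset.disjoint_iff_inter_eq_empty.1 hJ',
        Finset.empty_union, Finset.inter_eq_left.2 hK']
  refine h2.trans (le_of_eq ?_)
  rw [hcSum_add, hcSum_const_mul, hcSum_const_mul, hcSum_card_inter, ← h1]
  ring

/-- Exponential lower tail bound for the size of a random independent set. -/
lemma hcSum_exp_neg_card_le {S : Finset W} {a lam θ : ℝ} (hl : 0 < lam) (hθ : 0 ≤ θ)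
    (ha : 0 ≤ a) (hd : ((∑ v ∈ S, H.degIn S v : ℕ) : ℝ) ≤ a * S.card) :
    H.hcSum S lam (fun I => Real.exp (-(θ * I.card))) ≤
      Real.exp (-(θ * (S.card * lam * Real.exp (-θ) * (1 + lam) ^ (-(a + 1))))) *
        H.hcSum S lam (fun _ => 1) := by
  -- The exponential weight lowers the fugacity to `μ`. Conversely `Z(lam)` is the sum of `μ ^ |I| *
  -- exp (θ|I|)`; the tangent to `exp` at `θ * m`, with mean size at least `m` at fugacity `μ`,
  -- bounds it below by `exp (θ * m) * Z(μ)`.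
  set μ := lam * Real.exp (-θ) with hμ
  have hμ0 : 0 < μ := by positivity
  have hμl : μ ≤ lam := mul_le_of_le_one_right hl.le (Real.exp_le_one_iff.2 (by linarith))
  set m := S.card * lam * Real.exp (-θ) * (1 + lam) ^ (-(a + 1)) with hm
  have h1 : H.hcSum S lam (fun I => Real.exp (-(θ * I.card))) = H.hcSum S μ (fun _ => 1) := by
    refine Finset.sum_congr rfl fun I _ => ?_
    rw [hμ, mul_pow, ← Real.exp_nat_mul, mul_one]
    congr 2; ring_nf
  have h2 : m * H.hcSum S μ (fun _ => 1) ≤ H.hcSum S μ (fun I => (I.card : ℝ)) := by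
    refine le_trans ?_ (le_hcSum_card hμ0 hd)
    refine mul_le_mul_of_nonneg_right ?_ (zero_le_one.trans (one_le_hcSum_one hμ0.le))
    rw [hm, mul_assoc (S.card : ℝ), ← hμ]
    refine mul_le_mul_of_nonneg_left ?_ (by positivity)
    exact Real.rpow_le_rpow_of_nonpos (by linarith) (by linarith) (by linarith)
  rw [h1, Real.exp_neg, inv_mul_eq_div, le_div_iff₀ (Real.exp_pos _)]
  calc H.hcSum S μ (fun _ => 1) * Real.exp (θ * m)
      ≤ Real.exp (θ * m) * (H.hcSum S μ (fun _ => 1) + θ *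
          (H.hcSum S μ (fun I => (I.card : ℝ)) - m * H.hcSum S μ (fun _ => 1))) := by
        rw [mul_comm]
        refine mul_le_mul_of_nonneg_left ?_ (Real.exp_pos _).le
        have := mul_nonneg hθ (sub_nonneg.2 h2)
        linarith
    _ = H.hcSum S μ (fun I => Real.exp (θ * m) * (1 + θ * (I.card - m))) := by
        rw [hcSum_const_mul, hcSum_add, hcSum_const_mul]
        congr 3
        have : H.hcSum S μ (fun I => (I.card : ℝ) - m) =
            H.hcSum S μ (fun I => (I.card : ℝ) + (-m) * 1) := hcSum_congr fun I _ => by ring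
        rw [this, hcSum_add, hcSum_const_mul]; ring
    _ ≤ H.hcSum S lam (fun _ => 1) := by
        refine Finset.sum_le_sum fun I _ => ?_
        rw [hμ, mul_pow, mul_assoc]
        refine mul_le_mul_of_nonneg_left ?_ (by positivity)
        have h3 : 1 + θ * (I.card - m) ≤ Real.exp (θ * (I.card - m)) := by
          have := Real.add_one_le_exp (θ * (I.card - m)); linarith
        calc Real.exp (-θ) ^ I.card * (Real.exp (θ * m) * (1 + θ * (I.card - m)))
            ≤ Real.exp (-θ) ^ I.card * (Real.exp (θ * m) * Real.exp (θ * (I.card - m))) := by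
              gcongr
          _ = 1 := by
              rw [← Real.exp_nat_mul, ← Real.exp_add, ← Real.exp_add, Real.exp_eq_one_iff]
              ring

end HardCore

end SimpleGraph

/-! ### The Lambert function on the nonnegative reals -/

section Lambert

lemma lambertW_spec {y : ℝ} (hy : 0 ≤ y) :
    0 ≤ lambertW y ∧ lambertW y * Real.exp (lambertW y) = y := by
  have hex : ∃ x ∈ Set.Ici (-1 : ℝ), x * Real.exp x = y := by
    have hcont : ContinuousOn (fun x : ℝ => x * Real.exp x) (Set.Icc 0 y) := by fun_prop
    have h := intermediate_value_Icc hy hcont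
    have hmem : y ∈ Set.Icc (0 * Real.exp 0) (y * Real.exp y) := by
      refine ⟨by simpa using hy, ?_⟩
      exact le_mul_of_one_le_right hy (Real.one_le_exp hy)
    obtain ⟨x, hx, hxy⟩ := h hmem
    exact ⟨x, by rw [Set.mem_Ici]; linarith [hx.1], hxy⟩
  have h1 : lambertW y * Real.exp (lambertW y) = y :=
    Function.invFunOn_eq (f := fun x : ℝ => x * Real.exp x) hex
  refine ⟨?_, h1⟩
  by_contra h
  push Not at h
  have := mul_neg_of_neg_of_pos h (Real.exp_pos (lambertW y))
  linarith

/-- For `x ≥ 0` the derivative of `x * exp x` is at least `1`, so the inverse is nondecreasing and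
1-Lipschitz; this supplies the continuity behind the maximum in part 1. -/
lemma lambertW_le_add {x y : ℝ} (hx : 0 ≤ x) (hxy : x ≤ y) :
    lambertW x ≤ lambertW y ∧ lambertW y ≤ lambertW x + (y - x) := by
  obtain ⟨hx0, hx1⟩ := lambertW_spec hx
  obtain ⟨hy0, hy1⟩ := lambertW_spec (hx.trans hxy)
  have hle : lambertW x ≤ lambertW y := by
    by_contra h
    push Not at h
    have h2 := Real.exp_lt_exp.2 h
    have := Real.exp_pos (lambertW y)
    nlinarith
  refine ⟨hle, ?_⟩
  have h2 := Real.exp_le_exp.2 hle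
  have h3 := Real.one_le_exp hy0
  nlinarith

/-- Divide `W(y) * exp (W(y)) = y` by `y`; the resulting form needs no separate value at `0`. -/
lemma lambertRatio_eq_exp {y : ℝ} (hy : 0 ≤ y) :
    lambertRatio y = Real.exp (-lambertW y) := by
  obtain ⟨h0, h1⟩ := lambertW_spec hy
  unfold lambertRatio
  split_ifs with h
  · rw [h] at h1 ⊢
    have : lambertW 0 = 0 := by
      rcases mul_eq_zero.1 h1 with h2 | h2
      · exact h2
      · exact absurd h2 (Real.exp_pos _).ne'
    simp [this]
  · rw [Real.exp_neg, div_eq_iff h, eq_comm, inv_mul_eq_div, div_eq_iff (Real.exp_pos _).ne']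
    exact h1.symm

lemma continuousOn_lambertRatio : ContinuousOn lambertRatio (Set.Ici 0) := by
  have h : LipschitzOnWith 1 lambertW (Set.Ici 0) := by
    refine LipschitzOnWith.of_dist_le_mul fun x hx y hy => ?_
    rw [NNReal.coe_one, one_mul, Real.dist_eq, Real.dist_eq]
    rcases le_total x y with hxy | hxy
    · obtain ⟨h1, h2⟩ := lambertW_le_add hx hxy
      rw [abs_sub_comm, abs_of_nonneg (by linarith), abs_sub_comm, abs_of_nonneg (by linarith)]
      linarith
    · obtain ⟨h1, h2⟩ := lambertW_le_add hy hxy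
      rw [abs_of_nonneg (by linarith), abs_of_nonneg (by linarith)]
      linarith
  have h2 : ContinuousOn (fun y => Real.exp (-lambertW y)) (Set.Ici 0) :=
    Real.continuous_exp.comp_continuousOn h.continuousOn.neg
  exact h2.congr fun y hy => lambertRatio_eq_exp hy

end Lambert

namespace SimpleGraph

/-! ### Lower bound on the occupancy fraction -/

section OccupancyFraction

open scoped Classical

variable {V : Type*} [Fintype V] {G : SimpleGraph V}

lemma indepIn_univ :
    G.indepIn Finset.univ =
      Finset.univ.filter (fun I : Finset V => G.IsIndepSet (I : Set V)) := by
  ext I; simp [mem_indepIn]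

lemma hardCoreZ_eq (lam : ℝ) :
    G.hardCoreZ lam = G.hcSum Finset.univ lam (fun _ => 1) := by
  unfold hardCoreZ hcSum
  rw [indepIn_univ]
  simp

lemma mul_deriv_hardCoreZ (lam : ℝ) :
    lam * deriv G.hardCoreZ lam = G.hcSum Finset.univ lam (fun I => (I.card : ℝ)) := by
  have h : HasDerivAt G.hardCoreZ
      (∑ I ∈ G.indepIn Finset.univ, (I.card : ℝ) * lam ^ (I.card - 1)) lam := by
    have : G.hardCoreZ = fun x => ∑ I ∈ G.indepIn Finset.univ, x ^ I.card := by
      funext x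
      rw [hardCoreZ_eq]
      simp [hcSum]
    rw [this]
    exact HasDerivAt.fun_sum fun I _ => hasDerivAt_pow I.card lam
  rw [h.deriv, hcSum, Finset.mul_sum]
  refine Finset.sum_congr rfl fun I _ => ?_
  rcases Nat.eq_zero_or_pos I.card with h0 | h0
  · simp [h0]
  · conv_rhs => rw [← Nat.sub_add_cancel h0, pow_succ, Nat.sub_add_cancel h0]
    ring

lemma occupancyFraction_eq (lam : ℝ) :
    G.occupancyFraction lam = 1 / (Fintype.card V : ℝ) *
      (G.hcSum Finset.univ lam (fun I => (I.card : ℝ)) /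
        G.hcSum Finset.univ lam (fun _ => 1)) := by
  rw [occupancyFraction, mul_deriv_hardCoreZ, hardCoreZ_eq]

/-- The expected size of a random independent set is monotone in the fugacity. -/
lemma hcSum_card_div_mono {W : Type*} {H : SimpleGraph W} {S : Finset W} {x y : ℝ} (hx : 0 < x)
    (hxy : x ≤ y) :
    H.hcSum S x (fun I => (I.card : ℝ)) / H.hcSum S x (fun _ => 1) ≤
      H.hcSum S y (fun I => (I.card : ℝ)) / H.hcSum S y (fun _ => 1) := by
  have hy : 0 < y := hx.trans_le hxy
  have hZx : 1 ≤ H.hcSum S x (fun _ => 1) := one_le_hcSum_one hx.le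
  have hZy : 1 ≤ H.hcSum S y (fun _ => 1) := one_le_hcSum_one hy.le
  set m := H.hcSum S x (fun I => (I.card : ℝ)) / H.hcSum S x (fun _ => 1) with hm
  rw [le_div_iff₀ (by linarith)]
  have hr : 1 ≤ y / x := (one_le_div hx).2 hxy
  -- Both `(y / x) ^ s` and `s - m` increase with `s`, so replacing `(y / x) ^ m` by `(y / x) ^ |I|`
  -- can only increase each summand. At fugacity `x` the sum vanishes by the choice of `m`.
  have h1 : (y / x) ^ m * (H.hcSum S x (fun I => (I.card : ℝ)) - m * H.hcSum S x (fun _ => 1)) ≤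
      H.hcSum S y (fun I => (I.card : ℝ)) - m * H.hcSum S y (fun _ => 1) := by
    simp only [hcSum]
    rw [Finset.mul_sum, Finset.mul_sum, ← Finset.sum_sub_distrib, ← Finset.sum_sub_distrib,
      Finset.mul_sum]
    refine Finset.sum_le_sum fun I _ => ?_
    have e : y ^ I.card = x ^ I.card * (y / x) ^ (I.card : ℝ) := by
      rw [Real.rpow_natCast, ← mul_pow, mul_div_cancel₀ _ hx.ne']
    rw [e]
    have hk : (y / x) ^ m * ((I.card : ℝ) - m) ≤
        (y / x) ^ (I.card : ℝ) * ((I.card : ℝ) - m) := by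
      rcases le_total m I.card with h | h
      · exact mul_le_mul_of_nonneg_right (Real.rpow_le_rpow_of_exponent_le hr h) (by linarith)
      · exact mul_le_mul_of_nonpos_right (Real.rpow_le_rpow_of_exponent_le hr h) (by linarith)
    have hp : 0 ≤ x ^ I.card := by positivity
    have := mul_le_mul_of_nonneg_left hk hp
    linarith
  have h2 : H.hcSum S x (fun I => (I.card : ℝ)) - m * H.hcSum S x (fun _ => 1) = 0 := by
    rw [hm, div_mul_cancel₀ _ (by linarith), sub_self]
  rw [h2, mul_zero] at h1
  linarith

/-- Lower bound on the occupancy fraction of a graph of bounded local density. -/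
lemma LocalDensityLE.le_occupancy [Nonempty V] [DecidableRel G.Adj] {a x : ℝ} (hx : 0 < x)
    (ha : G.LocalDensityLE a) :
    x / (1 + x) * lambertRatio ((G.maxDegree : ℝ) * (1 + x) ^ a * Real.log (1 + x)) ≤
      G.occupancyFraction x := by
  set D := (G.maxDegree : ℝ) * (1 + x) ^ a * Real.log (1 + x) with hD
  have hlog : 0 ≤ Real.log (1 + x) := Real.log_nonneg (by linarith)
  have hD0 : 0 ≤ D := by positivity
  obtain ⟨hw0, hw1⟩ := lambertW_spec hD0
  rw [lambertRatio_eq_exp hD0]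
  set w := lambertW D
  rw [occupancyFraction_eq]
  set Z := G.hcSum Finset.univ x (fun _ => 1) with hZ
  set N := G.hcSum Finset.univ x (fun I => (I.card : ℝ)) with hN
  have hZ1 : 1 ≤ Z := one_le_hcSum_one hx.le
  set p : V → ℝ := fun v => G.hcSum Finset.univ x (fun I => if v ∈ I then 1 else 0) with hp
  have hp0 : ∀ v, 0 ≤ p v := fun v => hcSum_nonneg hx.le fun I _ => by positivity
  set β := (1 + x) / x * (Real.exp w / (1 + w)) with hβ
  set γ := (1 + x) ^ (a + 1) * Real.log (1 + x) / x / (1 + w) with hγ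
  have hγ0 : 0 ≤ γ := by positivity
  have h1 : ∀ u, Z ≤ β * p u + γ * ∑ v ∈ Finset.univ.filter (fun v => G.Adj u v), p v :=
    fun u => by convert ha.vertex_occupancy hx hw0 (Finset.mem_univ u)
  -- Double counting: in the sum over `u`, each `p v` occurs once per neighbour of `v`.
  have h2 : (Fintype.card V : ℝ) * Z ≤ β * N + γ * (G.maxDegree * N) := by
    have h3 := Finset.sum_le_sum (s := Finset.univ) fun u _ => h1 u
    rw [Finset.sum_const, nsmul_eq_mul, Finset.card_univ, Finset.sum_add_distrib,
      ← Finset.mul_sum, ← Finset.mul_sum] at h3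
    have hNp : N = ∑ v, p v := hcSum_card x
    rw [← hNp] at h3
    refine h3.trans (add_le_add le_rfl (mul_le_mul_of_nonneg_left ?_ hγ0))
    rw [hNp, Finset.mul_sum]
    simp only [Finset.sum_filter]
    rw [Finset.sum_comm]
    refine Finset.sum_le_sum fun v _ => ?_
    rw [← Finset.sum_filter, Finset.sum_const, nsmul_eq_mul]
    refine mul_le_mul_of_nonneg_right ?_ (hp0 v)
    have h4 : (Finset.univ.filter (fun u => G.Adj u v)).card = G.degree v := by
      rw [← card_neighborFinset_eq_degree]
      congr 1
      ext w
      simp [G.adj_comm]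
    rw [h4]
    exact_mod_cast G.degree_le_maxDegree v
  -- The left side is `(1 + x) / x * (exp w + D) / (1 + w)`; it is least where `w * exp w = D`, and
  -- there the last quotient is `exp w`.
  have h5 : β + γ * G.maxDegree = (1 + x) / x * Real.exp w := by
    have e : (1 + x) ^ (a + 1) * Real.log (1 + x) * G.maxDegree = (1 + x) * (w * Real.exp w) := by
      rw [hw1, hD, Real.rpow_add_one (by linarith)]; ring
    have hw2 : 1 + w ≠ 0 := by linarith
    calc β + γ * G.maxDegree = (1 + x) / x * (Real.exp w / (1 + w)) +
          (1 + x) ^ (a + 1) * Real.log (1 + x) * G.maxDegree / x / (1 + w) := by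
            rw [hβ, hγ]; ring
      _ = (1 + x) / x * Real.exp w := by rw [e]; field_simp
  have h6 : (Fintype.card V : ℝ) * Z ≤ (1 + x) / x * Real.exp w * N := by
    rw [← h5]; linarith
  have hn : (0 : ℝ) < Fintype.card V := by exact_mod_cast Fintype.card_pos
  rw [Real.exp_neg, one_div_mul_eq_div, div_div, le_div_iff₀ (by positivity)]
  have hx1 : 0 < 1 + x := by linarith
  have h7 : 0 ≤ x / (1 + x) * (Real.exp w)⁻¹ := by positivity
  calc x / (1 + x) * (Real.exp w)⁻¹ * (Z * Fintype.card V)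
      = x / (1 + x) * (Real.exp w)⁻¹ * (Fintype.card V * Z) := by ring
    _ ≤ x / (1 + x) * (Real.exp w)⁻¹ * ((1 + x) / x * Real.exp w * N) :=
        mul_le_mul_of_nonneg_left h6 h7
    _ = N := by
        have := (Real.exp_pos w).ne'
        field_simp

theorem LocalDensityLE.exists_isGreatest_le_occupancyFraction [Nonempty V] [DecidableRel G.Adj]
    {a lam : ℝ} (hl : 0 < lam) (ha : G.LocalDensityLE a) :
    ∃ M : ℝ, IsGreatest ((fun x : ℝ => x / (1 + x) *
        lambertRatio ((G.maxDegree : ℝ) * (1 + x) ^ a * Real.log (1 + x))) '' Set.Icc 0 lam) M ∧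
      M ≤ G.occupancyFraction lam := by
  set φ : ℝ → ℝ := fun x => x / (1 + x) *
        lambertRatio ((G.maxDegree : ℝ) * (1 + x) ^ a * Real.log (1 + x)) with hφ
  have hpos : ∀ x ∈ Set.Icc 0 lam, (0 : ℝ) < 1 + x := fun x hx => by linarith [hx.1]
  have hcont : ContinuousOn φ (Set.Icc 0 lam) := by
    refine ContinuousOn.mul (ContinuousOn.div (by fun_prop) (by fun_prop)
      fun x hx => (hpos x hx).ne') (continuousOn_lambertRatio.comp ?_ ?_)
    · refine ContinuousOn.mul (ContinuousOn.mul continuousOn_const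
        (ContinuousOn.rpow_const (by fun_prop) fun x hx => Or.inl (hpos x hx).ne'))
        (ContinuousOn.log (by fun_prop) fun x hx => (hpos x hx).ne')
    · intro x hx
      have := Real.log_nonneg (show 1 ≤ 1 + x by linarith [hx.1])
      have := hpos x hx
      rw [Set.mem_Ici]
      positivity
  obtain ⟨x, hx, hmax⟩ := isCompact_Icc.exists_isMaxOn ⟨0, le_rfl, hl.le⟩ hcont
  refine ⟨φ x, ⟨⟨x, hx, rfl⟩, ?_⟩, ?_⟩
  · rintro _ ⟨y, hy, rfl⟩
    exact hmax hy
  · rcases hx.1.eq_or_lt with h0 | h0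
    · have : φ x = 0 := by simp [hφ, ← h0]
      rw [this, occupancyFraction_eq]
      have h1 := one_le_hcSum_one (H := G) (S := Finset.univ) hl.le
      have h2 : 0 ≤ G.hcSum Finset.univ lam (fun I => (I.card : ℝ)) :=
        hcSum_nonneg hl.le fun I _ => by positivity
      positivity
    -- The bound holds at the maximising fugacity `x ≤ lam` and passes to `lam` by monotonicity.
    · refine (ha.le_occupancy h0).trans ?_
      rw [occupancyFraction_eq, occupancyFraction_eq]
      exact mul_le_mul_of_nonneg_left (hcSum_card_div_mono h0 hx.2) (by positivity)

end OccupancyFraction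

/-! ### Greedy fractional colouring with deadlines -/

section FractionalColouring

open scoped Classical

variable {V : Type*} [Fintype V] {G : SimpleGraph V}

/-- The greedy fractional colouring procedure: if every set `S` of vertices carries a probability
distribution on independent sets satisfying a linear occupancy condition with weights `β`, `γ`,
then the remaining demands `1 - c` can be met by independent sets in such a way that the total
weight that has to be used before the deadline `β u + γ u * deg u` fits in after time `T`. -/
lemma exists_weights_of_occupancy {β γ : V → ℝ} (hβ : ∀ u, 0 ≤ β u) (hγ : ∀ u, 0 ≤ γ u)
    (hP : ∀ S : Finset V, S.Nonempty → ∃ P : Finset V → ℝ, (∀ I, 0 ≤ P I) ∧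
      (∀ I, P I ≠ 0 → I ∈ G.indepIn S) ∧ ∑ I, P I = 1 ∧
      ∀ u ∈ S, 1 ≤ β u * (∑ I, if u ∈ I then P I else 0) +
        γ u * ∑ v, if G.Adj u v then (∑ I, if v ∈ I then P I else 0) else 0)
    {b : V → ℝ} (hb : ∀ u, b u = β u + γ u * (Finset.univ.filter (fun v => G.Adj u v)).card)
    (S : Finset V) : ∀ (c : V → ℝ) (T : ℝ), (∀ v, c v ≤ 1) →
      (∀ u ∈ S, T ≤ β u * c u + γ u * ∑ v, if G.Adj u v then c v else 0) →
      ∃ m : Finset V → ℝ, (∀ I, 0 ≤ m I) ∧ (∀ I, m I ≠ 0 → I ∈ G.indepIn S) ∧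
        (∀ u ∈ S, (∑ I, if u ∈ I then m I else 0) = 1 - c u) ∧
        ∀ u ∈ S, (∑ I, if ∃ v ∈ I, b v ≤ b u then m I else 0) ≤ b u - T := by
  induction S using Finset.strongInduction with
  | H S ih =>
  intro c T hc hT
  rcases S.eq_empty_or_nonempty with rfl | hS
  · exact ⟨fun _ => 0, by simp, by simp, by simp, by simp⟩
  obtain ⟨P, hP0, hPS, hP1, hPocc⟩ := hP S hS
  set p : V → ℝ := fun v => ∑ I, if v ∈ I then P I else 0 with hp
  have hp0 : ∀ v, 0 ≤ p v := fun v => Finset.sum_nonneg fun I _ => by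
    split_ifs
    exacts [hP0 I, le_rfl]
  have hpS : ∀ v, v ∉ S → p v = 0 := by
    intro v hv
    refine Finset.sum_eq_zero fun I _ => ?_
    split_ifs with h
    · by_contra hne
      exact hv ((mem_indepIn.1 (hPS I hne)).1 h)
    · rfl
  have hex : (S.filter (fun v => 0 < p v)).Nonempty := by
    by_contra hne
    rw [Finset.not_nonempty_iff_eq_empty, Finset.filter_eq_empty_iff] at hne
    have hz : ∀ v, p v = 0 := by
      intro v
      by_cases hv : v ∈ S
      · exact le_antisymm (not_lt.1 (hne hv)) (hp0 v)
      · exact hpS v hv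
    obtain ⟨u, hu⟩ := hS
    have := hPocc u hu
    change 1 ≤ β u * p u + γ u * ∑ v, (if G.Adj u v then p v else 0) at this
    simp [hz] at this
    linarith
  obtain ⟨u₀, hu₀, hmin⟩ := Finset.exists_min_image _ (fun v => (1 - c v) / p v) hex
  rw [Finset.mem_filter] at hu₀
  -- The longest time for which `P` can be used without overfilling a vertex; afterwards `u₀` is
  -- saturated and leaves `S`.
  set τ := (1 - c u₀) / p u₀ with hτ
  have hτ0 : 0 ≤ τ := div_nonneg (by linarith [hc u₀]) (hp0 _)
  set c' : V → ℝ := fun v => c v + τ * p v with hc'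
  have hc'1 : ∀ v, c' v ≤ 1 := by
    intro v
    rcases (hp0 v).eq_or_lt with h | h
    · simp [hc', ← h, hc v]
    · have hv : v ∈ S := by
        by_contra hv
        exact h.ne' (hpS v hv)
      have h1 := hmin v (Finset.mem_filter.2 ⟨hv, h⟩)
      rw [le_div_iff₀ h] at h1
      simp only [hc']
      linarith
  have hc'0 : c' u₀ = 1 := by
    simp only [hc', hτ]
    rw [div_mul_cancel₀ _ hu₀.2.ne']
    ring
  -- The invariant: elapsed time is at most the occupancy functional of the coverage so far. By the
  -- occupancy condition this functional grows at rate at least `1` at every vertex still in `S`.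
  have hT' : ∀ u ∈ S, T + τ ≤ β u * c' u + γ u * ∑ v, if G.Adj u v then c' v else 0 := by
    intro u hu
    have h1 := hT u hu
    have h2 := mul_le_mul_of_nonneg_left (hPocc u hu) hτ0
    have e : (∑ v, if G.Adj u v then c' v else 0) = (∑ v, if G.Adj u v then c v else 0) +
        τ * ∑ v, if G.Adj u v then p v else 0 := by
      rw [Finset.mul_sum, ← Finset.sum_add_distrib]
      refine Finset.sum_congr rfl fun v _ => ?_
      split_ifs <;> simp [hc']
    rw [e]
    simp only [hc']
    simp only [hp] at h2 ⊢
    linarith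
  -- Coverages never exceed `1`, so the functional is at most `b u`: a vertex of `S` has not passed
  -- its deadline.
  have hTb : ∀ u ∈ S, T + τ ≤ b u := by
    intro u hu
    refine (hT' u hu).trans ?_
    rw [hb]
    refine add_le_add (mul_le_of_le_one_right (hβ u) (hc'1 u))
      (mul_le_mul_of_nonneg_left ?_ (hγ u))
    rw [Finset.card_filter]
    push_cast
    refine Finset.sum_le_sum fun v _ => ?_
    split_ifs
    exacts [hc'1 v, le_rfl]
  set S' := S.filter (fun v => c' v < 1) with hS'
  have hss : S' ⊂ S := by
    refine Finset.filter_ssubset.2 ⟨u₀, hu₀.1, ?_⟩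
    rw [hc'0]; exact lt_irrefl _
  obtain ⟨m, hm0, hmS, hm1, hm2⟩ := ih S' hss c' (T + τ) hc'1
    fun u hu => hT' u (Finset.mem_filter.1 hu).1
  refine ⟨fun I => m I + τ * P I, fun I => add_nonneg (hm0 I) (mul_nonneg hτ0 (hP0 I)), ?_, ?_, ?_⟩
  · intro I hI
    by_cases h : m I = 0
    · have : P I ≠ 0 := by
        intro h'
        simp [h, h'] at hI
      exact hPS I this
    · have := mem_indepIn.1 (hmS I h)
      exact mem_indepIn.2 ⟨this.1.trans hss.1, this.2⟩
  · intro u hu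
    have e : (∑ I, if u ∈ I then m I + τ * P I else 0) =
        (∑ I, if u ∈ I then m I else 0) + τ * p u := by
      rw [hp, Finset.mul_sum, ← Finset.sum_add_distrib]
      refine Finset.sum_congr rfl fun I _ => ?_
      split_ifs <;> simp
    rw [e]
    by_cases hu' : u ∈ S'
    · rw [hm1 u hu']
      simp only [hc']
      ring
    · have h1 : c' u = 1 := by
        refine le_antisymm (hc'1 u) (not_lt.1 fun h => hu' (Finset.mem_filter.2 ⟨hu, h⟩))
      have h2 : (∑ I, if u ∈ I then m I else 0) = 0 := by
        refine Finset.sum_eq_zero fun I _ => ?_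
        split_ifs with h
        · by_contra hne
          exact hu' ((mem_indepIn.1 (hmS I hne)).1 h)
        · rfl
      rw [h2, ← h1]
      simp only [hc']
      ring
  · intro u hu
    have h1 : (∑ I, if ∃ v ∈ I, b v ≤ b u then m I + τ * P I else 0) ≤
        (∑ I, if ∃ v ∈ I, b v ≤ b u then m I else 0) + τ := by
      have : τ = ∑ I, τ * P I := by rw [← Finset.mul_sum, hP1, mul_one]
      conv_rhs => rw [this]
      rw [← Finset.sum_add_distrib]
      refine Finset.sum_le_sum fun I _ => ?_
      have := mul_nonneg hτ0 (hP0 I)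
      split_ifs
      · exact le_rfl
      · linarith
    refine h1.trans ?_
    -- Later rounds use only vertices of `S'`. Among those with deadline at most `b u`, one with the
    -- latest deadline accounts for all the relevant sets, so its inductive bound serves `u`. If
    -- there is none, only the current `τ` counts.
    by_cases hv : (S'.filter (fun v => b v ≤ b u)).Nonempty
    · obtain ⟨v, hvm, hvmax⟩ := Finset.exists_max_image _ b hv
      rw [Finset.mem_filter] at hvm
      have h2 := hm2 v hvm.1
      have h3 : (∑ I, if ∃ v ∈ I, b v ≤ b u then m I else 0) ≤
          ∑ I, if ∃ v' ∈ I, b v' ≤ b v then m I else 0 := by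
        refine Finset.sum_le_sum fun I _ => ?_
        split_ifs with h4 h5 h5
        · exact le_rfl
        · by_contra hne
          push Not at hne
          obtain ⟨x, hx, hxu⟩ := h4
          have hxS := (mem_indepIn.1 (hmS I hne.ne')).1 hx
          exact h5 ⟨x, hx, hvmax x (Finset.mem_filter.2 ⟨hxS, hxu⟩)⟩
        · exact hm0 I
        · exact le_rfl
      linarith [hvm.2]
    · have h3 : (∑ I, if ∃ v ∈ I, b v ≤ b u then m I else 0) = 0 := by
        refine Finset.sum_eq_zero fun I _ => ?_
        split_ifs with h4
        · by_contra hne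
          obtain ⟨x, hx, hxu⟩ := h4
          have hxS := (mem_indepIn.1 (hmS I hne)).1 hx
          exact hv ⟨x, Finset.mem_filter.2 ⟨hxS, hxu⟩⟩
        · rfl
      rw [h3]
      linarith [hTb u hu]

/-- Scheduling by earliest deadline: weights on independent sets obeying the deadline condition
can be realised by disjoint intervals. -/
lemma exists_isFractionalColouring_of_weights {b : V → ℝ} {m : Finset V → ℝ} (hm0 : ∀ I, 0 ≤ m I)
    (hmI : ∀ I, m I ≠ 0 → G.IsIndepSet (I : Set V))
    (hm1 : ∀ u, (∑ I, if u ∈ I then m I else 0) = 1)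
    (hm2 : ∀ u, (∑ I, if ∃ v ∈ I, b v ≤ b u then m I else 0) ≤ b u) {q : ℝ}
    (hq : ∀ u, b u ≤ q) :
    ∃ w : Finset V → Set ℝ, G.IsFractionalColouring q w ∧
      ∀ u, fractionalColours w u ⊆ Set.Ico 0 (b u) := by
  let e := Fintype.equivFin (Finset V)
  -- A set may have been used in several rounds, and merging these into one interval destroys the
  -- chronological order. The sets are therefore scheduled anew by the earliest deadline among their
  -- members, with ties broken by `e`; the empty set serves no vertex and gets length `0` in `m'`.
  let D : Finset V → ℝ := fun I => if h : I.Nonempty then I.inf' h b else 0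
  let key : Finset V → ℝ ×ₗ Fin (Fintype.card (Finset V)) := fun I => toLex (D I, e I)
  have hkey : Function.Injective key := by
    intro I J h
    have := congrArg (fun x => (ofLex x).2) h
    exact e.injective this
  let m' : Finset V → ℝ := fun I => if I.Nonempty then m I else 0
  have hm'0 : ∀ I, 0 ≤ m' I := fun I => by
    simp only [m']
    split_ifs
    exacts [hm0 I, le_rfl]
  let st : Finset V → ℝ := fun I => ∑ J, if key J < key I then m' J else 0
  have hst0 : ∀ I, 0 ≤ st I := fun I => Finset.sum_nonneg fun J _ => by
    split_ifs
    exacts [hm'0 J, le_rfl]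
  have hst : ∀ I, st I + m' I = ∑ J, if key J ≤ key I then m' J else 0 := by
    intro I
    have : m' I = ∑ J, if J = I then m' J else 0 := by simp
    conv_lhs => rw [this]
    rw [← Finset.sum_add_distrib]
    refine Finset.sum_congr rfl fun J _ => ?_
    by_cases h : J = I
    · subst h; simp
    · have : key J ≠ key I := fun h' => h (hkey h')
      simp [h, le_iff_lt_or_eq, this]
  -- If `v` has the earliest deadline in `I`, every nonempty set scheduled up to `I` contains a
  -- vertex of deadline at most `b v`, so its weight is counted in `hm2 v`.
  have hend : ∀ I, ∀ u ∈ I, st I + m' I ≤ b u := by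
    intro I u hu
    have hne : I.Nonempty := ⟨u, hu⟩
    obtain ⟨v, hv, hvD⟩ := I.exists_mem_eq_inf' hne b
    have hDI : D I = b v := by simp only [D, dif_pos hne, hvD]
    have hvu : b v ≤ b u := by rw [← hvD]; exact Finset.inf'_le b hu
    rw [hst]
    refine le_trans ?_ ((hm2 v).trans hvu)
    refine Finset.sum_le_sum fun J _ => ?_
    by_cases hJ : J.Nonempty
    · obtain ⟨x, hx, hxD⟩ := J.exists_mem_eq_inf' hJ b
      have hDJ : D J = b x := by simp only [D, dif_pos hJ, hxD]
      by_cases hk : key J ≤ key I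
      · have hle : D J ≤ D I := by
          rcases Prod.Lex.le_iff.1 hk with h | h
          · exact le_of_lt h
          · exact le_of_eq h.1
        rw [if_pos hk, if_pos ⟨x, hx, by rw [← hDJ, ← hDI]; exact hle⟩]
        simp [m', hJ]
      · rw [if_neg hk]
        split_ifs
        exacts [hm0 J, le_rfl]
    · simp only [m', if_neg hJ, ite_self]
      split_ifs
      exacts [hm0 J, le_rfl]
  refine ⟨fun I => Set.Ico (st I) (st I + m' I), ⟨?_, ?_, ?_, ?_, ?_⟩, ?_⟩
  · intro I hI
    have : m I = 0 := by
      by_contra h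
      exact hI (hmI I h)
    simp [m', this]
  · intro I
    exact Set.ordConnected_Ico
  · intro I
    rcases I.eq_empty_or_nonempty with rfl | ⟨u, hu⟩
    · simp [m']
    · exact Set.Ico_subset_Ico (hst0 I) ((hend I u hu).trans (hq u))
  · have hlt : ∀ I J, key I < key J → st I + m' I ≤ st J := by
      intro I J h
      rw [hst]
      refine Finset.sum_le_sum fun K _ => ?_
      by_cases hK : key K ≤ key I
      · rw [if_pos hK, if_pos (hK.trans_lt h)]
      · rw [if_neg hK]
        split_ifs
        exacts [hm'0 K, le_rfl]
    intro I J hIJ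
    have : key I ≠ key J := fun h => hIJ (hkey h)
    rcases lt_or_gt_of_ne this with h | h
    · exact Set.disjoint_left.2 fun x hx hy => by linarith [hx.2, hy.1, hlt I J h]
    · exact Set.disjoint_left.2 fun x hx hy => by linarith [hx.1, hy.2, hlt J I h]
  · intro x
    have e1 : ∀ I ∈ Finset.univ.filter (fun I : Finset V => x ∈ I),
        MeasureTheory.volume (Set.Ico (st I) (st I + m' I)) = ENNReal.ofReal (m I) := by
      intro I hI
      rw [Real.volume_Ico]
      have : I.Nonempty := ⟨x, (Finset.mem_filter.1 hI).2⟩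
      simp [m', this]
    have e2 := Finset.sum_congr rfl e1
    have e3 : ∑ I ∈ Finset.univ.filter (fun I : Finset V => x ∈ I), m I = 1 := by
      rw [Finset.sum_filter]
      exact hm1 x
    rw [← ENNReal.ofReal_sum_of_nonneg (fun I _ => hm0 I), e3, ENNReal.ofReal_one] at e2
    exact e2
  · intro u
    refine Set.iUnion₂_subset fun I hu => ?_
    exact Set.Ico_subset_Ico (hst0 I) (hend I u hu)

/-- Fractional colouring of graphs of bounded local density, with a free parameter `w u` for each
vertex. -/
theorem LocalDensityLE.exists_isFractionalColouring {a lam : ℝ} (hl : 0 < lam)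
    (ha : G.LocalDensityLE a) {w : V → ℝ} (hw : ∀ u, 0 ≤ w u) {b : V → ℝ}
    (hb : ∀ u, b u = (1 + lam) / lam * (Real.exp (w u) / (1 + w u)) +
      (1 + lam) ^ (a + 1) * Real.log (1 + lam) / lam / (1 + w u) *
        (Finset.univ.filter (fun v => G.Adj u v)).card) {q : ℝ} (hq : ∀ u, b u ≤ q) :
    ∃ c : Finset V → Set ℝ, G.IsFractionalColouring q c ∧
      ∀ u, fractionalColours c u ⊆ Set.Ico 0 (b u) := by
  have hlog : 0 ≤ Real.log (1 + lam) := Real.log_nonneg (by linarith)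
  have hβ : ∀ u, 0 ≤ (1 + lam) / lam * (Real.exp (w u) / (1 + w u)) := fun u => by
    have := hw u
    positivity
  have hγ : ∀ u, 0 ≤ (1 + lam) ^ (a + 1) * Real.log (1 + lam) / lam / (1 + w u) := fun u => by
    have := hw u
    positivity
  have hP : ∀ S : Finset V, S.Nonempty → ∃ P : Finset V → ℝ, (∀ I, 0 ≤ P I) ∧
      (∀ I, P I ≠ 0 → I ∈ G.indepIn S) ∧ ∑ I, P I = 1 ∧
      ∀ u ∈ S, 1 ≤ (1 + lam) / lam * (Real.exp (w u) / (1 + w u)) *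
          (∑ I, if u ∈ I then P I else 0) +
        (1 + lam) ^ (a + 1) * Real.log (1 + lam) / lam / (1 + w u) *
          ∑ v, if G.Adj u v then (∑ I, if v ∈ I then P I else 0) else 0 := by
    intro S hS
    set Z := G.hcSum S lam (fun _ => 1) with hZ
    have hZ1 : 1 ≤ Z := one_le_hcSum_one hl.le
    have hZ0 : 0 < Z := by linarith
    have hsum : ∀ f : Finset V → ℝ, (∑ I, (if I ∈ G.indepIn S then lam ^ I.card / Z else 0) * f I)
        = G.hcSum S lam f / Z := by
      intro f
      rw [hcSum, Finset.sum_div]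
      simp only [ite_mul, zero_mul]
      rw [Finset.sum_ite_mem, Finset.univ_inter]
      exact Finset.sum_congr rfl fun I _ => by ring
    have hmem : ∀ v, (∑ I : Finset V, if v ∈ I then
        (if I ∈ G.indepIn S then lam ^ I.card / Z else 0) else 0) =
        G.hcSum S lam (fun I => if v ∈ I then 1 else 0) / Z := by
      intro v
      rw [← hsum]
      exact Finset.sum_congr rfl fun I _ => by split_ifs <;> simp
    refine ⟨fun I => if I ∈ G.indepIn S then lam ^ I.card / Z else 0, ?_, ?_, ?_, ?_⟩
    · intro I
      dsimp only
      split_ifs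
      exacts [by positivity, le_rfl]
    · intro I hI
      by_contra h
      simp [h] at hI
    · have := hsum (fun _ => 1)
      simp only [mul_one] at this
      rw [this, ← hZ, div_self hZ0.ne']
    · intro u hu
      have h1 := ha.vertex_occupancy hl (hw u) hu
      simp only [hmem]
      rw [← hZ] at h1
      have e : (∑ v, if G.Adj u v then G.hcSum S lam (fun I => if v ∈ I then 1 else 0) / Z else 0) =
          (∑ v ∈ S.filter (fun v => G.Adj u v),
            G.hcSum S lam (fun I => if v ∈ I then 1 else 0)) / Z := by
        rw [Finset.sum_div, Finset.sum_filter]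
        symm
        refine Finset.sum_subset (Finset.subset_univ S) fun v _ hv => ?_
        have : G.hcSum S lam (fun I => if v ∈ I then 1 else 0) = 0 := by
          refine Finset.sum_eq_zero fun I hI => ?_
          have : v ∉ I := fun h => hv ((mem_indepIn.1 hI).1 h)
          simp [this]
        simp [this]
      rw [e]
      calc (1 : ℝ) = Z / Z := (div_self hZ0.ne').symm
        _ ≤ _ := div_le_div_of_nonneg_right h1 hZ0.le
        _ = _ := by ring
  obtain ⟨m, hm0, hmI, hm1, hm2⟩ := exists_weights_of_occupancy hβ hγ hP hb
    Finset.univ (fun _ => 0) 0 (fun _ => zero_le_one) (fun u _ => by simp)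
  refine exists_isFractionalColouring_of_weights hm0 (fun I hI => (mem_indepIn.1 (hmI I hI)).2)
    (fun u => ?_) (fun u => ?_) hq
  · rw [hm1 u (Finset.mem_univ u), sub_zero]
  · simpa using hm2 u (Finset.mem_univ u)

end FractionalColouring

end SimpleGraph

/-! ### Balancing the parameters -/

section Analysis

/-- The choice of parameters balancing the two terms of the local occupancy bound. -/
lemma exists_balance {ε : ℝ} (hε : 0 < ε) :
    ∃ η : ℝ, 0 < η ∧ η < 1 ∧ ∀ M : ℝ, 0 < M → ∀ w₀ : ℝ, ∃ δ₀ : ℝ, 1 < δ₀ ∧ ∀ x : ℝ, δ₀ ≤ x →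
      ∃ w : ℝ, 0 ≤ w ∧ w₀ ≤ w ∧
        (Real.exp (3 * η) * x + M * Real.exp w) / (1 + w) ≤ (1 + ε) * (x / Real.log x) := by
  have h1 : Tendsto (fun η : ℝ => Real.exp (3 * η) + η) (𝓝[>] 0) (𝓝 1) := by
    have : Tendsto (fun η : ℝ => Real.exp (3 * η) + η) (𝓝 0) (𝓝 (Real.exp (3 * 0) + 0)) :=
      (Continuous.tendsto (by fun_prop) 0)
    simp only [mul_zero, Real.exp_zero, add_zero] at this
    exact this.mono_left nhdsWithin_le_nhds
  have h2 : ∀ᶠ η : ℝ in 𝓝[>] 0, Real.exp (3 * η) + η < 1 + ε / 2 :=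
    h1.eventually_lt_const (by linarith)
  have h3 : ∀ᶠ η : ℝ in 𝓝[>] 0, η ∈ Set.Ioo (0 : ℝ) 1 := Ioo_mem_nhdsGT one_pos
  obtain ⟨η, h2, h3⟩ := (h2.and h3).exists
  refine ⟨η, h3.1, h3.2, fun M hM w₀ => ?_⟩
  -- With `w = log x + c` one has `M * exp w = η * x`, a small multiple of the main term, while `1 +
  -- w` is `log x` up to a constant. Since `η` is fixed first, `M` and `w₀` may depend on it.
  set c := Real.log (η / M) with hc
  have hlog := Real.tendsto_log_atTop
  have e1 : ∀ᶠ x : ℝ in atTop, |w₀| + |c| + 1 ≤ Real.log x :=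
    hlog.eventually_ge_atTop _
  have e2 : ∀ᶠ x : ℝ in atTop, (1 + ε) * (1 + |c|) / (ε / 2) ≤ Real.log x :=
    hlog.eventually_ge_atTop _
  obtain ⟨δ, hδ⟩ := eventually_atTop.1 (e1.and (e2.and (eventually_gt_atTop 1)))
  refine ⟨max δ 2, lt_max_of_lt_right (by norm_num), fun x hx => ?_⟩
  obtain ⟨a1, a2, a3⟩ := hδ x ((le_max_left _ _).trans hx)
  have hx0 : 0 < x := by linarith
  refine ⟨Real.log x + c, ?_, ?_, ?_⟩
  · have := neg_abs_le c
    have := abs_nonneg w₀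
    linarith
  · have := neg_abs_le c
    have := le_abs_self w₀
    linarith
  · have hexp : Real.exp (Real.log x + c) = η * x / M := by
      rw [Real.exp_add, Real.exp_log hx0, hc, Real.exp_log (by have := h3.1; positivity)]
      ring
    have hL : 0 < Real.log x := Real.log_pos a3
    have hc1 := neg_abs_le c
    have hw1 : 0 < 1 + (Real.log x + c) := by
      have := abs_nonneg w₀
      linarith
    rw [hexp, mul_div_cancel₀ _ hM.ne', ← add_mul, mul_div_assoc', div_le_div_iff₀ hw1 hL]
    rw [div_le_iff₀ (by positivity)] at a2
    have h5 : (Real.exp (3 * η) + η) * Real.log x ≤ (1 + ε) * (1 + (Real.log x + c)) := by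
      have := mul_le_mul_of_nonneg_right h2.le hL.le
      nlinarith [abs_nonneg c]
    nlinarith

/-- An error term tending to zero can be extracted from eventual bounds with arbitrarily small
relative error. -/
lemma exists_tendsto_zero_of_eventually {P : ℕ → ℝ → Prop}
    (hmono : ∀ n ε ε', ε ≤ ε' → P n ε → P n ε') (h : ∀ ε : ℝ, 0 < ε → ∀ᶠ n in atTop, P n ε) :
    ∃ err : ℕ → ℝ, Tendsto err atTop (𝓝 0) ∧ ∀ᶠ n in atTop, P n (err n) := by
  let A : ℕ → Set ℝ := fun n => {ε : ℝ | 0 < ε ∧ P n ε}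
  have hbdd : ∀ n, BddBelow (A n) := fun n => ⟨0, fun ε hε => hε.1.le⟩
  have hnn : ∀ n, 0 ≤ sInf (A n) := fun n => Real.sInf_nonneg fun ε hε => hε.1.le
  -- The infimum of the admissible errors need not be admissible; the vanishing summand moves past
  -- it.
  refine ⟨fun n => sInf (A n) + 1 / ((n : ℝ) + 1), ?_, ?_⟩
  · have h1 : Tendsto (fun n => sInf (A n)) atTop (𝓝 0) := by
      rw [Metric.tendsto_atTop]
      intro ε hε
      obtain ⟨N, hN⟩ := eventually_atTop.1 (h (ε / 2) (by linarith))
      refine ⟨N, fun n hn => ?_⟩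
      rw [Real.dist_eq, sub_zero, abs_of_nonneg (hnn n)]
      have : sInf (A n) ≤ ε / 2 := csInf_le (hbdd n) ⟨by linarith, hN n hn⟩
      linarith
    simpa using h1.add tendsto_one_div_add_atTop_nhds_zero_nat
  · filter_upwards [h 1 one_pos] with n hn
    have hne : (A n).Nonempty := ⟨1, one_pos, hn⟩
    obtain ⟨ε, hε, hlt⟩ := exists_lt_of_csInf_lt hne
      (show sInf (A n) < sInf (A n) + 1 / ((n : ℝ) + 1) by
        have : (0 : ℝ) < 1 / ((n : ℝ) + 1) := by positivity
        linarith)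
    exact hmono n _ _ hlt.le hε.2

/-- The local density is of order at most `K = k + √t`, so at fugacity `η / K` the factor `(1 + lam)
^ (a + 1)` stays close to `1` for small `η`. -/
lemma pathDensity_bounds {k : ℕ} {t : ℝ} (hk : 3 ≤ k) (ht : 1 / 2 ≤ t) :
    0 ≤ (k : ℝ) - 3 + √(2 * t) ∧ (k : ℝ) - 3 + √(2 * t) + 1 ≤ 2 * ((k : ℝ) + √t) ∧
      3 ≤ (k : ℝ) + √t := by
  have hk' : (3 : ℝ) ≤ k := by exact_mod_cast hk
  have h1 := Real.sqrt_nonneg (2 * t)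
  have h2 := Real.sqrt_nonneg t
  have h3 : √(2 * t) ≤ 2 * √t := by
    rw [Real.sqrt_le_left (by positivity), mul_pow, Real.sq_sqrt (by linarith)]
    linarith
  exact ⟨by linarith, by linarith, by linarith⟩

lemma one_add_rpow_le_exp {η K a : ℝ} (hη : 0 < η) (hK : 0 < K) (ha : 0 ≤ a + 1)
    (haK : a + 1 ≤ 2 * K) : (1 + η / K) ^ (a + 1) ≤ Real.exp (2 * η) := by
  have h1 : 1 + η / K ≤ Real.exp (η / K) := by
    have := Real.add_one_le_exp (η / K)
    linarith
  calc (1 + η / K) ^ (a + 1) ≤ Real.exp (η / K) ^ (a + 1) :=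
        Real.rpow_le_rpow (by positivity) h1 ha
    _ = Real.exp (η / K * (a + 1)) := by rw [Real.exp_mul]
    _ ≤ Real.exp (2 * η) := by
        apply Real.exp_le_exp.2
        calc η / K * (a + 1) ≤ η / K * (2 * K) := by gcongr
          _ = 2 * η := by field_simp

/-- The fractional colouring bound at fugacity `η / K`. -/
lemma occupancy_weight_le {η K a w d : ℝ} (hη : 0 < η) (hη1 : η < 1) (hK : 3 ≤ K)
    (ha : 0 ≤ a) (haK : a + 1 ≤ 2 * K) (hw : 0 ≤ w) (hd : 0 ≤ d) :
    (1 + η / K) / (η / K) * (Real.exp w / (1 + w)) +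
      (1 + η / K) ^ (a + 1) * Real.log (1 + η / K) / (η / K) / (1 + w) * d ≤
    K * ((Real.exp (3 * η) * (d / K) + 2 / η * Real.exp w) / (1 + w)) := by
  have hK0 : 0 < K := by linarith
  have hl : 0 < η / K := by positivity
  have hl1 : η / K ≤ 1 := by rw [div_le_one hK0]; linarith
  have hw1 : 0 < 1 + w := by linarith
  have h1 : (1 + η / K) / (η / K) ≤ K * (2 / η) := by
    rw [div_le_iff₀ hl]
    calc 1 + η / K ≤ 2 := by linarith
      _ = K * (2 / η) * (η / K) := by field_simp
  have h2 : (1 + η / K) ^ (a + 1) * Real.log (1 + η / K) / (η / K) ≤ Real.exp (3 * η) := by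
    rw [div_le_iff₀ hl]
    have h3 : Real.log (1 + η / K) ≤ η / K := by
      have := Real.log_le_sub_one_of_pos (show 0 < 1 + η / K by linarith)
      linarith
    have h4 := one_add_rpow_le_exp hη hK0 (by linarith) haK
    -- Here `2 * η` would suffice; the third `η` is needed in the tail bound for correspondence
    -- colouring, and the weaker estimate lets both use the same balance.
    have h5 : Real.exp (2 * η) ≤ Real.exp (3 * η) := Real.exp_le_exp.2 (by linarith)
    exact mul_le_mul (h4.trans h5) h3 (Real.log_nonneg (by linarith)) (Real.exp_pos _).le
  calc (1 + η / K) / (η / K) * (Real.exp w / (1 + w)) +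
      (1 + η / K) ^ (a + 1) * Real.log (1 + η / K) / (η / K) / (1 + w) * d
      ≤ K * (2 / η) * (Real.exp w / (1 + w)) + Real.exp (3 * η) / (1 + w) * d := by
        gcongr
    _ = _ := by field_simp; ring

/-- Balanced parameters for every ratio `D`, with the ratio truncated at `δ₀` from below. -/
lemma exists_balance_max {ε η M w₀ δ₀ : ℝ}
    (h : ∀ x : ℝ, δ₀ ≤ x → ∃ w : ℝ, 0 ≤ w ∧ w₀ ≤ w ∧
        (Real.exp (3 * η) * x + M * Real.exp w) / (1 + w) ≤ (1 + ε) * (x / Real.log x))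
    (hε : 0 < ε) {Λ d : ℝ} (hΛ : 0 < Λ) :
    ∃ w : ℝ, 0 ≤ w ∧ w₀ ≤ w ∧
      Λ * ((Real.exp (3 * η) * (d / Λ) + M * Real.exp w) / (1 + w)) ≤
        (1 + ε) * max (d / Real.log (d / Λ)) (δ₀ / Real.log δ₀ * Λ) := by
  rcases le_total δ₀ (d / Λ) with hD | hD
  · obtain ⟨w, hw, hw0, hb⟩ := h _ hD
    refine ⟨w, hw, hw0, ?_⟩
    calc Λ * ((Real.exp (3 * η) * (d / Λ) + M * Real.exp w) / (1 + w))
        ≤ Λ * ((1 + ε) * (d / Λ / Real.log (d / Λ))) := mul_le_mul_of_nonneg_left hb hΛ.le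
      _ = (1 + ε) * (d / Real.log (d / Λ)) := by field_simp
      _ ≤ _ := mul_le_mul_of_nonneg_left (le_max_left _ _) (by linarith)
  -- A small degree is treated as `δ₀ * Λ`. Only the second entry of the maximum is used, so the
  -- value of the first one, possibly a quotient by zero or a negative number, is irrelevant.
  · obtain ⟨w, hw, hw0, hb⟩ := h _ le_rfl
    refine ⟨w, hw, hw0, ?_⟩
    have h1 : (Real.exp (3 * η) * (d / Λ) + M * Real.exp w) / (1 + w) ≤
        (Real.exp (3 * η) * δ₀ + M * Real.exp w) / (1 + w) := by gcongr
    calc Λ * ((Real.exp (3 * η) * (d / Λ) + M * Real.exp w) / (1 + w))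
        ≤ Λ * ((1 + ε) * (δ₀ / Real.log δ₀)) :=
          mul_le_mul_of_nonneg_left (h1.trans hb) hΛ.le
      _ = (1 + ε) * (δ₀ / Real.log δ₀ * Λ) := by ring
      _ ≤ _ := mul_le_mul_of_nonneg_left (le_max_right _ _) (by linarith)

end Analysis

namespace SimpleGraph

/-! ### The fractional colouring theorems -/

section FractionalTheorems

lemma card_filter_adj_eq_degree {V : Type*} [Fintype V] (G : SimpleGraph V) [DecidableRel G.Adj]
    (u : V) : (Finset.univ.filter (fun v => G.Adj u v)).card = G.degree u := by
  rw [← card_neighborFinset_eq_degree]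
  congr 1
  ext w
  simp

theorem local_fractional_colouring {ε : ℝ} (hε : 0 < ε) : ∃ δ₀ : ℝ, 1 < δ₀ ∧
    ∀ (V : Type u) [Fintype V] (G : SimpleGraph V) [DecidableRel G.Adj]
      (k : ℕ) (t : ℝ), 3 ≤ k → 1 / 2 ≤ t → G.NbhdPathCountLE k t →
    ∃ (q : ℝ) (w : Finset V → Set ℝ), G.IsFractionalColouring q w ∧
      ∀ a : V, fractionalColours w a ⊆
        Set.Ico 0 ((1 + ε) *
          max ((G.degree a : ℝ) / Real.log ((G.degree a : ℝ) / ((k : ℝ) + √t)))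
            (δ₀ / Real.log δ₀ * ((k : ℝ) + √t))) := by
  classical
  obtain ⟨η, hη, hη1, h⟩ := exists_balance hε
  obtain ⟨δ₀, hδ, h⟩ := h (2 / η) (by positivity) 0
  refine ⟨δ₀, hδ, fun V _ G _ k t hk ht hG => ?_⟩
  obtain ⟨ha0, haK, hK⟩ := pathDensity_bounds hk ht
  have hK0 : (0 : ℝ) < (k : ℝ) + √t := by linarith
  have hd := hG.localDensityLE hk (by linarith)
  set a := (k : ℝ) - 3 + √(2 * t)
  set K := (k : ℝ) + √t
  choose w hw0 _ hw using fun u : V =>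
    exists_balance_max h hε (Λ := K) (d := (G.degree u : ℝ)) hK0
  set b : V → ℝ := fun u => (1 + η / K) / (η / K) * (Real.exp (w u) / (1 + w u)) +
      (1 + η / K) ^ (a + 1) * Real.log (1 + η / K) / (η / K) / (1 + w u) *
        (Finset.univ.filter (fun v => G.Adj u v)).card with hb
  have hb0 : ∀ u, 0 ≤ b u := fun u => by
    have h1 := hw0 u
    have h2 : 0 ≤ Real.log (1 + η / K) := Real.log_nonneg (by
      have : 0 < η / K := by positivity
      linarith)
    positivity
  -- Any common upper bound of the deadlines can serve as `q`; their sum is one.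
  obtain ⟨c, hc, hcb⟩ := hd.exists_isFractionalColouring (lam := η / K) (by positivity) hw0
    (b := b) (fun u => by simp only [hb]; congr!) (q := ∑ u, b u)
    (fun u => Finset.single_le_sum (fun v _ => hb0 v) (Finset.mem_univ u))
  refine ⟨_, c, hc, fun u => (hcb u).trans (Set.Ico_subset_Ico_right ?_)⟩
  refine le_trans ?_ (hw u)
  simp only [hb, card_filter_adj_eq_degree]
  exact occupancy_weight_le hη hη1 hK ha0 haK (hw0 u) (by positivity)

/-- A vertex is needed for the infimum to be meaningful: on the empty graph every real `q` is
admissible and the set has no lower bound. -/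
lemma fracChromaticNumber_le {V : Type*} [Fintype V] [Nonempty V] {G : SimpleGraph V} {q : ℝ}
    {w : Finset V → Set ℝ} (h : G.IsFractionalColouring q w) : G.fracChromaticNumber ≤ q := by
  classical
  refine csInf_le ⟨0, ?_⟩ ⟨w, h⟩
  rintro r ⟨c, hc⟩
  obtain ⟨v⟩ := ‹Nonempty V›
  by_contra hr
  push Not at hr
  have h1 := hc.sum_length v
  have h2 : ∀ I, c I = ∅ := fun I => by
    have := hc.subset_Ico I
    rwa [Set.Ico_eq_empty (by linarith), Set.subset_empty_iff] at this
  simp [h2] at h1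

theorem fracChromaticNumber_asymptotic (k : ℕ → ℕ) (t : ℕ → ℝ) (hk : ∀ Δ, 3 ≤ k Δ)
    (ht : ∀ Δ, 1 / 2 ≤ t Δ)
    (hlim : Tendsto (fun Δ : ℕ => (Δ : ℝ) / ((k Δ : ℝ) + √(t Δ))) atTop atTop) :
    ∃ err : ℕ → ℝ, Tendsto err atTop (𝓝 0) ∧ ∀ᶠ Δ : ℕ in atTop,
      ∀ (V : Type u) [Fintype V] (G : SimpleGraph V) [DecidableRel G.Adj],
        G.maxDegree = Δ → G.NbhdPathCountLE (k Δ) (t Δ) →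
        G.fracChromaticNumber ≤
          (1 + err Δ) * ((Δ : ℝ) / Real.log ((Δ : ℝ) / ((k Δ : ℝ) + √(t Δ)))) := by
  classical
  -- Nonnegativity of the main term is included so that `P` is monotone in `ε`.
  let P : ℕ → ℝ → Prop := fun Δ ε =>
    0 ≤ (Δ : ℝ) / Real.log ((Δ : ℝ) / ((k Δ : ℝ) + √(t Δ))) ∧
    ∀ (V : Type u) [Fintype V] (G : SimpleGraph V) [DecidableRel G.Adj],
        G.maxDegree = Δ → G.NbhdPathCountLE (k Δ) (t Δ) →
        G.fracChromaticNumber ≤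
          (1 + ε) * ((Δ : ℝ) / Real.log ((Δ : ℝ) / ((k Δ : ℝ) + √(t Δ))))
  suffices hP : ∀ ε : ℝ, 0 < ε → ∀ᶠ Δ in atTop, P Δ ε by
    have hmono : ∀ Δ ε ε', ε ≤ ε' → P Δ ε → P Δ ε' := fun Δ ε ε' hle h =>
      ⟨h.1, fun V _ G _ h1 h2 => (h.2 V G h1 h2).trans
        (mul_le_mul_of_nonneg_right (by linarith) h.1)⟩
    obtain ⟨err, herr, hP⟩ := exists_tendsto_zero_of_eventually hmono hP
    exact ⟨err, herr, hP.mono fun Δ h => h.2⟩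
  intro ε hε
  obtain ⟨η, hη, hη1, h⟩ := exists_balance hε
  obtain ⟨δ₀, hδ, h⟩ := h (2 / η) (by positivity) 0
  filter_upwards [hlim.eventually_ge_atTop δ₀] with Δ hΔ
  obtain ⟨ha0, haK, hK⟩ := pathDensity_bounds (hk Δ) (ht Δ)
  have hK0 : (0 : ℝ) < (k Δ : ℝ) + √(t Δ) := by linarith
  have hlogpos := Real.log_pos (hδ.trans_le hΔ)
  refine ⟨by positivity, fun V _ G _ hmax hG => ?_⟩
  have hne : Nonempty V := by
    by_contra hne
    rw [not_nonempty_iff] at hne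
    have : G.maxDegree = 0 := by simp
    rw [this] at hmax
    rw [← hmax] at hΔ
    simp at hΔ
    linarith
  have hd := hG.localDensityLE (hk Δ) (by linarith [ht Δ])
  set a := (k Δ : ℝ) - 3 + √(2 * t Δ)
  set K := (k Δ : ℝ) + √(t Δ)
  -- One `w`, balanced for the maximum degree, serves all vertices, because the deadline increases
  -- with the degree.
  obtain ⟨w, hw0, -, hw⟩ := h _ hΔ
  set b : V → ℝ := fun u => (1 + η / K) / (η / K) * (Real.exp w / (1 + w)) +
      (1 + η / K) ^ (a + 1) * Real.log (1 + η / K) / (η / K) / (1 + w) *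
        (Finset.univ.filter (fun v => G.Adj u v)).card with hb
  suffices hq : ∀ u, b u ≤ (1 + ε) * ((Δ : ℝ) / Real.log ((Δ : ℝ) / K)) by
    obtain ⟨c, hc, -⟩ := hd.exists_isFractionalColouring (lam := η / K) (by positivity)
      (w := fun _ => w) (fun _ => hw0) (b := b) (fun u => by simp only [hb]; congr!) hq
    exact fracChromaticNumber_le hc
  intro u
  simp only [hb, card_filter_adj_eq_degree]
  refine (occupancy_weight_le hη hη1 hK ha0 haK hw0 (by positivity)).trans ?_
  have h1 : (G.degree u : ℝ) ≤ Δ := by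
    rw [← hmax]
    exact_mod_cast G.degree_le_maxDegree u
  calc K * ((Real.exp (3 * η) * (G.degree u / K) + 2 / η * Real.exp w) / (1 + w))
      ≤ K * ((Real.exp (3 * η) * (Δ / K) + 2 / η * Real.exp w) / (1 + w)) := by gcongr
    _ ≤ K * ((1 + ε) * (Δ / K / Real.log (Δ / K))) := mul_le_mul_of_nonneg_left hw hK0.le
    _ = _ := by field_simp

end FractionalTheorems

end SimpleGraph

/-! ### The lopsided local lemma -/

section LocalLemma

open scoped Classical

/-- The lopsided Lovász local lemma for a finite weighted space: if, for every set `S` of events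
avoiding `Γ i`, the event `B i` has probability at most `p` conditionally on avoiding all events
of `S`, and `4 p D ≤ 1` where `D` bounds the sizes of the sets `Γ i`, then all events can be avoided
simultaneously. -/
theorem lopsided_local_lemma {ι Ω : Type*} (E : Finset Ω) (μ : Ω → ℝ) (hμ : ∀ x, 0 ≤ μ x)
    (hE : 0 < ∑ x ∈ E, μ x) (B : ι → Ω → Prop) (Γ : ι → Finset ι) {p : ℝ} {D : ℕ} (hp : 0 ≤ p)
    (hpD : 4 * p * D ≤ 1) (hD1 : 1 ≤ D) (hD : ∀ i, (Γ i).card ≤ D)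
    (U : Finset ι) (hB : ∀ i ∈ U, ∀ S ⊆ U, Disjoint S (Γ i) →
      ∑ x ∈ E.filter (fun x => B i x ∧ ∀ j ∈ S, ¬ B j x), μ x ≤
        p * ∑ x ∈ E.filter (fun x => ∀ j ∈ S, ¬ B j x), μ x) :
    ∃ x ∈ E, ∀ j ∈ U, ¬ B j x := by
  set M : Finset ι → ℝ := fun S => ∑ x ∈ E.filter (fun x => ∀ j ∈ S, ¬ B j x), μ x with hM
  set MB : ι → Finset ι → ℝ := fun i S =>
    ∑ x ∈ E.filter (fun x => B i x ∧ ∀ j ∈ S, ¬ B j x), μ x with hMB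
  have hM0 : ∀ S, 0 ≤ M S := fun S => Finset.sum_nonneg fun x _ => hμ x
  have hinsert : ∀ i S, M S = M (insert i S) + MB i S := by
    intro i S
    simp only [hM, hMB]
    rw [← Finset.sum_filter_add_sum_filter_not (E.filter (fun x => ∀ j ∈ S, ¬ B j x))
      (fun x => ¬ B i x), Finset.filter_filter, Finset.filter_filter]
    congr 1
    · refine Finset.sum_congr (Finset.filter_congr fun x _ => ?_) fun _ _ => rfl
      simp only [Finset.forall_mem_insert]
      tauto
    · refine Finset.sum_congr (Finset.filter_congr fun x _ => ?_) fun _ _ => rfl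
      tauto
  have hMBmono : ∀ i S T, S ⊆ T → MB i T ≤ MB i S := by
    intro i S T h
    refine Finset.sum_le_sum_of_subset_of_nonneg ?_ fun x _ _ => hμ x
    intro x hx
    rw [Finset.mem_filter] at hx ⊢
    exact ⟨hx.1, hx.2.1, fun j hj => hx.2.2 j (h hj)⟩
  have hunion : ∀ S T : Finset ι, M S ≤ M (S ∪ T) + ∑ j ∈ T, MB j S := by
    intro S T
    induction T using Finset.induction_on with
    | empty => simp
    | insert i T hi ih =>
      rw [Finset.sum_insert hi, Finset.union_insert]
      have h1 := hinsert i (S ∪ T)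
      have h2 := hMBmono i S (S ∪ T) Finset.subset_union_left
      linarith
  -- Given that `S` is avoided, `B i` has probability at most `2 * p`. Conditioning on `S2` alone
  -- gives `p`. Given `S2`, the at most `D` events of `S1` have probability at most `2 * p` each by
  -- induction, so they are all avoided with probability at least `1 / 2`, which costs a factor `2`.
  have claim : ∀ n : ℕ, ∀ S ⊆ U, S.card = n → ∀ i ∈ U, MB i S ≤ 2 * p * M S := by
    intro n
    induction n using Nat.strong_induction_on with
    | _ n ih =>
    intro S hSU hS i hi
    set S1 := S ∩ Γ i with hS1
    set S2 := S \ Γ i with hS2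
    have hSS : S2 ∪ S1 = S := Finset.sdiff_union_inter S (Γ i)
    have h1 : MB i S ≤ p * M S2 :=
      (hMBmono i S2 S Finset.sdiff_subset).trans (hB i hi S2 (Finset.sdiff_subset.trans hSU) Finset.sdiff_disjoint)
    rcases S1.eq_empty_or_nonempty with h0 | h0
    · rw [h0, Finset.union_empty] at hSS
      rw [hSS] at h1
      have := mul_nonneg hp (hM0 S)
      linarith
    have hlt : S2.card < n := by
      rw [← hS]
      refine Finset.card_lt_card ?_
      rw [Finset.ssubset_iff_subset_ne]
      refine ⟨Finset.sdiff_subset, fun h => ?_⟩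
      obtain ⟨j, hj⟩ := h0
      rw [hS1, Finset.mem_inter] at hj
      have := hj.1
      rw [← h, hS2, Finset.mem_sdiff] at this
      exact this.2 hj.2
    have h2 := hunion S2 S1
    rw [hSS] at h2
    have h3 : ∑ j ∈ S1, MB j S2 ≤ 1 / 2 * M S2 := by
      calc ∑ j ∈ S1, MB j S2 ≤ ∑ j ∈ S1, 2 * p * M S2 :=
            Finset.sum_le_sum fun j hj => ih _ hlt S2 (Finset.sdiff_subset.trans hSU) rfl j
              (hSU (Finset.mem_inter.1 hj).1)
        _ = S1.card * (2 * p * M S2) := by simp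
        _ ≤ D * (2 * p * M S2) := by
            refine mul_le_mul_of_nonneg_right ?_ (by have := hM0 S2; positivity)
            exact_mod_cast (Finset.card_le_card Finset.inter_subset_right).trans (hD i)
        _ = 4 * p * D * (1 / 2 * M S2) := by ring
        _ ≤ 1 * (1 / 2 * M S2) :=
            mul_le_mul_of_nonneg_right hpD (by have := hM0 S2; positivity)
        _ = 1 / 2 * M S2 := one_mul _
    have h4 : M S2 ≤ 2 * M S := by linarith
    calc MB i S ≤ p * M S2 := h1
      _ ≤ p * (2 * M S) := mul_le_mul_of_nonneg_left h4 hp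
      _ = 2 * p * M S := by ring
  have hp4 : 4 * p ≤ 1 := by
    have : (1 : ℝ) ≤ D := by exact_mod_cast hD1
    nlinarith
  have hpos : ∀ S ⊆ U, 0 < M S := by
    intro S
    induction S using Finset.induction_on with
    | empty => intro _; simpa [hM] using hE
    | insert i S hi ih =>
      intro hSU
      have hSU' := (Finset.subset_insert i S).trans hSU
      have h1 := hinsert i S
      have h2 := claim _ S hSU' rfl i (hSU (Finset.mem_insert_self i S))
      have h3 := ih hSU'
      nlinarith
  obtain ⟨x, hx, -⟩ := Finset.exists_ne_zero_of_sum_ne_zero (hpos U le_rfl).ne'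
  rw [Finset.mem_filter] at hx
  exact ⟨x, hx.1, hx.2⟩

end LocalLemma

namespace SimpleGraph

/-! ### Independent transversals by counting -/

section Transversals

open scoped Classical

variable {V W : Type*} [Fintype V] {H : SimpleGraph W}

/-- If every list has at least `ℓ` elements and every element has at most `ℓ / 8` neighbours in the
other lists, then there is an independent transversal. -/
theorem exists_independent_transversal {L : V → Finset W} {U : Finset V} {ℓ : ℝ} (hℓ : 0 < ℓ)
    (hL : ∀ v ∈ U, ℓ ≤ (L v).card)
    (hdeg : ∀ v ∈ U, ∀ x ∈ L v,
      ((∑ v' ∈ U.erase v, ((L v').filter (fun y => H.Adj x y)).card : ℕ) : ℝ) ≤ ℓ / 8) :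
    U = ∅ ∨ ∃ f : V → W, (∀ v ∈ U, f v ∈ L v) ∧
      ∀ v ∈ U, ∀ v' ∈ U, v ≠ v' → ¬ H.Adj (f v) (f v') := by
  -- The case `U = ∅` is set apart because `W` may then be empty.
  rcases U.eq_empty_or_nonempty with h0 | ⟨v₀, hv₀⟩
  · exact Or.inl h0
  right
  have hne : (L v₀).Nonempty := by
    rw [← Finset.card_pos]
    have := hL v₀ hv₀
    have h2 : (0 : ℝ) < (L v₀).card := hℓ.trans_le this
    exact_mod_cast h2
  obtain ⟨x₀, -⟩ := hne
  -- Partial transversals on `S`, frozen at `x₀` elsewhere so that they can be counted as total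
  -- functions.
  let T : Finset V → Finset (V → W) := fun S =>
    (Fintype.piFinset (fun v => if v ∈ S then L v else {x₀})).filter
      (fun f => ∀ v ∈ S, ∀ v' ∈ S, v ≠ v' → ¬ H.Adj (f v) (f v'))
  have hT : ∀ S f, f ∈ T S ↔ ((∀ v ∈ S, f v ∈ L v) ∧ ∀ v, v ∉ S → f v = x₀) ∧
      ∀ v ∈ S, ∀ v' ∈ S, v ≠ v' → ¬ H.Adj (f v) (f v') := by
    intro S f
    simp only [T, Finset.mem_filter, Fintype.mem_piFinset]
    refine and_congr_left fun _ => ?_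
    constructor
    · intro h
      refine ⟨fun v hv => by simpa [hv] using h v, fun v hv => by simpa [hv] using h v⟩
    · intro h v
      split_ifs with hv
      · exact h.1 v hv
      · simpa using h.2 v hv
  have hfix : ∀ S v y, ((T S).filter (fun f => f v = y)).card ≤ (T (S.erase v)).card := by
    intro S v y
    refine Finset.card_le_card_of_injOn (fun f => Function.update f v x₀) ?_ ?_
    · intro f hf
      have hf' := Finset.mem_filter.1 (Finset.mem_coe.1 hf)
      obtain ⟨⟨h1, h2⟩, h3⟩ := (hT S f).1 hf'.1
      refine Finset.mem_coe.2 ((hT _ _).2 ⟨⟨?_, ?_⟩, ?_⟩)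
      · intro u hu
        rw [Finset.mem_erase] at hu
        simp only [Function.update_of_ne hu.1]
        exact h1 u hu.2
      · intro u hu
        by_cases h : u = v
        · subst h; simp
        · simp only [Function.update_of_ne h]
          exact h2 u fun h' => hu (Finset.mem_erase.2 ⟨h, h'⟩)
      · intro u hu u' hu' hne
        rw [Finset.mem_erase] at hu hu'
        simp only [Function.update_of_ne hu.1, Function.update_of_ne hu'.1]
        exact h3 u hu.2 u' hu'.2 hne
    · intro f hf g hg hfg
      have hf' := (Finset.mem_filter.1 (Finset.mem_coe.1 hf)).2
      have hg' := (Finset.mem_filter.1 (Finset.mem_coe.1 hg)).2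
      funext u
      by_cases h : u = v
      · rw [h, hf', hg']
      · have := congrFun hfg u
        simpa only [Function.update_of_ne h] using this
  -- Each new vertex multiplies the count by at least `ℓ / 2`. By induction, prescribing `f v' = y`
  -- leaves at most a fraction `2 / ℓ` of `T S`, so the at most `ℓ / 8` neighbours of `x` rule out
  -- at most a quarter; the at least `ℓ` choices of `x` then give `3 * ℓ / 4`.
  have hstep : ∀ n : ℕ, ∀ S : Finset V, S.card = n → S ⊆ U → ∀ v ∈ U, v ∉ S →
      ℓ / 2 * (T S).card ≤ (T (insert v S)).card := by
    intro n
    induction n using Nat.strong_induction_on with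
    | _ n ih =>
    intro S hn hS v hv hvS
    -- the transversals of `S` compatible with a fixed `x`
    have hx : ∀ x ∈ L v, 3 / 4 * ((T S).card : ℝ) ≤
        ((T S).filter (fun f => ∀ v' ∈ S, ¬ H.Adj x (f v'))).card := by
      intro x hx
      have h1 : (T S).card ≤ ((T S).filter (fun f => ∀ v' ∈ S, ¬ H.Adj x (f v'))).card +
          ∑ v' ∈ S, ∑ y ∈ (L v').filter (fun y => H.Adj x y),
            ((T S).filter (fun f => f v' = y)).card := by
        rw [← Finset.card_filter_add_card_filter_not (s := T S)
          (fun f => ∀ v' ∈ S, ¬ H.Adj x (f v'))]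
        refine add_le_add le_rfl ?_
        have hsub : (T S).filter (fun f => ¬ ∀ v' ∈ S, ¬ H.Adj x (f v')) ⊆
            S.biUnion fun v' => ((L v').filter (fun y => H.Adj x y)).biUnion
              fun y => (T S).filter (fun f => f v' = y) := by
          intro f hf
          rw [Finset.mem_filter] at hf
          obtain ⟨hf1, hf2⟩ := hf
          push Not at hf2
          obtain ⟨v', hv', hadj⟩ := hf2
          simp only [Finset.mem_biUnion, Finset.mem_filter]
          exact ⟨v', hv', f v', ⟨((hT S f).1 hf1).1.1 v' hv', hadj⟩, hf1, rfl⟩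
        refine (Finset.card_le_card hsub).trans (Finset.card_biUnion_le.trans ?_)
        exact Finset.sum_le_sum fun v' _ => Finset.card_biUnion_le
      have h2 : ∀ v' ∈ S, ∀ y, (((T S).filter (fun f => f v' = y)).card : ℝ) ≤
          2 / ℓ * (T S).card := by
        intro v' hv' y
        have h3 := ih (S.erase v').card (by rw [← hn]; exact Finset.card_erase_lt_of_mem hv')
          (S.erase v') rfl ((Finset.erase_subset _ _).trans hS) v' (hS hv')
          (Finset.notMem_erase v' S)
        rw [Finset.insert_erase hv'] at h3
        have h4 : (((T S).filter (fun f => f v' = y)).card : ℝ) ≤ (T (S.erase v')).card := by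
          exact_mod_cast hfix S v' y
        calc (((T S).filter (fun f => f v' = y)).card : ℝ) ≤ (T (S.erase v')).card := h4
          _ = 2 / ℓ * (ℓ / 2 * (T (S.erase v')).card) := by field_simp
          _ ≤ 2 / ℓ * (T S).card := by gcongr
      have h5 : ((∑ v' ∈ S, ∑ y ∈ (L v').filter (fun y => H.Adj x y),
            ((T S).filter (fun f => f v' = y)).card : ℕ) : ℝ) ≤ 1 / 4 * (T S).card := by
        push_cast
        calc ∑ v' ∈ S, ∑ y ∈ (L v').filter (fun y => H.Adj x y),
              (((T S).filter (fun f => f v' = y)).card : ℝ)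
            ≤ ∑ v' ∈ S, ∑ y ∈ (L v').filter (fun y => H.Adj x y), 2 / ℓ * (T S).card :=
              Finset.sum_le_sum fun v' hv' => Finset.sum_le_sum fun y _ => h2 v' hv' y
          _ = ((∑ v' ∈ S, ((L v').filter (fun y => H.Adj x y)).card : ℕ) : ℝ) *
                (2 / ℓ * (T S).card) := by
              push_cast
              rw [Finset.sum_mul]
              simp
          _ ≤ ℓ / 8 * (2 / ℓ * (T S).card) := by
              refine mul_le_mul_of_nonneg_right (le_trans ?_ (hdeg v hv x hx)) (by positivity)
              have : S ⊆ U.erase v := fun u hu =>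
                Finset.mem_erase.2 ⟨fun h => hvS (h ▸ hu), hS hu⟩
              exact_mod_cast Finset.sum_le_sum_of_subset this
          _ = 1 / 4 * (T S).card := by field_simp; ring
      have h6 : ((T S).card : ℝ) ≤
          ((T S).filter (fun f => ∀ v' ∈ S, ¬ H.Adj x (f v'))).card +
          ((∑ v' ∈ S, ∑ y ∈ (L v').filter (fun y => H.Adj x y),
            ((T S).filter (fun f => f v' = y)).card : ℕ) : ℝ) := by exact_mod_cast h1
      linarith
    have hcount : ∑ x ∈ L v, ((T S).filter (fun f => ∀ v' ∈ S, ¬ H.Adj x (f v'))).card ≤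
        (T (insert v S)).card := by
      have hmaps : ∀ g ∈ T (insert v S), g v ∈ L v := fun g hg =>
        ((hT _ g).1 hg).1.1 v (Finset.mem_insert_self _ _)
      rw [Finset.card_eq_sum_card_fiberwise hmaps]
      refine Finset.sum_le_sum fun x hx => ?_
      refine Finset.card_le_card_of_injOn (fun f => Function.update f v x) ?_ ?_
      · intro f hf
        have hf' := Finset.mem_filter.1 (Finset.mem_coe.1 hf)
        obtain ⟨⟨h1, h2⟩, h3⟩ := (hT S f).1 hf'.1
        have hne : ∀ u ∈ S, u ≠ v := fun u hu h => hvS (h ▸ hu)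
        refine Finset.mem_coe.2 (Finset.mem_filter.2 ⟨(hT _ _).2 ⟨⟨?_, ?_⟩, ?_⟩, by simp⟩)
        · intro u hu
          rcases Finset.mem_insert.1 hu with rfl | hu
          · simpa using hx
          · simp only [Function.update_of_ne (hne u hu)]
            exact h1 u hu
        · intro u hu
          rw [Finset.mem_insert, not_or] at hu
          simp only [Function.update_of_ne hu.1]
          exact h2 u hu.2
        · intro u hu u' hu' huu
          rcases Finset.mem_insert.1 hu with rfl | hu1 <;>
            rcases Finset.mem_insert.1 hu' with rfl | hu1'
          · exact absurd rfl huu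
          · simp only [Function.update_self, Function.update_of_ne (hne u' hu1')]
            exact hf'.2 u' hu1'
          · simp only [Function.update_self, Function.update_of_ne (hne u hu1)]
            exact fun h => hf'.2 u hu1 h.symm
          · simp only [Function.update_of_ne (hne u' hu1'), Function.update_of_ne (hne u hu1)]
            exact h3 u hu1 u' hu1' huu
      · intro f hf g hg hfg
        have hf' := ((hT S f).1 (Finset.mem_filter.1 (Finset.mem_coe.1 hf)).1).1.2 v hvS
        have hg' := ((hT S g).1 (Finset.mem_filter.1 (Finset.mem_coe.1 hg)).1).1.2 v hvS
        funext u
        by_cases h : u = v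
        · rw [h, hf', hg']
        · have := congrFun hfg u
          simpa only [Function.update_of_ne h] using this
    calc ℓ / 2 * (T S).card ≤ (L v).card * (3 / 4 * (T S).card) := by
          have := hL v hv
          have h0 : (0 : ℝ) ≤ (T S).card := by positivity
          nlinarith
      _ = ∑ x ∈ L v, 3 / 4 * ((T S).card : ℝ) := by simp
      _ ≤ ∑ x ∈ L v, (((T S).filter (fun f => ∀ v' ∈ S, ¬ H.Adj x (f v'))).card : ℝ) :=
          Finset.sum_le_sum hx
      _ ≤ (T (insert v S)).card := by exact_mod_cast hcount
  have hpos : ∀ S ⊆ U, 0 < (T S).card := by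
    intro S
    induction S using Finset.induction_on with
    | empty =>
      intro _
      exact Finset.card_pos.2 ⟨fun _ => x₀, (hT _ _).2 (by simp)⟩
    | insert v S hv ih =>
      intro h
      have h1 := ih ((Finset.subset_insert v S).trans h)
      have h2 := hstep _ S rfl ((Finset.subset_insert v S).trans h) v
        (h (Finset.mem_insert_self v S)) hv
      have h3 : (0 : ℝ) < (T S).card := by exact_mod_cast h1
      have h4 : (0 : ℝ) < (T (insert v S)).card := lt_of_lt_of_le (by positivity) h2
      exact_mod_cast h4
  obtain ⟨f, hf⟩ := Finset.card_pos.1 (hpos U le_rfl)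
  obtain ⟨⟨h1, -⟩, h3⟩ := (hT U f).1 hf
  exact ⟨f, h1, h3⟩

end Transversals

/-! ### Exponential estimates on a single block -/

section Blocks

open scoped Classical

variable {W : Type*} {H : SimpleGraph W}

/-- Conditional estimates for the configuration inside of `N`, averaged over the outside. -/
lemma hcSum_mul_block_le {S N : Finset W} (hN : N ⊆ S) {lam c : ℝ} (hl : 0 ≤ lam)
    {g : Finset W → ℝ} (hg0 : ∀ I, 0 ≤ g I) (hg : ∀ J K, K ⊆ N → g (J ∪ K) = g J)
    {φ : Finset W → Finset W → ℝ}
    (hφ : ∀ J, H.hcSum (H.uncovered N J) lam (φ J) ≤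
      c * H.hcSum (H.uncovered N J) lam (fun _ => 1)) :
    H.hcSum S lam (fun I => g I * φ (I \ N) (I ∩ N)) ≤ c * H.hcSum S lam g := by
  rw [← hcSum_const_mul]
  refine hcSum_le_hcSum_of_split hN hl fun J hJ => ?_
  have hJN : Disjoint J N := by
    have := (mem_indepIn.1 hJ).1
    rw [Finset.subset_sdiff] at this
    exact this.2
  have e1 : H.hcSum (H.uncovered N J) lam
      (fun K => g (J ∪ K) * φ ((J ∪ K) \ N) ((J ∪ K) ∩ N)) =
      g J * H.hcSum (H.uncovered N J) lam (φ J) := by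
    rw [← hcSum_const_mul]
    refine hcSum_congr fun K hK => ?_
    have hK' : K ⊆ N := (mem_indepIn.1 hK).1.trans uncovered_subset
    rw [hg J K hK', Finset.union_sdiff_distrib, Finset.sdiff_eq_empty_iff_subset.2 hK',
      Finset.union_empty, Finset.sdiff_eq_self_of_disjoint hJN, Finset.union_inter_distrib_right,
      Finset.disjoint_iff_inter_eq_empty.1 hJN, Finset.empty_union, Finset.inter_eq_left.2 hK']
  have e2 : H.hcSum (H.uncovered N J) lam (fun K => c * g (J ∪ K)) =
      g J * (c * H.hcSum (H.uncovered N J) lam (fun _ => 1)) := by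
    rw [← hcSum_const_mul, ← hcSum_const_mul]
    refine hcSum_congr fun K hK => ?_
    have hK' : K ⊆ N := (mem_indepIn.1 hK).1.trans uncovered_subset
    rw [hg J K hK']
    ring
  rw [e1, e2]
  exact mul_le_mul_of_nonneg_left (hφ J) (hg0 J)

/-- The exponential functional tracking both the size of `K` and the event `K = ∅`. -/
noncomputable def tilt (θ : ℝ) (K : Finset W) : ℝ :=
  Real.exp (-(θ * K.card)) * if K = ∅ then Real.exp (-1) else 1

lemma tilt_nonneg (θ : ℝ) (K : Finset W) : 0 ≤ tilt θ K := by
  unfold tilt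
  positivity

/-- An exponential form of local occupancy. With `z = lam * |F|`, the normalised sum is at most `exp
(-θcz) - κ * exp (-z)`: the first term bounds the Laplace transform, and the empty set has
probability at least `exp (-z)`. The condition on `θ * c` makes `z = w` the minimiser of `κ * exp
(-z) + θcz`, whose minimum `κ * (1 + w) * exp (-w)` is the exponent obtained. -/
lemma hcSum_tilt_le {F : Finset W} {a lam θ c w : ℝ} (hl : 0 < lam) (hθ : 0 ≤ θ) (ha : 0 ≤ a)
    (hc : c ≤ Real.exp (-θ) * (1 + lam) ^ (-(a + 1)))
    (hθw : θ * c = (1 - Real.exp (-1)) * Real.exp (-w))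
    (hd : ((∑ v ∈ F, H.degIn F v : ℕ) : ℝ) ≤ a * F.card) :
    H.hcSum F lam (tilt θ) ≤
      Real.exp (-((1 - Real.exp (-1)) * (1 + w) * Real.exp (-w))) *
        H.hcSum F lam (fun _ => 1) := by
  set Z := H.hcSum F lam (fun _ => 1) with hZ
  have hZ1 : 1 ≤ Z := one_le_hcSum_one hl.le
  set z := lam * F.card with hz
  have hz0 : 0 ≤ z := by positivity
  set κ := 1 - Real.exp (-1) with hκ
  have hκ0 : 0 ≤ κ := by
    have : Real.exp (-1) ≤ 1 := Real.exp_le_one_iff.2 (by norm_num)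
    linarith
  set s := κ * (1 + w) * Real.exp (-w) with hs
  have h1 : H.hcSum F lam (tilt θ) =
      H.hcSum F lam (fun I => Real.exp (-(θ * I.card))) - κ := by
    have : H.hcSum F lam (fun I => Real.exp (-(θ * I.card))) =
        H.hcSum F lam (fun I => tilt θ I + κ * if I = ∅ then 1 else 0) := by
      refine hcSum_congr fun I _ => ?_
      unfold tilt
      split_ifs with h
      · simp [h, hκ]
      · simp
    rw [this, hcSum_add, hcSum_const_mul, hcSum_ite_empty]
    ring
  have h2 := hcSum_exp_neg_card_le hl hθ ha hd
  rw [← hZ] at h2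
  have h3 : Real.exp (-(θ * (F.card * lam * Real.exp (-θ) * (1 + lam) ^ (-(a + 1))))) ≤
      Real.exp (-(θ * c * z)) := by
    apply Real.exp_le_exp.2
    have : θ * (z * c) ≤ θ * (z * (Real.exp (-θ) * (1 + lam) ^ (-(a + 1)))) := by gcongr
    rw [hz] at this ⊢
    linarith
  have h4 : Real.exp (-z) * Z ≤ 1 := by
    have h5 : Z ≤ Real.exp z := by
      refine (hcSum_one_le_pow hl.le).trans ?_
      rw [hz, mul_comm, Real.exp_nat_mul]
      have := Real.add_one_le_exp lam
      exact pow_le_pow_left₀ (by linarith) (by linarith) _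
    calc Real.exp (-z) * Z ≤ Real.exp (-z) * Real.exp z := by gcongr
      _ = 1 := by rw [← Real.exp_add]; simp
  have h6 : Real.exp (-(θ * c * z)) - κ * Real.exp (-z) ≤ Real.exp (-s) := by
    rcases le_total s (θ * c * z) with h | h
    · have := Real.exp_le_exp.2 (neg_le_neg h)
      have := mul_nonneg hκ0 (Real.exp_pos (-z)).le
      linarith
    · have h7 : s ≤ κ * Real.exp (-z) + θ * c * z := by
        have h8 := Real.add_one_le_exp (w - z)
        have h9 : Real.exp (-z) = Real.exp (-w) * Real.exp (w - z) := by
          rw [← Real.exp_add]; ring_nf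
        have h10 := mul_le_mul_of_nonneg_left h8 (mul_nonneg hκ0 (Real.exp_pos (-w)).le)
        rw [hs, hθw, h9]
        linarith
      set x := θ * c * z with hx
      have hx0 : 0 ≤ x := by
        rw [hx, hθw]
        have := (Real.exp_pos (-w)).le
        positivity
      have h11 : Real.exp (-s) = Real.exp (-x) * Real.exp (-(s - x)) := by
        rw [← Real.exp_add]; ring_nf
      have h12 := Real.add_one_le_exp (-(s - x))
      have h13 : Real.exp (-x) ≤ 1 := Real.exp_le_one_iff.2 (by linarith)
      have h14 := mul_le_mul_of_nonneg_left h12 (Real.exp_pos (-x)).le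
      rw [← h11] at h14
      have h15 : Real.exp (-x) * (s - x) ≤ 1 * (s - x) :=
        mul_le_mul_of_nonneg_right h13 (by linarith)
      linarith
  rw [h1]
  calc H.hcSum F lam (fun I => Real.exp (-(θ * I.card))) - κ
      ≤ Real.exp (-(θ * c * z)) * Z - κ * (Real.exp (-z) * Z) := by
        have h7 := mul_le_mul_of_nonneg_right h3 (show 0 ≤ Z by linarith)
        have h8 := mul_le_mul_of_nonneg_left h4 hκ0
        linarith
    _ = (Real.exp (-(θ * c * z)) - κ * Real.exp (-z)) * Z := by ring
    _ ≤ Real.exp (-s) * Z := mul_le_mul_of_nonneg_right h6 (by linarith)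

/-- The empty set is an unlikely configuration on a large sparse graph. -/
lemma one_le_exp_mul_hcSum {F : Finset W} {a lam r : ℝ} (hl : 0 < lam) (ha : 0 ≤ a)
    (hd : ((∑ v ∈ F, H.degIn F v : ℕ) : ℝ) ≤ a * F.card)
    (hr : r ≤ F.card * lam * Real.exp (-1) * (1 + lam) ^ (-(a + 1))) :
    1 ≤ Real.exp (-r) * H.hcSum F lam (fun _ => 1) := by
  -- The Laplace transform at `θ = 1` dominates the probability of the empty set.
  have h1 := hcSum_exp_neg_card_le (θ := 1) hl zero_le_one ha hd
  have h2 : 1 ≤ H.hcSum F lam (fun I => Real.exp (-(1 * (I.card : ℝ)))) := by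
    rw [← hcSum_ite_empty (H := H) (S := F) (lam := lam)]
    refine hcSum_mono hl.le fun I _ => ?_
    split_ifs with h
    · simp [h]
    · positivity
  refine h2.trans (h1.trans (mul_le_mul_of_nonneg_right (Real.exp_le_exp.2 ?_) ?_))
  · linarith
  · exact zero_le_one.trans (one_le_hcSum_one hl.le)

end Blocks

/-! ### Random independent sets in covers -/

section Covers

open scoped Classical

variable {V W : Type*} {G : SimpleGraph V} {H : SimpleGraph W} {L : V → Finset W}

/-- Disjoint lists in `H` forming a (not necessarily spanning) cover of `G`. -/
structure IsPartialCover (G : SimpleGraph V) (H : SimpleGraph W) (L : V → Finset W) : Prop where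
  eq_of_mem : ∀ {a b : V} {x : W}, x ∈ L a → x ∈ L b → a = b
  adj_of_adj : ∀ {a b : V} {x y : W}, x ∈ L a → y ∈ L b → H.Adj x y → a = b ∨ G.Adj a b
  clique : ∀ {a : V} {x y : W}, x ∈ L a → y ∈ L a → x ≠ y → H.Adj x y
  matching : ∀ {a b : V} {x y z : W}, G.Adj a b → x ∈ L a → y ∈ L b → z ∈ L b →
    H.Adj x y → H.Adj x z → y = z

variable [Fintype V]

/-- The union of the lists of the neighbours of `u`. -/
noncomputable def nbrList (G : SimpleGraph V) (L : V → Finset W) (u : V) : Finset W :=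
  (Finset.univ.filter (fun v => G.Adj u v)).biUnion L

/-- The neighbours of `x` in the lists of the neighbours of `u`. -/
noncomputable def crossNbrs (G : SimpleGraph V) (H : SimpleGraph W) (L : V → Finset W) (u : V)
    (x : W) : Finset W :=
  (G.nbrList L u).filter (fun y => H.Adj x y)

/-- The elements of the list of `u` that are not blocked by `I` from another list. -/
noncomputable def available (G : SimpleGraph V) (H : SimpleGraph W) (L : V → Finset W)
    (I : Finset W) (u : V) : Finset W :=
  (L u).filter (fun x => Disjoint I (crossNbrs G H L u x))

lemma mem_nbrList {u : V} {y : W} : y ∈ G.nbrList L u ↔ ∃ v, G.Adj u v ∧ y ∈ L v := by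
  simp [nbrList]

lemma mem_crossNbrs {u : V} {x y : W} :
    y ∈ crossNbrs G H L u x ↔ (∃ v, G.Adj u v ∧ y ∈ L v) ∧ H.Adj x y := by
  simp [crossNbrs, mem_nbrList]

lemma crossNbrs_subset {u : V} {x : W} : crossNbrs G H L u x ⊆ G.nbrList L u :=
  Finset.filter_subset _ _

lemma nbrList_subset {u : V} : G.nbrList L u ⊆ Finset.univ.biUnion L := by
  intro y hy
  obtain ⟨v, -, hv⟩ := mem_nbrList.1 hy
  exact Finset.mem_biUnion.2 ⟨v, Finset.mem_univ v, hv⟩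

namespace IsPartialCover

lemma disjoint_crossNbrs (hc : IsPartialCover G H L) {u : V} {x x' : W} (hx : x ∈ L u)
    (hx' : x' ∈ L u) (hne : x ≠ x') :
    Disjoint (crossNbrs G H L u x) (crossNbrs G H L u x') := by
  rw [Finset.disjoint_left]
  intro y hy hy'
  obtain ⟨⟨v, hv, hyv⟩, hxy⟩ := mem_crossNbrs.1 hy
  obtain ⟨-, hxy'⟩ := mem_crossNbrs.1 hy'
  exact hne (hc.matching hv.symm hyv hx hx' hxy.symm hxy'.symm)

/-- By the matching condition at `x`, distinct elements of `F` lie in distinct lists. Hence `F`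
projects injectively into the neighbourhood of `u`, and edges of `H` inside `F` go to edges of `G`.
-/
lemma density (hc : IsPartialCover G H L) {a : ℝ} (ha : G.LocalDensityLE a) {u : V} {x : W}
    (hx : x ∈ L u) {F : Finset W} (hF : F ⊆ crossNbrs G H L u x) :
    ((∑ y ∈ F, H.degIn F y : ℕ) : ℝ) ≤ a * F.card := by
  have hex : ∀ y ∈ F, ∃ v, G.Adj u v ∧ y ∈ L v := fun y hy => (mem_crossNbrs.1 (hF hy)).1
  have : Nonempty V := ⟨u⟩
  choose! π hπ using hex
  have hinj : Set.InjOn π F := by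
    intro y hy z hz hyz
    have h1 := (mem_crossNbrs.1 (hF hy)).2
    have h2 := (mem_crossNbrs.1 (hF hz)).2
    exact hc.matching (hπ y hy).1 hx (hπ y hy).2 (hyz ▸ (hπ z hz).2) h1 h2
  have h1 := ha u (F.image π) (by
    intro v hv
    obtain ⟨y, hy, rfl⟩ := Finset.mem_image.1 hv
    exact (hπ y hy).1)
  rw [Finset.card_image_of_injOn hinj, Finset.sum_image hinj] at h1
  refine le_trans ?_ h1
  refine Nat.cast_le.2 (Finset.sum_le_sum fun y hy => ?_)
  unfold degIn
  refine Finset.card_le_card_of_injOn π ?_ (hinj.mono fun z hz => ?_)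
  · intro z hz
    have hz' := Finset.mem_filter.1 (Finset.mem_coe.1 hz)
    refine Finset.mem_coe.2 (Finset.mem_filter.2 ⟨Finset.mem_image_of_mem π hz'.1, ?_⟩)
    rcases hc.adj_of_adj (hπ y hy).2 (hπ z hz'.1).2 hz'.2 with h | h
    · exact absurd (hinj hy hz'.1 h) hz'.2.ne
    · exact h
  · exact (Finset.mem_filter.1 (Finset.mem_coe.1 hz)).1

/-- The blocks of distinct elements of `L u` are disjoint, and an independent set meets each list,
being a clique, at most once. -/
lemma sum_card_inter_crossNbrs_le (hc : IsPartialCover G H L) {u : V} {I : Finset W}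
    (hI : H.IsIndepSet (I : Set W)) :
    ∑ x ∈ L u, (I ∩ crossNbrs G H L u x).card ≤
      (Finset.univ.filter (fun v => G.Adj u v)).card := by
  rw [← Finset.card_biUnion fun x hx y hy hxy =>
    Finset.disjoint_of_subset_left Finset.inter_subset_right
      (Finset.disjoint_of_subset_right Finset.inter_subset_right
        (hc.disjoint_crossNbrs hx hy hxy))]
  have hsub : (L u).biUnion (fun x => I ∩ crossNbrs G H L u x) ⊆
      (Finset.univ.filter (fun v => G.Adj u v)).biUnion (fun v => I ∩ L v) := by
    intro y hy
    obtain ⟨x, -, hy⟩ := Finset.mem_biUnion.1 hy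
    rw [Finset.mem_inter, mem_crossNbrs] at hy
    obtain ⟨hyI, ⟨v, hv, hyv⟩, -⟩ := hy
    exact Finset.mem_biUnion.2 ⟨v, by simpa using hv, Finset.mem_inter.2 ⟨hyI, hyv⟩⟩
  refine (Finset.card_le_card hsub).trans (Finset.card_biUnion_le.trans ?_)
  rw [Finset.card_eq_sum_ones]
  refine Finset.sum_le_sum fun v _ => ?_
  rw [Finset.card_le_one]
  intro x hx y hy
  rw [Finset.mem_inter] at hx hy
  by_contra hne
  exact isIndepSet_coe_iff.1 hI x hx.1 y hy.1 (hc.clique hx.2 hy.2 hne)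

/-- Tail estimate for the number of blocked colours, conditionally on the configuration outside of
the lists of the neighbours of `u`. -/
lemma hcSum_prod_tilt_le (hc : IsPartialCover G H L) {u : V} {lam θ κ : ℝ} (hl : 0 < lam)
    (hκ : 0 ≤ κ)
    (htilt : ∀ x ∈ L u, ∀ F ⊆ crossNbrs G H L u x,
      H.hcSum F lam (tilt θ) ≤ κ * H.hcSum F lam (fun _ => 1))
    {h : Finset W → ℝ} (h0 : ∀ I, 0 ≤ h I) (hh : ∀ J K, K ⊆ G.nbrList L u → h (J ∪ K) = h J)
    {T : Finset W} (hT : T ⊆ L u) :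
    H.hcSum (Finset.univ.biUnion L) lam
      (fun I => h I * ∏ x ∈ T, tilt θ (I ∩ crossNbrs G H L u x)) ≤
      κ ^ T.card * H.hcSum (Finset.univ.biUnion L) lam h := by
  induction T using Finset.induction_on with
  | empty => simp
  | insert x T hx ih =>
    have hxu : x ∈ L u := hT (Finset.mem_insert_self x T)
    have hTu : T ⊆ L u := (Finset.subset_insert x T).trans hT
    -- Condition on everything off the block of `x`. The other factors do not see this block, by
    -- disjointness; edges between blocks only shrink its uncovered part, to which `htilt` still
    -- applies.
    have key := hcSum_mul_block_le (H := H) (N := crossNbrs G H L u x)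
      (S := Finset.univ.biUnion L) (crossNbrs_subset.trans nbrList_subset) hl.le (c := κ)
      (g := fun I => h I * ∏ x ∈ T, tilt θ (I ∩ crossNbrs G H L u x))
      (fun I => mul_nonneg (h0 I) (Finset.prod_nonneg fun _ _ => tilt_nonneg _ _))
      (fun J K hK => by
        rw [hh J K (hK.trans crossNbrs_subset)]
        congr 1
        refine Finset.prod_congr rfl fun x' hx' => ?_
        have hd := hc.disjoint_crossNbrs hxu (hTu hx') (fun h => hx (h ▸ hx'))
        rw [Finset.union_inter_distrib_right,
          Finset.disjoint_iff_inter_eq_empty.1 (Finset.disjoint_of_subset_left hK hd),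
          Finset.union_empty])
      (φ := fun _ K => tilt θ K) (fun J => htilt x hxu _ uncovered_subset)
    have e : H.hcSum (Finset.univ.biUnion L) lam
        (fun I => h I * ∏ x ∈ insert x T, tilt θ (I ∩ crossNbrs G H L u x)) =
        H.hcSum (Finset.univ.biUnion L) lam
        (fun I => (h I * ∏ x ∈ T, tilt θ (I ∩ crossNbrs G H L u x)) *
          tilt θ (I ∩ crossNbrs G H L u x)) := by
      refine hcSum_congr fun I _ => ?_
      rw [Finset.prod_insert hx]
      ring
    rw [e, Finset.card_insert_of_notMem hx, pow_succ, mul_comm (κ ^ T.card), mul_assoc]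
    exact key.trans (mul_le_mul_of_nonneg_left (ih hTu) hκ)

/-- The input for Markov's inequality: minus the logarithm of the product is `θ` times the number of
occupied elements in the blocks plus the number of available elements of `L u`. -/
lemma exp_le_prod_tilt (hc : IsPartialCover G H L) {u : V} {θ ℓ : ℝ} (hθ : 0 ≤ θ)
    {I : Finset W} (hI : H.IsIndepSet (I : Set W))
    (hℓ : ((available G H L I u).card : ℝ) ≤ ℓ) :
    1 ≤ Real.exp (ℓ + θ * (Finset.univ.filter (fun v => G.Adj u v)).card) *
      ∏ x ∈ L u, tilt θ (I ∩ crossNbrs G H L u x) := by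
  have e : ∀ K : Finset W, tilt θ K = Real.exp (-(θ * K.card + if K = ∅ then 1 else 0)) := by
    intro K
    unfold tilt
    split_ifs with h
    · rw [← Real.exp_add]; ring_nf
    · simp
  simp only [e]
  rw [← Real.exp_sum, ← Real.exp_add, Real.one_le_exp_iff, Finset.sum_neg_distrib,
    Finset.sum_add_distrib, ← Finset.mul_sum]
  have h1 : ((∑ x ∈ L u, (I ∩ crossNbrs G H L u x).card : ℕ) : ℝ) ≤
      (Finset.univ.filter (fun v => G.Adj u v)).card :=
    Nat.cast_le.2 (hc.sum_card_inter_crossNbrs_le hI)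
  push_cast at h1
  have h2 : (∑ x ∈ L u, if I ∩ crossNbrs G H L u x = ∅ then (1 : ℝ) else 0) ≤ ℓ := by
    refine le_trans (le_of_eq ?_) hℓ
    rw [available, Finset.card_filter]
    push_cast
    refine Finset.sum_congr rfl fun x _ => ?_
    simp only [Finset.disjoint_iff_inter_eq_empty]
  have h3 := mul_le_mul_of_nonneg_left h1 hθ
  linarith

/-- A vertex is bad for the independent set `I` if it has few available colours, or if one of its
available colours still has many uncovered neighbours. -/
def Bad (G : SimpleGraph V) (H : SimpleGraph W) (L : V → Finset W) (ℓ : ℝ) (I : Finset W)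
    (u : V) : Prop :=
  ((available G H L I u).card : ℝ) < ℓ ∨
    ∃ x ∈ available G H L I u, ℓ / 8 < ((H.uncovered (crossNbrs G H L u x) I).card : ℝ)

/-- The vertices whose badness may depend on the lists of the neighbours of `u`. -/
noncomputable def depSet (G : SimpleGraph V) (u : V) : Finset V :=
  Finset.univ.filter fun v => ∃ a b, G.Adj u a ∧ G.Adj v b ∧ (a = b ∨ G.Adj a b)

/-- Badness of `v` depends only on which elements of the lists of its neighbours are in `I` or
adjacent to `I`. Outside `depSet G u`, changes in the lists of the neighbours of `u` affect neither.
-/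
lemma bad_union_iff (hc : IsPartialCover G H L) {ℓ : ℝ} {u v : V} (hv : v ∉ depSet G u)
    {J K : Finset W} (hK : K ⊆ G.nbrList L u) : Bad G H L ℓ (J ∪ K) v ↔ Bad G H L ℓ J v := by
  have hv' : ∀ a b, G.Adj u a → G.Adj v b → ¬ (a = b ∨ G.Adj a b) := by
    intro a b h1 h2 h3
    exact hv (Finset.mem_filter.2 ⟨Finset.mem_univ v, a, b, h1, h2, h3⟩)
  have h1 : available G H L (J ∪ K) v = available G H L J v := by
    refine Finset.filter_congr fun x _ => ?_
    rw [Finset.disjoint_union_left, and_iff_left]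
    rw [Finset.disjoint_left]
    intro y hy hy'
    obtain ⟨a, ha, hya⟩ := mem_nbrList.1 (hK hy)
    obtain ⟨⟨b, hb, hyb⟩, -⟩ := mem_crossNbrs.1 hy'
    exact hv' a b ha hb (Or.inl (hc.eq_of_mem hya hyb))
  have h2 : ∀ x, H.uncovered (crossNbrs G H L v x) (J ∪ K) =
      H.uncovered (crossNbrs G H L v x) J := by
    intro x
    refine Finset.filter_congr fun y hy => ?_
    simp only [Finset.mem_union, or_imp, forall_and]
    rw [and_iff_left]
    intro z hz hyz
    obtain ⟨a, ha, hza⟩ := mem_nbrList.1 (hK hz)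
    obtain ⟨⟨b, hb, hyb⟩, -⟩ := mem_crossNbrs.1 hy
    exact hv' a b ha hb (hc.adj_of_adj hza hyb hyz.symm)
  simp only [Bad, h1, h2]

/-- The conditional probability of a vertex being bad. -/
lemma hcSum_bad_le (hc : IsPartialCover G H L) {u : V} {a lam θ κ ℓ ρ : ℝ} (hl : 0 < lam)
    (ha0 : 0 ≤ a) (ha : G.LocalDensityLE a) (hθ : 0 ≤ θ) (hκ : 0 ≤ κ)
    (htilt : ∀ F : Finset W, ((∑ y ∈ F, H.degIn F y : ℕ) : ℝ) ≤ a * F.card →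
      H.hcSum F lam (tilt θ) ≤ κ * H.hcSum F lam (fun _ => 1))
    (hρ : ℓ / 8 * lam * Real.exp (-1) * (1 + lam) ^ (-(a + 1)) ≥ ρ)
    {h : Finset W → ℝ} (h0 : ∀ I, 0 ≤ h I) (hh : ∀ J K, K ⊆ G.nbrList L u → h (J ∪ K) = h J) :
    H.hcSum (Finset.univ.biUnion L) lam (fun I => h I * if Bad G H L ℓ I u then 1 else 0) ≤
      (Real.exp (ℓ + θ * (Finset.univ.filter (fun v => G.Adj u v)).card) * κ ^ (L u).card +
        (L u).card * Real.exp (-ρ)) * H.hcSum (Finset.univ.biUnion L) lam h := by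
  set S := Finset.univ.biUnion L with hS
  set C := Real.exp (ℓ + θ * (Finset.univ.filter (fun v => G.Adj u v)).card) with hC
  have hC0 : 0 ≤ C := (Real.exp_pos _).le
  -- The second kind of failure at `x`. An available `x` has an unoccupied block, so its uncovered
  -- part is determined by `J`; if that part is large, the block is empty with conditional
  -- probability at most `exp (-ρ)`.
  let φ : W → Finset W → Finset W → ℝ := fun x J K =>
    (if ℓ / 8 < ((H.uncovered (crossNbrs G H L u x) J).card : ℝ) then 1 else 0) *
      if K = ∅ then 1 else 0
  have hφ0 : ∀ x J K, 0 ≤ φ x J K := fun x J K => by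
    simp only [φ]
    positivity
  have hpt : H.hcSum S lam (fun I => h I * if Bad G H L ℓ I u then 1 else 0) ≤
      H.hcSum S lam (fun I => C * (h I * ∏ x ∈ L u, tilt θ (I ∩ crossNbrs G H L u x)) +
        ∑ x ∈ L u, h I * φ x (I \ crossNbrs G H L u x) (I ∩ crossNbrs G H L u x)) := by
    refine hcSum_mono hl.le fun I hI => ?_
    have hA : 0 ≤ C * (h I * ∏ x ∈ L u, tilt θ (I ∩ crossNbrs G H L u x)) :=
      mul_nonneg hC0 (mul_nonneg (h0 I) (Finset.prod_nonneg fun _ _ => tilt_nonneg _ _))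
    have hB : ∀ x ∈ L u,
        0 ≤ h I * φ x (I \ crossNbrs G H L u x) (I ∩ crossNbrs G H L u x) := fun x _ =>
      mul_nonneg (h0 I) (hφ0 _ _ _)
    have hB' := Finset.sum_nonneg hB
    split_ifs with hbad
    · rcases hbad with hbad | ⟨x, hx, hxl⟩
      · have h1 := hc.exp_le_prod_tilt hθ (mem_indepIn.1 hI).2 hbad.le
        have h2 := mul_le_mul_of_nonneg_left h1 (h0 I)
        rw [← hC] at h2
        linarith
      · rw [available, Finset.mem_filter] at hx
        have h1 := Finset.single_le_sum hB hx.1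
        have h2 : φ x (I \ crossNbrs G H L u x) (I ∩ crossNbrs G H L u x) = 1 := by
          simp only [φ]
          rw [Finset.sdiff_eq_self_of_disjoint hx.2, Finset.disjoint_iff_inter_eq_empty.1 hx.2,
            if_pos hxl, if_pos rfl, mul_one]
        rw [h2] at h1
        linarith
    · linarith
  refine hpt.trans ?_
  rw [hcSum_add, hcSum_const_mul, hcSum_sum, add_mul]
  refine add_le_add ?_ ?_
  · rw [mul_assoc]
    exact mul_le_mul_of_nonneg_left (hc.hcSum_prod_tilt_le hl hκ
      (fun x hx F hF => htilt F (hc.density ha hx hF)) h0 hh le_rfl) hC0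
  · have hZ0 : 0 ≤ H.hcSum S lam h := hcSum_nonneg hl.le fun I _ => h0 I
    calc ∑ x ∈ L u, H.hcSum S lam
          (fun I => h I * φ x (I \ crossNbrs G H L u x) (I ∩ crossNbrs G H L u x))
        ≤ ∑ x ∈ L u, Real.exp (-ρ) * H.hcSum S lam h := by
          refine Finset.sum_le_sum fun x hx => ?_
          refine hcSum_mul_block_le (crossNbrs_subset.trans nbrList_subset) hl.le h0
            (fun J K hK => hh J K (hK.trans crossNbrs_subset)) fun J => ?_
          simp only [φ]
          rw [hcSum_const_mul, hcSum_ite_empty, mul_one]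
          split_ifs with hlt
          · refine one_le_exp_mul_hcSum hl ha0 (hc.density ha hx uncovered_subset)
              (hρ.trans ?_)
            gcongr
          · exact mul_nonneg (Real.exp_pos _).le (zero_le_one.trans (one_le_hcSum_one hl.le))
      _ = (L u).card * Real.exp (-ρ) * H.hcSum S lam h := by
          rw [Finset.sum_const, nsmul_eq_mul]; ring

/-- There is an independent set for which no vertex of `U` is bad. -/
lemma exists_forall_not_bad (hc : IsPartialCover G H L) {a lam ℓ ρ p : ℝ} {D : ℕ} (hl : 0 < lam)
    (ha0 : 0 ≤ a) (ha : G.LocalDensityLE a)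
    (hρ : ℓ / 8 * lam * Real.exp (-1) * (1 + lam) ^ (-(a + 1)) ≥ ρ) (U : Finset V)
    (hU : ∀ u ∈ U, ∃ θ κ : ℝ, 0 ≤ θ ∧ 0 ≤ κ ∧
      (∀ F : Finset W, ((∑ y ∈ F, H.degIn F y : ℕ) : ℝ) ≤ a * F.card →
        H.hcSum F lam (tilt θ) ≤ κ * H.hcSum F lam (fun _ => 1)) ∧
      Real.exp (ℓ + θ * (Finset.univ.filter (fun v => G.Adj u v)).card) * κ ^ (L u).card +
        (L u).card * Real.exp (-ρ) ≤ p)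
    (hp : 0 ≤ p) (hD1 : 1 ≤ D) (hpD : 4 * p * D ≤ 1) (hD : ∀ u, (depSet G u).card ≤ D) :
    ∃ I ∈ H.indepIn (Finset.univ.biUnion L), ∀ u ∈ U, ¬ Bad G H L ℓ I u := by
  set S := Finset.univ.biUnion L with hS
  obtain ⟨I, hI, hgood⟩ := lopsided_local_lemma (H.indepIn S) (fun I => lam ^ I.card)
    (fun I => pow_nonneg hl.le _)
    (by
      have := one_le_hcSum_one (H := H) (S := S) hl.le
      simp only [hcSum, mul_one] at this
      linarith)
    (fun u I => Bad G H L ℓ I u) (depSet G) hp hpD hD1 hD U (fun u hu T _ hT => by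
      obtain ⟨θ, κ, hθ, hκ, htilt, hle⟩ := hU u hu
      -- The indicator of avoiding the events of `T`; as `T` is disjoint from `depSet G u`, it
      -- ignores the lists of the neighbours of `u`.
      set h : Finset W → ℝ := fun I => if ∀ j ∈ T, ¬ Bad G H L ℓ I j then 1 else 0 with hh
      have h0 : ∀ I, 0 ≤ h I := fun I => by
        simp only [hh]
        positivity
      have hinv : ∀ J K, K ⊆ G.nbrList L u → h (J ∪ K) = h J := by
        intro J K hK
        simp only [hh]
        congr 1
        refine propext (forall₂_congr fun j hj => ?_)
        rw [hc.bad_union_iff (Finset.disjoint_left.1 hT hj) hK]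
      have h1 := hc.hcSum_bad_le hl ha0 ha hθ hκ htilt hρ h0 hinv
      have h2 : 0 ≤ H.hcSum S lam h := hcSum_nonneg hl.le fun I _ => h0 I
      have h3 := h1.trans (mul_le_mul_of_nonneg_right hle h2)
      refine le_trans (le_of_eq ?_) (h3.trans (le_of_eq ?_))
      · rw [Finset.sum_filter, hcSum]
        refine Finset.sum_congr rfl fun I _ => ?_
        simp only [hh]
        by_cases hb : Bad G H L ℓ I u
        · by_cases hT : ∀ j ∈ T, ¬ Bad G H L ℓ I j
          · rw [if_pos ⟨hb, hT⟩, if_pos hT, if_pos hb]; ring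
          · rw [if_neg (fun h => hT h.2), if_neg hT]; ring
        · rw [if_neg (fun h => hb h.1), if_neg hb]; ring
      · rw [Finset.sum_filter, hcSum]
        congr 1
        refine Finset.sum_congr rfl fun I _ => ?_
        simp only [hh, mul_ite, mul_one, mul_zero]
        congr!)
  exact ⟨I, hI, hgood⟩

/-- An independent set without bad vertices in `U` can be completed on `U`. -/
lemma exists_transversal_of_not_bad (hc : IsPartialCover G H L) {ℓ : ℝ} (hℓ : 0 < ℓ)
    {U : Finset V} {I : Finset W} (hI : I ∈ H.indepIn (Finset.univ.biUnion L))
    (hgood : ∀ u ∈ U, ¬ Bad G H L ℓ I u) (hne : U.Nonempty) :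
    ∃ f : V → W, (∀ u ∈ U, f u ∈ L u) ∧ ∀ u ∈ U, ∀ v ∈ U, u ≠ v → ¬ H.Adj (f u) (f v) := by
  obtain ⟨hIS, hI⟩ := mem_indepIn.1 hI
  rw [isIndepSet_coe_iff] at hI
  have hgood1 : ∀ u ∈ U, ℓ ≤ (available G H L I u).card := fun u hu =>
    not_lt.1 fun h => hgood u hu (Or.inl h)
  have hgood2 : ∀ u ∈ U, ∀ x ∈ available G H L I u,
      ((H.uncovered (crossNbrs G H L u x) I).card : ℝ) ≤ ℓ / 8 := fun u hu x hx =>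
    not_lt.1 fun h => hgood u hu (Or.inr ⟨x, hx, h⟩)
  -- Vertices whose list meets `I` are coloured by `I`; only those in `U'` are left to the
  -- transversal.
  set U' := U.filter (fun u => Disjoint I (L u)) with hU'
  have havail : ∀ u x, x ∈ available G H L I u → x ∈ L u ∧
      ∀ v y, G.Adj u v → y ∈ L v → y ∈ I → ¬ H.Adj x y := by
    intro u x hx
    rw [available, Finset.mem_filter, Finset.disjoint_left] at hx
    exact ⟨hx.1, fun v y hv hy hyI hxy => hx.2 hyI (mem_crossNbrs.2 ⟨⟨v, hv, hy⟩, hxy⟩)⟩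
  have htrans : ∃ f : V → W, (∀ v ∈ U', f v ∈ available G H L I v) ∧
      ∀ v ∈ U', ∀ v' ∈ U', v ≠ v' → ¬ H.Adj (f v) (f v') := by
    rcases exists_independent_transversal (H := H) (L := fun v => available G H L I v)
      (U := U') hℓ (fun v hv => hgood1 v (Finset.mem_filter.1 hv).1) (by
        intro v hv x hx
        refine le_trans (Nat.cast_le.2 ?_) (hgood2 v (Finset.mem_filter.1 hv).1 x hx)
        rw [← Finset.card_biUnion]
        -- Any neighbour `y` of `x` in an available list over `U'` is uncovered: an element of `I`
        -- adjacent to `y` would lie in the list of `v'`, which `I` misses, or make `y` unavailable.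
        · refine Finset.card_le_card fun y hy => ?_
          simp only [Finset.mem_biUnion, Finset.mem_filter, Finset.mem_erase] at hy
          obtain ⟨v', ⟨hne, hv'⟩, hy, hxy⟩ := hy
          obtain ⟨hyL, hyI⟩ := havail v' y hy
          have hxL := (havail v x hx).1
          have hvv' : G.Adj v v' :=
            (hc.adj_of_adj hxL hyL hxy).resolve_left (Ne.symm hne)
          refine mem_uncovered.2 ⟨mem_crossNbrs.2 ⟨⟨v', hvv', hyL⟩, hxy⟩, fun z hz hyz => ?_⟩
          obtain ⟨c, -, hzc⟩ := Finset.mem_biUnion.1 (hIS hz)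
          rcases hc.adj_of_adj hyL hzc hyz with rfl | h
          · exact Finset.disjoint_left.1 (Finset.mem_filter.1 hv').2 hz hzc
          · exact hyI c z h hzc hz hyz
        · intro v₁ _ v₂ _ hne
          rw [Function.onFun, Finset.disjoint_left]
          intro y hy1 hy2
          exact hne (hc.eq_of_mem (havail _ _ (Finset.mem_filter.1 hy1).1).1
            (havail _ _ (Finset.mem_filter.1 hy2).1).1)) with h | h
    · obtain ⟨u, hu⟩ := hne
      have h1 := hgood1 u hu
      have h2 : (0 : ℝ) < (available G H L I u).card := hℓ.trans_le h1
      obtain ⟨x, -⟩ := Finset.card_pos.1 (by exact_mod_cast h2 :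
        0 < (available G H L I u).card)
      exact ⟨fun _ => x, by simp [h], by simp [h]⟩
    · exact h
  obtain ⟨f, hf1, hf2⟩ := htrans
  have hcol : ∀ u, ¬ Disjoint I (L u) → ∃ x, x ∈ I ∧ x ∈ L u := fun u h =>
    Finset.not_disjoint_iff.1 h
  have : Nonempty W := hne.elim fun u _ => ⟨f u⟩
  choose! g hg using hcol
  refine ⟨fun u => if Disjoint I (L u) then f u else g u, ?_, ?_⟩
  · intro u hu
    dsimp only
    split_ifs with h
    · exact (havail _ _ (hf1 u (Finset.mem_filter.2 ⟨hu, h⟩))).1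
    · exact (hg u h).2
  · intro u hu v hv huv
    dsimp only
    split_ifs with h1 h2 h2
    · exact hf2 u (Finset.mem_filter.2 ⟨hu, h1⟩) v (Finset.mem_filter.2 ⟨hv, h2⟩) huv
    · intro hadj
      obtain ⟨hfL, hfI⟩ := havail _ _ (hf1 u (Finset.mem_filter.2 ⟨hu, h1⟩))
      have := (hc.adj_of_adj hfL (hg v h2).2 hadj).resolve_left huv
      exact hfI v (g v) this (hg v h2).2 (hg v h2).1 hadj
    · intro hadj
      obtain ⟨hfL, hfI⟩ := havail _ _ (hf1 v (Finset.mem_filter.2 ⟨hv, h2⟩))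
      have := (hc.adj_of_adj hfL (hg u h1).2 hadj.symm).resolve_left huv.symm
      exact hfI u (g u) this (hg u h1).2 (hg u h1).1 hadj.symm
    · exact hI _ (hg u h1).1 _ (hg v h2).1

/-- A transversal on `A` extends greedily to vertices whose lists are larger than their degrees. -/
lemma exists_transversal_of_card_lt (hc : IsPartialCover G H L) (hne : Nonempty W) {A : Finset V}
    (hA : A.Nonempty → ∃ f : V → W, (∀ u ∈ A, f u ∈ L u) ∧
      ∀ u ∈ A, ∀ v ∈ A, u ≠ v → ¬ H.Adj (f u) (f v))
    (hbig : ∀ u, u ∉ A → (Finset.univ.filter (fun v => G.Adj u v)).card < (L u).card) :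
    ∃ f : V → W, (∀ u, f u ∈ L u) ∧ ∀ u v, u ≠ v → ¬ H.Adj (f u) (f v) := by
  have key : ∀ B : Finset V, ∃ f : V → W, (∀ u ∈ A ∪ B, f u ∈ L u) ∧
      ∀ u ∈ A ∪ B, ∀ v ∈ A ∪ B, u ≠ v → ¬ H.Adj (f u) (f v) := by
    intro B
    induction B using Finset.induction_on with
    | empty =>
      rw [Finset.union_empty]
      rcases A.eq_empty_or_nonempty with rfl | h
      · exact ⟨fun _ => Classical.arbitrary W, by simp, by simp⟩
      · exact hA h
    | insert b B hb ih =>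
      obtain ⟨f, hf1, hf2⟩ := ih
      rw [Finset.union_insert]
      by_cases hbA : b ∈ A ∪ B
      · rw [Finset.insert_eq_of_mem hbA]
        exact ⟨f, hf1, hf2⟩
      have hbig' := hbig b fun h => hbA (Finset.mem_union_left _ h)
      set N := (Finset.univ.filter (fun v => G.Adj b v)).filter (fun v => v ∈ A ∪ B) with hN
      set X := N.biUnion (fun v => (L b).filter (fun x => H.Adj x (f v))) with hX
      have hXcard : X.card < (L b).card := by
        refine lt_of_le_of_lt ?_ hbig'
        calc X.card ≤ ∑ v ∈ N, ((L b).filter (fun x => H.Adj x (f v))).card :=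
              Finset.card_biUnion_le
          _ ≤ ∑ v ∈ N, 1 := by
              refine Finset.sum_le_sum fun v hv => ?_
              rw [hN, Finset.mem_filter, Finset.mem_filter] at hv
              rw [Finset.card_le_one]
              intro x hx y hy
              rw [Finset.mem_filter] at hx hy
              exact hc.matching hv.1.2.symm (hf1 v hv.2) hx.1 hy.1 hx.2.symm hy.2.symm
          _ = N.card := by simp
          _ ≤ _ := Finset.card_filter_le _ _
      obtain ⟨x, hxL, hxX⟩ : ∃ x ∈ L b, x ∉ X := by
        by_contra hcon
        push Not at hcon
        exact absurd (Finset.card_le_card hcon) (not_le.2 hXcard)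
      have hx : ∀ v ∈ A ∪ B, ¬ H.Adj x (f v) := by
        intro v hv hadj
        rcases hc.adj_of_adj hxL (hf1 v hv) hadj with rfl | h
        · exact hbA hv
        · exact hxX (Finset.mem_biUnion.2 ⟨v, Finset.mem_filter.2 ⟨by simpa using h, hv⟩,
            Finset.mem_filter.2 ⟨hxL, hadj⟩⟩)
      have hneb : ∀ u ∈ A ∪ B, u ≠ b := fun u hu h => hbA (h ▸ hu)
      refine ⟨Function.update f b x, ?_, ?_⟩
      · intro u hu
        rcases Finset.mem_insert.1 hu with rfl | hu1
        · simpa using hxL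
        · rw [Function.update_of_ne (hneb u hu1)]
          exact hf1 u hu1
      · intro u hu v hv huv
        by_cases hub : u = b
        · by_cases hvb : v = b
          · exact absurd (hub.trans hvb.symm) huv
          · have hv1 := (Finset.mem_insert.1 hv).resolve_left hvb
            rw [hub, Function.update_self, Function.update_of_ne hvb]
            exact hx v hv1
        · have hu1 := (Finset.mem_insert.1 hu).resolve_left hub
          rw [Function.update_of_ne hub]
          by_cases hvb : v = b
          · rw [hvb, Function.update_self]
            exact fun h => hx u hu1 h.symm
          · have hv1 := (Finset.mem_insert.1 hv).resolve_left hvb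
            rw [Function.update_of_ne hvb]
            exact hf2 u hu1 v hv1 huv
  obtain ⟨f, hf1, hf2⟩ := key Finset.univ
  exact ⟨f, fun u => hf1 u (by simp), fun u v => hf2 u (by simp) v (by simp)⟩

lemma card_depSet_le {Δ : ℕ} (hΔ : ∀ u, (Finset.univ.filter (fun v => G.Adj u v)).card ≤ Δ)
    (u : V) : (depSet G u).card ≤ Δ * ((Δ + 1) * Δ) := by
  have hsub : depSet G u ⊆ (Finset.univ.filter (fun v => G.Adj u v)).biUnion fun a =>
      (insert a (Finset.univ.filter (fun v => G.Adj a v))).biUnion fun b =>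
        Finset.univ.filter (fun v => G.Adj b v) := by
    intro v hv
    obtain ⟨-, a, b, h1, h2, h3⟩ := Finset.mem_filter.1 hv
    simp only [Finset.mem_biUnion, Finset.mem_filter, Finset.mem_univ, true_and,
      Finset.mem_insert]
    refine ⟨a, h1, b, ?_, h2.symm⟩
    rcases h3 with rfl | h3
    · exact Or.inl rfl
    · exact Or.inr h3
  refine (Finset.card_le_card hsub).trans ?_
  refine (Finset.card_biUnion_le_card_mul _ _ ((Δ + 1) * Δ) fun a _ => ?_).trans
    (Nat.mul_le_mul_right _ (hΔ u))
  refine (Finset.card_biUnion_le_card_mul _ _ Δ fun b _ => hΔ b).trans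
    (Nat.mul_le_mul_right _ ?_)
  exact (Finset.card_insert_le _ _).trans (Nat.add_le_add_right (hΔ a) 1)

end IsPartialCover

end Covers

/-! ### The correspondence colouring theorems -/

section Correspondence

open scoped Classical

variable {V W : Type*} [Fintype V] {G : SimpleGraph V} {H : SimpleGraph W} {L : V → Finset W}

lemma exp_neg_one_le : Real.exp (-1) ≤ 2 / 5 := by
  have h := Real.exp_one_gt_d9
  rw [Real.exp_neg, inv_le_comm₀ (Real.exp_pos 1) (by norm_num)]
  linarith

lemma exp_three_le : Real.exp 3 ≤ 21 := by
  have h := Real.exp_one_lt_d9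
  have h2 : Real.exp 3 = Real.exp 1 ^ 3 := by rw [← Real.exp_nat_mul]; norm_num
  rw [h2]
  calc Real.exp 1 ^ 3 ≤ 2.7182818286 ^ 3 := pow_le_pow_left₀ (Real.exp_pos 1).le h.le 3
    _ ≤ 21 := by norm_num

/-- The quantitative form of the failure probability of a vertex at fugacity `η / K`. -/
lemma failure_probability_le {K η w d q Λ' ℓ : ℝ} (hη : 0 < η) (hK : 3 ≤ K)
    (hΛ' : 0 ≤ Λ') (hℓ : ℓ = 1280 / η * (K * Λ')) (hη1 : η < 1) (hw : 0 ≤ w)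
    (hq : (Real.exp (3 * η) * d + 3 * ℓ * Real.exp w) / (1 + w) ≤ q) :
    ℓ + (1 - Real.exp (-1)) * Real.exp (-w) * Real.exp (3 * η) * d -
      q * ((1 - Real.exp (-1)) * (1 + w) * Real.exp (-w)) ≤ -(7 * Λ') := by
  have hκ : 3 / 5 ≤ 1 - Real.exp (-1) := by linarith [exp_neg_one_le]
  set κ := 1 - Real.exp (-1)
  have hw1 : 0 < 1 + w := by linarith
  rw [div_le_iff₀ hw1] at hq
  have h1 := mul_le_mul_of_nonneg_left hq
    (show 0 ≤ κ * Real.exp (-w) from mul_nonneg (by linarith) (Real.exp_pos _).le)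
  have h2 : Real.exp (-w) * Real.exp w = 1 := by rw [← Real.exp_add]; simp
  have h3 : κ * Real.exp (-w) * (Real.exp (3 * η) * d + 3 * ℓ * Real.exp w) =
      κ * Real.exp (-w) * Real.exp (3 * η) * d + 3 * κ * ℓ := by
    calc _ = κ * Real.exp (-w) * Real.exp (3 * η) * d +
          3 * κ * ℓ * (Real.exp (-w) * Real.exp w) := by ring
      _ = _ := by rw [h2, mul_one]
  rw [h3] at h1
  have h4 : 3840 * Λ' ≤ ℓ := by
    have h5 : 1280 ≤ 1280 / η := by
      rw [le_div_iff₀ hη]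
      nlinarith
    rw [hℓ]
    calc 3840 * Λ' = 1280 * (3 * Λ') := by ring
      _ ≤ 1280 / η * (K * Λ') := by gcongr
  have h5 : 0 ≤ ℓ := le_trans (by positivity) h4
  -- The terms in `d` cancel and leave at most `ℓ - 3 * κ * ℓ ≤ -(4 / 5) * ℓ`, with `ℓ ≥ 3840 * Λ'`.
  nlinarith

namespace IsPartialCover

/-- Correspondence colouring of graphs of bounded local density, with free parameters. -/
theorem exists_transversal_of_balance [Nonempty V] (hc : IsPartialCover G H L) {a K η : ℝ} {Δ : ℕ}
    (hη : 0 < η) (hη1 : η < 1) (hK : 3 ≤ K) (ha0 : 0 ≤ a) (haK : a + 1 ≤ 2 * K)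
    (ha : G.LocalDensityLE a) (hΔ : 3 ≤ Δ)
    (hdeg : ∀ u, (Finset.univ.filter (fun v => G.Adj u v)).card ≤ Δ)
    (hL : ∀ u, ∃ w : ℝ, 0 ≤ w ∧ 3 * η - Real.log η ≤ w ∧
      K * Real.log Δ * ((Real.exp (3 * η) *
        ((Finset.univ.filter (fun v => G.Adj u v)).card / (K * Real.log Δ)) +
        3840 / η * Real.exp w) / (1 + w)) ≤ (L u).card) :
    ∃ f : V → W, (∀ u, f u ∈ L u) ∧ ∀ u v, u ≠ v → ¬ H.Adj (f u) (f v) := by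
  have hΔ' : (3 : ℝ) ≤ Δ := by exact_mod_cast hΔ
  have hlog : 0 < Real.log Δ := Real.log_pos (by linarith)
  have hK0 : 0 < K := by linarith
  set lam := η / K with hlam
  have hl : 0 < lam := by positivity
  -- This makes `ℓ / 8 * lam = 160 * log Δ`, and `160 * exp (-3) > 7` yields the probability `Δ ^
  -- (-7)` below. The constant `3840 / η` in `hL` is the coefficient of `K * log Δ` in `3 * ℓ`.
  set ℓ := 1280 / η * (K * Real.log Δ) with hℓ
  have hℓ0 : 0 < ℓ := by positivity
  have hrpow : Real.exp (-(2 * η)) ≤ (1 + lam) ^ (-(a + 1)) := by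
    rw [Real.exp_neg, Real.rpow_neg (by linarith)]
    exact inv_anti₀ (by positivity) (one_add_rpow_le_exp hη hK0 (by linarith) haK)
  have hW : Nonempty W := by
    obtain ⟨u⟩ := ‹Nonempty V›
    obtain ⟨w, hw, -, h⟩ := hL u
    have : (0 : ℝ) < (L u).card := lt_of_lt_of_le (by positivity) h
    obtain ⟨x, -⟩ := Finset.card_pos.1 (by exact_mod_cast this : 0 < (L u).card)
    exact ⟨x⟩
  -- For these vertices `|L u| ≤ Δ`, which controls the union bound over the list. All other
  -- vertices are coloured greedily at the end, so their lists are emptied in `L'`.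
  set U : Finset V := Finset.univ.filter
    (fun u => (L u).card ≤ (Finset.univ.filter (fun v => G.Adj u v)).card) with hU
  set L' : V → Finset W := fun u => if u ∈ U then L u else ∅ with hL'
  have hL'sub : ∀ u x, x ∈ L' u → x ∈ L u := by
    intro u x hx
    simp only [hL'] at hx
    split_ifs at hx
    · exact hx
    · simp at hx
  have hL'eq : ∀ u ∈ U, L' u = L u := fun u hu => by simp only [hL', if_pos hu]
  have hc' : IsPartialCover G H L' :=
    ⟨fun h1 h2 => hc.eq_of_mem (hL'sub _ _ h1) (hL'sub _ _ h2),
      fun h1 h2 => hc.adj_of_adj (hL'sub _ _ h1) (hL'sub _ _ h2),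
      fun h1 h2 => hc.clique (hL'sub _ _ h1) (hL'sub _ _ h2),
      fun h h1 h2 h3 => hc.matching h (hL'sub _ _ h1) (hL'sub _ _ h2) (hL'sub _ _ h3)⟩
  refine hc.exists_transversal_of_card_lt hW (A := U) ?_ (fun u hu => by
    by_contra h
    exact hu (Finset.mem_filter.2 ⟨Finset.mem_univ u, not_lt.1 h⟩))
  intro hne
  have hΔ7 : Real.exp (-(7 * Real.log Δ)) = ((Δ : ℝ) ^ 7)⁻¹ := by
    rw [Real.exp_neg, mul_comm, Real.exp_mul, Real.exp_log (by linarith)]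
    norm_cast
  have hρ : ℓ / 8 * lam * Real.exp (-1) * (1 + lam) ^ (-(a + 1)) ≥ 7 * Real.log Δ := by
    have h1 : Real.exp (-3) ≤ Real.exp (-1) * (1 + lam) ^ (-(a + 1)) := by
      calc Real.exp (-3) ≤ Real.exp (-1) * Real.exp (-(2 * η)) := by
            rw [← Real.exp_add]
            exact Real.exp_le_exp.2 (by linarith)
        _ ≤ _ := by gcongr
    have h2 : (1 : ℝ) / 21 ≤ Real.exp (-3) := by
      rw [Real.exp_neg, ← one_div]
      exact one_div_le_one_div_of_le (Real.exp_pos 3) exp_three_le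
    have h3 : ℓ / 8 * lam = 160 * Real.log Δ := by
      rw [hℓ, hlam]
      field_simp
      norm_num
    rw [mul_assoc, h3]
    have := mul_le_mul_of_nonneg_left (h2.trans h1) (show 0 ≤ 160 * Real.log Δ by positivity)
    refine le_trans ?_ this
    linarith
  -- Each kind of failure has probability at most `Δ ^ (-6)`. With `D = Δ ^ 2 * (Δ + 1)` the local
  -- lemma needs `8 * (Δ + 1) ≤ Δ ^ 4`, true for `Δ ≥ 3`.
  obtain ⟨I, hI, hgood⟩ := hc'.exists_forall_not_bad (lam := lam) (ℓ := ℓ)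
    (p := 2 * ((Δ : ℝ) ^ 6)⁻¹) (D := Δ * ((Δ + 1) * Δ)) hl ha0 ha hρ U (by
      intro u hu
      obtain ⟨w, hw, hw0, hq⟩ := hL u
      have hcard := (Finset.mem_filter.1 hu).2.trans (hdeg u)
      set d := (Finset.univ.filter (fun v => G.Adj u v)).card
      set κ := 1 - Real.exp (-1) with hκ
      have hκ0 : 0 ≤ κ := by linarith [exp_neg_one_le]
      have hκ1 : κ ≤ 1 := by linarith [Real.exp_pos (-1)]
      -- With `c = exp (-3η)` this gives `θ * c = κ * exp (-w)`. The lower bound on `w` ensures `θ ≤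
      -- η`, so `exp (-θ) * (1 + lam) ^ (-(a + 1))` is at least `c`.
      set θ := κ * Real.exp (-w) * Real.exp (3 * η) with hθ
      have hθ0 : 0 ≤ θ := by positivity
      have hθη : θ ≤ η := by
        have h1 : Real.exp (-w) * Real.exp (3 * η) ≤ η := by
          rw [← Real.exp_add, ← Real.le_log_iff_exp_le hη]
          linarith
        calc θ = κ * (Real.exp (-w) * Real.exp (3 * η)) := by rw [hθ]; ring
          _ ≤ 1 * η := by gcongr
          _ = η := one_mul η
      refine ⟨θ, Real.exp (-(κ * (1 + w) * Real.exp (-w))), hθ0, (Real.exp_pos _).le,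
        fun F hF => hcSum_tilt_le (c := Real.exp (-(3 * η))) hl hθ0 ha0 ?_ ?_ hF, ?_⟩
      · calc Real.exp (-(3 * η)) ≤ Real.exp (-θ) * Real.exp (-(2 * η)) := by
              rw [← Real.exp_add]
              exact Real.exp_le_exp.2 (by linarith)
          _ ≤ _ := by gcongr
      · have : Real.exp (3 * η) * Real.exp (-(3 * η)) = 1 := by rw [← Real.exp_add]; simp
        rw [hθ, mul_assoc, this, mul_one]
      · rw [hL'eq u hu, ← Real.exp_nat_mul, ← Real.exp_add]
        have h1 := failure_probability_le (d := d) (q := (L u).card) hη hK hlog.le hℓ hη1 hw (by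
          refine le_trans (le_of_eq ?_) hq
          have : K * Real.log Δ ≠ 0 := by positivity
          rw [hℓ]
          field_simp
          ring)
        have h2 : Real.exp (ℓ + θ * d + (L u).card * -(κ * (1 + w) * Real.exp (-w))) ≤
            ((Δ : ℝ) ^ 7)⁻¹ := by
          rw [← hΔ7]
          apply Real.exp_le_exp.2
          rw [hθ]
          linarith
        have h3 : ((L u).card : ℝ) ≤ Δ := by exact_mod_cast hcard
        rw [hΔ7]
        have h4 : (Δ : ℝ) * ((Δ : ℝ) ^ 7)⁻¹ = ((Δ : ℝ) ^ 6)⁻¹ := by field_simp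
        have h5 : ((Δ : ℝ) ^ 7)⁻¹ ≤ ((Δ : ℝ) ^ 6)⁻¹ :=
          inv_anti₀ (by positivity) (pow_le_pow_right₀ (by linarith) (by norm_num))
        have h6 : ((L u).card : ℝ) * ((Δ : ℝ) ^ 7)⁻¹ ≤ Δ * ((Δ : ℝ) ^ 7)⁻¹ := by gcongr
        linarith)
    (by positivity) (Nat.one_le_iff_ne_zero.2 (by positivity)) (by
      push_cast
      have h1 : 4 * (2 * ((Δ : ℝ) ^ 6)⁻¹) * (Δ * ((Δ + 1) * Δ)) = 8 * (Δ + 1) / (Δ : ℝ) ^ 4 := by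
        field_simp
        norm_num
      rw [h1, div_le_one (by positivity)]
      have h2 : (27 : ℝ) ≤ (Δ : ℝ) ^ 3 := by
        calc (27 : ℝ) = 3 ^ 3 := by norm_num
          _ ≤ _ := by gcongr
      have h3 : (Δ : ℝ) ^ 4 = Δ ^ 3 * Δ := by ring
      rw [h3]
      nlinarith)
    (card_depSet_le hdeg)
  obtain ⟨f, hf1, hf2⟩ := hc'.exists_transversal_of_not_bad hℓ0 hI hgood hne
  exact ⟨f, fun u hu => hL'sub _ _ (hf1 u hu), hf2⟩

end IsPartialCover

lemma Cover.isPartialCover {V W : Type*} {G : SimpleGraph V} (C : G.Cover W) :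
    IsPartialCover G C.H C.L where
  eq_of_mem h1 h2 := (C.partition _).unique h1 h2
  adj_of_adj h1 h2 h := C.adj_of_adj _ _ _ _ h1 h2 h
  clique h1 h2 hne := C.isClique _ h1 h2 hne
  matching h h1 h2 h3 := C.matching _ _ h _ h1 _ h2 _ h3

lemma Cover.colourable_of_transversal (C : G.Cover W) {f : V → W} (hf : ∀ u, f u ∈ C.L u)
    (hadj : ∀ u v, u ≠ v → ¬ C.H.Adj (f u) (f v)) : C.Colourable := by
  have hinj : Function.Injective f := fun u v h =>
    C.isPartialCover.eq_of_mem (hf u) (h ▸ hf v)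
  refine ⟨Finset.univ.image f, ?_, by rw [Finset.card_image_of_injective _ hinj, Finset.card_univ]⟩
  rw [isIndepSet_coe_iff]
  intro x hx y hy
  obtain ⟨u, -, rfl⟩ := Finset.mem_image.1 hx
  obtain ⟨v, -, rfl⟩ := Finset.mem_image.1 hy
  by_cases h : u = v
  · rw [h]; exact C.H.loopless.irrefl _
  · exact hadj u v h

end Correspondence

theorem local_correspondence_colouring {ε : ℝ} (hε : 0 < ε) : ∃ (δ₀ : ℝ) (Δ₀ : ℕ), 1 < δ₀ ∧
    ∀ (V : Type u) [Fintype V] (G : SimpleGraph V) [DecidableRel G.Adj]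
      (k : ℕ) (t : ℝ), 3 ≤ k → 1 / 2 ≤ t → G.NbhdPathCountLE k t →
    Δ₀ ≤ G.maxDegree →
    ∀ (W : Type v) (C : G.Cover W),
      (∀ a : V,
        (1 + ε) *
          max ((G.degree a : ℝ) /
              Real.log ((G.degree a : ℝ) / (((k : ℝ) + √t) * Real.log G.maxDegree)))
            (δ₀ / Real.log δ₀ * ((k : ℝ) + √t) * Real.log G.maxDegree)
          ≤ ((C.L a).card : ℝ)) →
      C.Colourable := by
  classical
  obtain ⟨η, hη, hη1, h⟩ := exists_balance hε
  obtain ⟨δ₀, hδ, h⟩ := h (3840 / η) (by positivity) (3 * η - Real.log η)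
  refine ⟨δ₀, 3, hδ, fun V _ G _ k t hk ht hG hΔ W C hL => ?_⟩
  obtain ⟨ha0, haK, hK⟩ := pathDensity_bounds hk ht
  have hK0 : (0 : ℝ) < (k : ℝ) + √t := by linarith
  have hd := hG.localDensityLE hk (by linarith)
  have hV : Nonempty V := by
    by_contra hne
    rw [not_nonempty_iff] at hne
    have : G.maxDegree = 0 := by simp
    omega
  have hΔ' : (3 : ℝ) ≤ G.maxDegree := by exact_mod_cast hΔ
  have hlog : 0 < Real.log G.maxDegree := Real.log_pos (by linarith)
  obtain ⟨f, hf1, hf2⟩ := C.isPartialCover.exists_transversal_of_balance hη hη1 hK ha0 haK hd hΔ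
    (fun u => by
      refine le_trans (le_of_eq ?_) (G.degree_le_maxDegree u)
      rw [← card_filter_adj_eq_degree]
      congr!)
    (fun u => by
      obtain ⟨w, hw, hw0, hb⟩ := exists_balance_max h hε
        (Λ := ((k : ℝ) + √t) * Real.log G.maxDegree) (d := (G.degree u : ℝ)) (by positivity)
      refine ⟨w, hw, hw0, le_trans ?_ (hL u)⟩
      rw [mul_assoc (δ₀ / Real.log δ₀)]
      refine le_trans (le_of_eq ?_) hb
      rw [← card_filter_adj_eq_degree]
      congr!)
  exact C.colourable_of_transversal hf1 hf2

theorem corrChromaticNumber_asymptotic (k : ℕ → ℕ) (t : ℕ → ℝ) (hk : ∀ Δ, 3 ≤ k Δ)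
    (ht : ∀ Δ, 1 / 2 ≤ t Δ)
    (hlim : Tendsto (fun Δ : ℕ => Real.log ((k Δ : ℝ) + √(t Δ)) / Real.log (Δ : ℝ)) atTop (𝓝 0)) :
    ∃ err : ℕ → ℝ, Tendsto err atTop (𝓝 0) ∧ ∀ᶠ Δ : ℕ in atTop,
      ∀ (V : Type u) [Fintype V] (G : SimpleGraph V) [DecidableRel G.Adj],
        G.maxDegree = Δ → G.NbhdPathCountLE (k Δ) (t Δ) →
        (G.corrChromaticNumber : ℝ) ≤ (1 + err Δ) * ((Δ : ℝ) / Real.log (Δ : ℝ)) := by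
  classical
  let P : ℕ → ℝ → Prop := fun Δ ε => 0 ≤ (Δ : ℝ) / Real.log (Δ : ℝ) ∧
    ∀ (V : Type u) [Fintype V] (G : SimpleGraph V) [DecidableRel G.Adj],
        G.maxDegree = Δ → G.NbhdPathCountLE (k Δ) (t Δ) →
        (G.corrChromaticNumber : ℝ) ≤ (1 + ε) * ((Δ : ℝ) / Real.log (Δ : ℝ))
  suffices hP : ∀ ε : ℝ, 0 < ε → ∀ᶠ Δ in atTop, P Δ ε by
    have hmono : ∀ Δ ε ε', ε ≤ ε' → P Δ ε → P Δ ε' := fun Δ ε ε' hle h =>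
      ⟨h.1, fun V _ G _ h1 h2 => (h.2 V G h1 h2).trans
        (mul_le_mul_of_nonneg_right (by linarith) h.1)⟩
    obtain ⟨err, herr, hP⟩ := exists_tendsto_zero_of_eventually hmono hP
    exact ⟨err, herr, hP.mono fun Δ h => h.2⟩
  intro ε hε
  obtain ⟨η, hη, hη1, h⟩ := exists_balance (show 0 < ε / 4 by linarith)
  obtain ⟨δ₀, hδ, h⟩ := h (3840 / η) (by positivity) (3 * η - Real.log η)
  -- Both `log K` and `log log Δ` may cost `τ * log Δ` in the denominator. This `τ` turns the factor
  -- `1 + ε / 4` into at most `1 + ε / 2`; the other `ε / 2` pays for rounding up to the integer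
  -- `q`.
  set τ := ε / (8 * (1 + ε)) with hτ
  have hτ0 : 0 < τ := by positivity
  have hτε : (1 + ε / 4) ≤ (1 + ε / 2) * (1 - 2 * τ) := by
    have h1 : τ * (8 * (1 + ε)) = ε := by rw [hτ]; field_simp
    nlinarith
  have hτ1 : τ < 1 / 4 := by
    rw [hτ, div_lt_iff₀ (by positivity)]
    linarith
  have hlogN : Tendsto (fun Δ : ℕ => Real.log (Δ : ℝ)) atTop atTop :=
    Real.tendsto_log_atTop.comp tendsto_natCast_atTop_atTop
  have hlogo : ∀ {s : ℝ}, 0 < s → ∀ᶠ y : ℝ in atTop, Real.log y ≤ s * y := by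
    intro s hs
    filter_upwards [Real.isLittleO_log_id_atTop.bound hs, eventually_ge_atTop 1] with y hy hy1
    rw [Real.norm_eq_abs, Real.norm_eq_abs, id, abs_of_nonneg (Real.log_nonneg hy1),
      abs_of_nonneg (by linarith)] at hy
    exact hy
  filter_upwards [eventually_ge_atTop 3, hlogN.eventually (hlogo hτ0),
    tendsto_natCast_atTop_atTop.eventually (hlogo (show 0 < ε / 2 by linarith)),
    hlim.eventually_le_const hτ0, hlogN.eventually_ge_atTop (2 * Real.log δ₀)]
    with Δ hΔ hloglog hlogΔ hKlog hlogδ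
  have hΔ' : (3 : ℝ) ≤ Δ := by exact_mod_cast hΔ
  have hlog : 0 < Real.log (Δ : ℝ) := Real.log_pos (by linarith)
  obtain ⟨ha0, haK, hK⟩ := pathDensity_bounds (hk Δ) (ht Δ)
  have hK0 : (0 : ℝ) < (k Δ : ℝ) + √(t Δ) := by linarith
  refine ⟨by positivity, fun V _ G _ hmax hG => ?_⟩
  have hd := hG.localDensityLE (hk Δ) (by linarith [ht Δ])
  set a := (k Δ : ℝ) - 3 + √(2 * t Δ)
  set K := (k Δ : ℝ) + √(t Δ)
  rw [div_le_iff₀ hlog] at hKlog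
  set Λ := K * Real.log Δ with hΛ
  have hΛ0 : 0 < Λ := by positivity
  set x := (Δ : ℝ) / Λ with hx
  have hx0 : 0 < x := by positivity
  have hlogx : (1 - 2 * τ) * Real.log Δ ≤ Real.log x := by
    rw [hx, Real.log_div (by linarith) hΛ0.ne', hΛ, Real.log_mul hK0.ne' hlog.ne']
    linarith
  have hlogx0 : 0 < Real.log x := lt_of_lt_of_le (by
    have : 0 < 1 - 2 * τ := by linarith
    positivity) hlogx
  have hxδ : δ₀ ≤ x := by
    rw [← Real.log_le_log_iff (by linarith) hx0]
    have : 1 / 2 * Real.log Δ ≤ (1 - 2 * τ) * Real.log Δ := by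
      apply mul_le_mul_of_nonneg_right _ hlog.le
      linarith
    linarith
  obtain ⟨w, hw, hw0, hb⟩ := h x hxδ
  have hbound : (1 + ε / 4) * (Δ / Real.log x) ≤ (1 + ε / 2) * (Δ / Real.log Δ) := by
    rw [mul_div_assoc', mul_div_assoc', div_le_div_iff₀ hlogx0 hlog]
    have h1 : (1 + ε / 4) * Real.log Δ ≤ (1 + ε / 2) * Real.log x := by
      calc (1 + ε / 4) * Real.log Δ ≤ (1 + ε / 2) * (1 - 2 * τ) * Real.log Δ := by gcongr
        _ = (1 + ε / 2) * ((1 - 2 * τ) * Real.log Δ) := by ring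
        _ ≤ _ := by gcongr
    nlinarith
  have hone : 1 ≤ ε / 2 * (Δ / Real.log Δ) := by
    rw [mul_div_assoc', le_div_iff₀ hlog, one_mul]
    exact hlogΔ
  set q := ⌈(1 + ε / 4) * (Δ / Real.log x)⌉₊ with hq
  have hqle : (1 + ε / 4) * (Δ / Real.log x) ≤ q := Nat.le_ceil _
  have hqlt : (q : ℝ) < (1 + ε / 4) * (Δ / Real.log x) + 1 := Nat.ceil_lt_add_one (by positivity)
  have hsInf : G.corrChromaticNumber ≤ q := by
    refine Nat.sInf_le fun W C hC => ?_
    have hV : Nonempty V := by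
      by_contra hne
      rw [not_nonempty_iff] at hne
      have : G.maxDegree = 0 := by simp
      omega
    have hdeg : ∀ u, (Finset.univ.filter (fun v => G.Adj u v)).card ≤ Δ := fun u => by
      rw [card_filter_adj_eq_degree, ← hmax]
      exact G.degree_le_maxDegree u
    obtain ⟨f, hf1, hf2⟩ := C.isPartialCover.exists_transversal_of_balance hη hη1 hK ha0 haK hd hΔ
      (fun u => by convert hdeg u)
      (fun u => by
        refine ⟨w, hw, hw0, ?_⟩
        rw [hC u]
        refine le_trans ?_ hqle
        have h1 : Real.exp (3 * η) * (((Finset.univ.filter (fun v => G.Adj u v)).card : ℝ) / Λ) ≤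
            Real.exp (3 * η) * x := by
          have : ((Finset.univ.filter (fun v => G.Adj u v)).card : ℝ) ≤ Δ := by
            exact_mod_cast hdeg u
          rw [hx]
          gcongr
        calc _ ≤ Λ * ((Real.exp (3 * η) * x + 3840 / η * Real.exp w) / (1 + w)) := by
              refine mul_le_mul_of_nonneg_left ?_ hΛ0.le
              refine div_le_div_of_nonneg_right ?_ (by linarith)
              refine add_le_add ?_ le_rfl
              refine le_trans (le_of_eq ?_) h1
              congr!
          _ ≤ Λ * ((1 + ε / 4) * (x / Real.log x)) := mul_le_mul_of_nonneg_left hb hΛ0.le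
          _ = _ := by rw [hx]; field_simp)
    exact C.colourable_of_transversal hf1 hf2
  have : (G.corrChromaticNumber : ℝ) ≤ q := by exact_mod_cast hsInf
  linarith

end SimpleGraph

theorem theorem5p7 :
    -- occupancy fraction
    (∀ (V : Type u) [Fintype V] [Nonempty V] (G : SimpleGraph V) [DecidableRel G.Adj]
        (k : ℕ) (t : ℝ), 3 ≤ k → 1 / 2 ≤ t → G.NbhdPathCountLE k t →
      ∀ lam : ℝ, 0 < lam →
        ∃ M : ℝ,
          IsGreatest
            ((fun x : ℝ => x / (1 + x) *
              lambertRatio ((G.maxDegree : ℝ) * (1 + x) ^ ((k : ℝ) - 3 + √(2 * t)) *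
                Real.log (1 + x))) '' Set.Icc 0 lam) M ∧
          M ≤ G.occupancyFraction lam) ∧
    -- local fractional colouring
    (∀ ε : ℝ, 0 < ε → ∃ δ₀ : ℝ, 1 < δ₀ ∧
      ∀ (V : Type u) [Fintype V] (G : SimpleGraph V) [DecidableRel G.Adj]
        (k : ℕ) (t : ℝ), 3 ≤ k → 1 / 2 ≤ t → G.NbhdPathCountLE k t →
      ∃ (q : ℝ) (w : Finset V → Set ℝ), G.IsFractionalColouring q w ∧
        ∀ a : V, SimpleGraph.fractionalColours w a ⊆
          Set.Ico 0 ((1 + ε) *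
            max ((G.degree a : ℝ) / Real.log ((G.degree a : ℝ) / ((k : ℝ) + √t)))
              (δ₀ / Real.log δ₀ * ((k : ℝ) + √t)))) ∧
    -- fractional chromatic number
    (∀ (k : ℕ → ℕ) (t : ℕ → ℝ), (∀ Δ, 3 ≤ k Δ) → (∀ Δ, 1 / 2 ≤ t Δ) →
      Tendsto (fun Δ : ℕ => (Δ : ℝ) / ((k Δ : ℝ) + √(t Δ))) atTop atTop →
      ∃ err : ℕ → ℝ, Tendsto err atTop (𝓝 0) ∧ ∀ᶠ Δ : ℕ in atTop,
        ∀ (V : Type u) [Fintype V] (G : SimpleGraph V) [DecidableRel G.Adj],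
          G.maxDegree = Δ → G.NbhdPathCountLE (k Δ) (t Δ) →
          G.fracChromaticNumber ≤
            (1 + err Δ) * ((Δ : ℝ) / Real.log ((Δ : ℝ) / ((k Δ : ℝ) + √(t Δ))))) ∧
    -- local correspondence colouring
    (∀ ε : ℝ, 0 < ε → ∃ (δ₀ : ℝ) (Δ₀ : ℕ), 1 < δ₀ ∧
      ∀ (V : Type u) [Fintype V] (G : SimpleGraph V) [DecidableRel G.Adj]
        (k : ℕ) (t : ℝ), 3 ≤ k → 1 / 2 ≤ t → G.NbhdPathCountLE k t →
      Δ₀ ≤ G.maxDegree →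
      ∀ (W : Type v) (C : G.Cover W),
        (∀ a : V,
          (1 + ε) *
            max ((G.degree a : ℝ) /
                Real.log ((G.degree a : ℝ) / (((k : ℝ) + √t) * Real.log G.maxDegree)))
              (δ₀ / Real.log δ₀ * ((k : ℝ) + √t) * Real.log G.maxDegree)
            ≤ ((C.L a).card : ℝ)) →
        C.Colourable) ∧
    -- correspondence chromatic number
    (∀ (k : ℕ → ℕ) (t : ℕ → ℝ), (∀ Δ, 3 ≤ k Δ) → (∀ Δ, 1 / 2 ≤ t Δ) →
      Tendsto (fun Δ : ℕ => Real.log ((k Δ : ℝ) + √(t Δ)) / Real.log (Δ : ℝ)) atTop (𝓝 0) →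
      ∃ err : ℕ → ℝ, Tendsto err atTop (𝓝 0) ∧ ∀ᶠ Δ : ℕ in atTop,
        ∀ (V : Type u) [Fintype V] (G : SimpleGraph V) [DecidableRel G.Adj],
          G.maxDegree = Δ → G.NbhdPathCountLE (k Δ) (t Δ) →
          (G.corrChromaticNumber : ℝ) ≤ (1 + err Δ) * ((Δ : ℝ) / Real.log (Δ : ℝ))) := by
  refine ⟨?_, fun ε hε => SimpleGraph.local_fractional_colouring hε,
    SimpleGraph.fracChromaticNumber_asymptotic,
    fun ε hε => SimpleGraph.local_correspondence_colouring hε,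
    SimpleGraph.corrChromaticNumber_asymptotic⟩
  intro V _ _ G _ k t hk ht hG lam hl
  exact (hG.localDensityLE hk (by linarith)).exists_isGreatest_le_occupancyFraction hl
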